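/- **Setting.** Consider a junction at $x=0$ with $n$ incoming roads $i$ (half-lines $x<0$) and $m$ outgoing roads $j$ (half-lines $x>0$), with constant initial data $(\rho_{r,0},w_{r,0})$ on each road $r$. On incoming road $i$ the pressure is $p_i$, with $p_i$ continuous on $[0,\infty)$, $C^2$ on $(0,\infty)$, $p_i(0)=0$, $p_i'>0$, $2p_i'+\rho p_i''>0$ for $\rho>0$, and such that $\rho\mapsto\rho(w-p_i(\rho))$ has a unique maximum point on $[0,\infty)$ for every $w>0$. On outgoing road $j$ the initial pressure is $p_{j,0}(\rho)=c_{j,0}\rho^\gamma$ with $c_{j,0}>0$, $\gamma\ge1$. Assume $\rho_{i,0}\ge 0$, $w_{i,0}>0$ on incoming roads, $\rho_{j,0}>0$ on outgoing roads, and nonnegative initial velocities, $w_{i,0}\ge p_i(\rho_{i,0})$ and $v_{j,0}:=w_{j,0}-p_{j,0}(\rho_{j,0})\ge 0$. Let $\alpha_{ji}\ge0$ with $\sum_j\alpha_{ji}=1$ and $\beta_{ij}\ge0$ with $\sum_i\beta_{ij}=1$ be given, and put $\overline{w_j}=\sum_i\beta_{ij}w_{i,0}$. **Approximated homogenized pressure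 (H4\*).** Let $P_j(\tau)=p_{j,0}(1/\tau)$. A function $p_j^{**}$ is the approximated homogenized pressure of road $j$ if $p_j^{**}=c\,p_{j,0}$ on $[0,\infty)$ with a constant $c$ and the relation $p_j^{**}(1/\tau)=\overline{w_j}-v$, with $\tau=\sum_i\beta_{ij}P_j^{-1}(w_{i,0}-v)$, holds at $v=0$. **Admissible fluxes.** For a pressure $p$ let $\sigma(w)$ be the maximum point of $\rho(w-p(\rho))$, let $d(p;\rho,w)$ be $\rho(w-p(\rho))$ if $\rho\le\sigma(w)$ and $\sigma(w)(w-p(\sigma(w)))$ otherwise, and let $s(p;\rho,w)$ be the same with the two cases interchanged. Fluxes $q_{ji}\ge0$ with $q_i=\sum_jq_{ji}$, $q_j=\sum_iq_{ji}$ are admissible if (H1\*) $0\le q_i\le d(p_i;\rho_{i,0},w_{i,0})$ and $0\le q_j\le s(p_j^{**};\tilde\rho_j,\overline{w_j})$, where $\tilde\rho_j\ge0$ solves $\overline{w_j}-p_j^{**}(\tilde\rho_j)=v_{j,0}$, or $\tilde\rho_j=0$ if there is no solution; (H2) $q_{ji}=\alpha_{ji}q_i$; (H3) for each $j$ there is $z_j\in\mathbb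 R$ with $q_{ji}=z_j\beta_{ij}$ for all $i$ (so $\beta_{ij}=q_{ji}/q_j$ whenever $q_j\neq0$). **Network solution.** A network solution consists of pressures $p_j^{**}$ satisfying (H4\*) and bounded measurable functions $(\rho_r,w_r)(x,t)$, $\rho_r\ge0$, depending only on $x/t$, such that, with $v_r=w_r-p(\rho_r)$, where $p=p_i$ on incoming road $i$, $p=p_j^{**}$ on outgoing road $j$ for $0<x<tv_{j,0}$ and $p=p_{j,0}$ for $x>tv_{j,0}$: 1. for $(u,f,u_0)=(\rho,\rho v,\rho_0)$ and $(\rho w,\rho wv,\rho_0w_0)$, and all smooth compactly supported $\varphi_r$ with $\varphi_i(0,t)=\varphi_j(0,t)$ for all $t\ge0$ and all incoming $i$ and outgoing $j$, $$\sum_r\Big(\int_0^\infty\!\!\int \big[u_r\,\partial_t\varphi_r+f_r\,\partial_x\varphi_r\big]dx\,dt+\int u_{r,0}\,\varphi_r(x,0)\,dx\Big)=0,$$ the $x$-integrals being over the half-line of road $r$; 2. (entropy) for every $t>0$, at every point of the open half-lines $\rho_r,w_r,v_r$ have one-sided limits, and if the left limit of $\rho_r$ is positive then so is the right one, and the right limit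 of $v_r$ is at most the left one; 3. $w_j=\overline{w_j}$ for $0<x<tv_{j,0}$ on every outgoing road $j$; 4. there are fluxes $q_{ji}$ that maximize $\sum_iq_i$ among all admissible fluxes and satisfy $(\rho_iv_i)(0-,t)=q_i$, $(\rho_jv_j)(0+,t)=q_j$ for all $i,j$ and $t>0$. **Claim.** There exists a network solution, and it is unique: any two have the same $(\rho_r,\rho_rw_r)$ (for every $t>0$, almost everywhere in $x$, on every road) and the same $p_j^{**}$ on $[0,\infty)$. Moreover, for each outgoing road $j$ the approximated homogenized pressure is exactly $$p_j^{**}(\rho)=c_{j,0}\Big(\sum_{i=1}^n\beta_{ij}w_{i,0}\Big(\sum_{l=1}^n\frac{\beta_{lj}}{w_{l,0}^{1/\gamma}}\Big)^{\gamma}\Big)\rho^\gamma,\qquad\rho\ge0.$$ -/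

import Mathlib

open Filter Topology MeasureTheory Set
open scoped ContDiff

noncomputable section

namespace TrafficNetwork

/-- `σ` is the unique maximiser on `[0, ∞)` of the flux `ρ ↦ ρ (w - p ρ)`. -/
def IsFluxMax (p : ℝ → ℝ) (w σ : ℝ) : Prop :=
  0 ≤ σ ∧ ∀ r, 0 ≤ r → r ≠ σ → r * (w - p r) < σ * (w - p σ)

/-- The density `σ(w)` at which the flux `ρ (w - p ρ)` is maximal. -/
def sigma (p : ℝ → ℝ) (w : ℝ) : ℝ := Classical.epsilon (IsFluxMax p w)

/-- The demand function `d(p; ρ, w)`. -/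
def demand (p : ℝ → ℝ) (ρ w : ℝ) : ℝ :=
  if ρ ≤ sigma p w then ρ * (w - p ρ) else sigma p w * (w - p (sigma p w))

/-- The supply function `s(p; ρ, w)`. -/
def supply (p : ℝ → ℝ) (ρ w : ℝ) : ℝ :=
  if ρ ≤ sigma p w then sigma p w * (w - p (sigma p w)) else ρ * (w - p ρ)

open Classical in
/-- The density `ρ̃` at which the curves `{v + p ρ = w}` and `{velocity = v}` intersect, and `0` if
they do not intersect. -/
def rhoTilde (p : ℝ → ℝ) (w v : ℝ) : ℝ :=
  if h : ∃ r, 0 ≤ r ∧ w - p r = v then h.choose else 0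

/-- A pressure law of the Aw-Rascle-Zhang model: no pressure at vacuum, `p' > 0` (so that
`λ₁ = v - ρ p' < v = λ₂` away from vacuum), a genuinely nonlinear first field, and a flux
`ρ (w - p ρ)` with a unique maximum for every `w > 0`. -/
structure IsPressureLaw (p : ℝ → ℝ) : Prop where
  zero : p 0 = 0
  continuousOn : ContinuousOn p (Ici 0)
  contDiffOn : ContDiffOn ℝ 2 p (Ioi 0)
  deriv_pos : ∀ ρ, 0 < ρ → 0 < deriv p ρ
  genuinely_nonlinear : ∀ ρ, 0 < ρ → 0 < 2 * deriv p ρ + ρ * deriv (deriv p) ρ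
  exists_max : ∀ w, 0 < w → ∃ σ, IsFluxMax p w σ

/-- `τ` is the homogenized specific volume at velocity `v`, that is
`τ = ∑ i, β i * P⁻¹ (w i - v)` where `P τ = p (1 / τ)`. The (exact) homogenized pressure `p*` is
characterised by `p* (1 / τ) = ∑ i, β i * w i - v` for all `v` and the corresponding `τ`. -/
def IsHomogenizedVolume {n : ℕ} (p : ℝ → ℝ) (β w : Fin n → ℝ) (v τ : ℝ) : Prop :=
  ∃ T : Fin n → ℝ, (∀ i, 0 < T i ∧ p (1 / T i) = w i - v) ∧ τ = ∑ i, β i * T i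

/-- `P` is the approximated homogenized pressure `p**`: it is of the form `c * p` with a constant
`c`, and it satisfies the defining relation of the homogenized pressure at `v = 0`. -/
def IsApproxHomogenizedPressure {n : ℕ} (p : ℝ → ℝ) (β w : Fin n → ℝ) (P : ℝ → ℝ) : Prop :=
  (∃ c : ℝ, ∀ ρ, 0 ≤ ρ → P ρ = c * p ρ) ∧
    ∀ τ, IsHomogenizedVolume p β w 0 τ → P (1 / τ) = ∑ i, β i * w i - 0

/-- A junction at `x = 0` with `n` incoming roads `(-∞, 0)`, indexed by `Sum.inl`, and `m` outgoing
roads `(0, ∞)`, indexed by `Sum.inr`, together with constant initial data on each road. -/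
structure Junction (n m : ℕ) where
  /-- pressure laws of the incoming roads -/
  pin : Fin n → ℝ → ℝ
  /-- the exponent of the pressure laws of the outgoing roads -/
  γ : ℝ
  /-- the coefficients of the initial pressure laws of the outgoing roads -/
  c₀ : Fin m → ℝ
  /-- initial densities -/
  ρ₀ : Fin n ⊕ Fin m → ℝ
  /-- initial Lagrangian markers -/
  w₀ : Fin n ⊕ Fin m → ℝ
  /-- traffic distribution matrix: `α j i` is the share of road `i` that goes to road `j` -/
  α : Fin m → Fin n → ℝ
  /-- priorities: `β i j` is the share of the traffic entering road `j` that comes from road `i` -/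
  β : Fin n → Fin m → ℝ
  pin_law : ∀ i, IsPressureLaw (pin i)
  one_le_γ : 1 ≤ γ
  c₀_pos : ∀ j, 0 < c₀ j
  ρ₀_in_nonneg : ∀ i, 0 ≤ ρ₀ (Sum.inl i)
  ρ₀_out_pos : ∀ j, 0 < ρ₀ (Sum.inr j)
  w₀_in_pos : ∀ i, 0 < w₀ (Sum.inl i)
  /-- initial velocities are nonnegative -/
  v₀_in_nonneg : ∀ i, pin i (ρ₀ (Sum.inl i)) ≤ w₀ (Sum.inl i)
  v₀_out_nonneg : ∀ j, c₀ j * ρ₀ (Sum.inr j) ^ γ ≤ w₀ (Sum.inr j)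
  α_nonneg : ∀ j i, 0 ≤ α j i
  α_sum : ∀ i, ∑ j, α j i = 1
  β_nonneg : ∀ i j, 0 ≤ β i j
  β_sum : ∀ j, ∑ i, β i j = 1

/-- A candidate solution: density and Lagrangian marker on each road as functions of `(x, t)`, and
the approximated homogenized pressure `p**` on each outgoing road. -/
structure NetworkState (n m : ℕ) where
  ρ : Fin n ⊕ Fin m → ℝ → ℝ → ℝ
  w : Fin n ⊕ Fin m → ℝ → ℝ → ℝ
  P : Fin m → ℝ → ℝ

/-- The interior of the road `r`. -/
def road {n m : ℕ} : Fin n ⊕ Fin m → Set ℝ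
  | Sum.inl _ => Iio 0
  | Sum.inr _ => Ioi 0

/-- Test functions that are compatible across the junction. -/
def IsTestFamily {n m : ℕ} (φ : Fin n ⊕ Fin m → ℝ → ℝ → ℝ) : Prop :=
  (∀ r, ContDiff ℝ ∞ (Function.uncurry (φ r)) ∧ HasCompactSupport (Function.uncurry (φ r))) ∧
    ∀ i j t, 0 ≤ t → φ (Sum.inl i) 0 t = φ (Sum.inr j) 0 t

/-- Weak form on the whole junction of `∂ₜ u + ∂ₓ f = 0`, `u(x, 0) = u₀`. -/
def IsWeakSolution {n m : ℕ} (u f : Fin n ⊕ Fin m → ℝ → ℝ → ℝ) (u₀ : Fin n ⊕ Fin m → ℝ) : Prop :=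
  ∀ φ, IsTestFamily φ →
    ∑ r, ((∫ t in Ioi (0 : ℝ), ∫ x in road r,
        (u r x t * deriv (fun s => φ r x s) t + f r x t * deriv (fun y => φ r y t) x)) +
      ∫ x in road r, u₀ r * φ r x 0) = 0

/-- Total flux leaving the incoming road `i`. -/
def qin {n m : ℕ} (q : Fin m → Fin n → ℝ) (i : Fin n) : ℝ := ∑ j, q j i

/-- Total flux entering the outgoing road `j`. -/
def qout {n m : ℕ} (q : Fin m → Fin n → ℝ) (j : Fin m) : ℝ := ∑ i, q j i

namespace Junction

variable {n m : ℕ} (J : Junction n m)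

/-- Initial pressure law on the outgoing road `j`. -/
def pout (j : Fin m) (ρ : ℝ) : ℝ := J.c₀ j * ρ ^ J.γ

/-- Initial velocity on the outgoing road `j`. -/
def v₀ (j : Fin m) : ℝ := J.w₀ (Sum.inr j) - J.pout j (J.ρ₀ (Sum.inr j))

/-- Homogenized Lagrangian marker on the outgoing road `j`. By the mixture rule,
`β i j = q j i / qout q j` whenever the flux into road `j` does not vanish. -/
def wbar (j : Fin m) : ℝ := ∑ i, J.β i j * J.w₀ (Sum.inl i)

/-- `P` is the approximated homogenized pressure of the outgoing road `j`. -/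
def IsApproxPressure (j : Fin m) (P : ℝ → ℝ) : Prop :=
  IsApproxHomogenizedPressure (J.pout j) (fun i => J.β i j) (fun i => J.w₀ (Sum.inl i)) P

/-- The fluxes `q j i` from road `i` to road `j` obey the demand and supply bounds, the distribution
rule and the mixture rule. -/
structure IsAdmissibleFlux (P : Fin m → ℝ → ℝ) (q : Fin m → Fin n → ℝ) : Prop where
  nonneg : ∀ j i, 0 ≤ q j i
  demand_bound : ∀ i, 0 ≤ qin q i ∧
    qin q i ≤ demand (J.pin i) (J.ρ₀ (Sum.inl i)) (J.w₀ (Sum.inl i))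
  supply_bound : ∀ j, 0 ≤ qout q j ∧
    qout q j ≤ supply (P j) (rhoTilde (P j) (J.wbar j) (J.v₀ j)) (J.wbar j)
  distribution : ∀ j i, q j i = J.α j i * qin q i
  mixture : ∀ j, ∃ z : ℝ, ∀ i, q j i = z * J.β i j

/-- The pressure law in force at `(x, t)`: the given one on the incoming roads; on an outgoing road
the approximated homogenized pressure for `x < t v₀` and the initial one for `x > t v₀`. -/
def pressureAt (P : Fin m → ℝ → ℝ) : Fin n ⊕ Fin m → ℝ → ℝ → ℝ → ℝ
  | Sum.inl i, _, _ => J.pin i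
  | Sum.inr j, x, t => if x < t * J.v₀ j then P j else J.pout j

/-- The velocity `v = w - p(ρ)`. -/
def velocity (S : NetworkState n m) (r : Fin n ⊕ Fin m) (x t : ℝ) : ℝ :=
  S.w r x t - J.pressureAt S.P r x t (S.ρ r x t)

/-- Entropy admissibility: at every time the state has one-sided limits at every point of a road,
and a jump from a non-vacuum state on the left leads to a non-vacuum state whose velocity is not
larger (smaller across a 1-shock, equal across a contact discontinuity). -/
def IsEntropyAdmissible (S : NetworkState n m) : Prop :=
  ∀ r t, 0 < t → ∀ x ∈ road r, ∃ ρl ρr wl wr vl vr : ℝ,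
    Tendsto (fun y => S.ρ r y t) (𝓝[<] x) (𝓝 ρl) ∧
    Tendsto (fun y => S.ρ r y t) (𝓝[>] x) (𝓝 ρr) ∧
    Tendsto (fun y => S.w r y t) (𝓝[<] x) (𝓝 wl) ∧
    Tendsto (fun y => S.w r y t) (𝓝[>] x) (𝓝 wr) ∧
    Tendsto (fun y => J.velocity S r y t) (𝓝[<] x) (𝓝 vl) ∧
    Tendsto (fun y => J.velocity S r y t) (𝓝[>] x) (𝓝 vr) ∧
    (0 < ρl → 0 < ρr ∧ vr ≤ vl)

/-- Network solution of the Riemann problem at the junction with approximated homogenized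
pressure. -/
structure IsNetworkSolution (S : NetworkState n m) : Prop where
  measurable_ρ : ∀ r, Measurable (Function.uncurry (S.ρ r))
  measurable_w : ∀ r, Measurable (Function.uncurry (S.w r))
  bounded : ∃ M : ℝ, ∀ r, ∀ x ∈ road r, ∀ t, 0 < t → |S.ρ r x t| ≤ M ∧ |S.w r x t| ≤ M
  ρ_nonneg : ∀ r, ∀ x ∈ road r, ∀ t, 0 < t → 0 ≤ S.ρ r x t
  /-- as for every Riemann problem, the solution is a function of `x / t` -/
  self_similar : ∀ r, ∀ x ∈ road r, ∀ t, 0 < t →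
    S.ρ r x t = S.ρ r (x / t) 1 ∧ S.w r x t = S.w r (x / t) 1
  /-- conservation of mass on the roads and through the junction -/
  mass : IsWeakSolution (fun r x t => S.ρ r x t)
    (fun r x t => S.ρ r x t * J.velocity S r x t) J.ρ₀
  /-- conservation of the generalized momentum on the roads and through the junction -/
  momentum : IsWeakSolution (fun r x t => S.ρ r x t * S.w r x t)
    (fun r x t => S.ρ r x t * J.velocity S r x t * S.w r x t) (fun r => J.ρ₀ r * J.w₀ r)
  entropy : J.IsEntropyAdmissible S
  /-- the pressure on the outgoing roads is the approximated homogenized one -/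
  pressure : ∀ j, J.IsApproxPressure j (S.P j)
  /-- the marker of the cars that have crossed the junction is the homogenized one -/
  marker : ∀ j x t, 0 < t → 0 < x → x < t * J.v₀ j → S.w (Sum.inr j) x t = J.wbar j
  /-- the fluxes at the junction maximize the total incoming flux among the admissible ones -/
  flux : ∃ q : Fin m → Fin n → ℝ, J.IsAdmissibleFlux S.P q ∧
    (∀ q', J.IsAdmissibleFlux S.P q' → ∑ i, qin q' i ≤ ∑ i, qin q i) ∧
    (∀ i t, 0 < t → Tendsto (fun x => S.ρ (Sum.inl i) x t * J.velocity S (Sum.inl i) x t)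
      (𝓝[<] 0) (𝓝 (qin q i))) ∧
    (∀ j t, 0 < t → Tendsto (fun x => S.ρ (Sum.inr j) x t * J.velocity S (Sum.inr j) x t)
      (𝓝[>] 0) (𝓝 (qout q j)))

end Junction

end TrafficNetwork

end

/-! For power laws the equation `p (1 / T) = w i` has exactly one positive solution, so there is
exactly one homogenized volume at `v = 0`, and the approximated homogenized pressure is fixed by one
linear equation for its constant (`isApproxPressure_iff`). The admissible fluxes form a nonempty
compact set. Because the coefficients `α`, `β` are nonnegative, this set is closed under
componentwise maxima, so the maximizer of the total incoming flux exists and is unique. What remains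
is one Riemann problem with prescribed boundary flux on each road.

For a self-similar density `R (x / t)` with flux `F (x / t)`, the conservation law on a road says
that `M ξ = F ξ - ξ * R ξ` has a continuous representative with `M' = -R`. The initial value is the
limit of `-M ξ / ξ` at infinity, and the boundary flux is the value of `M` at `0`. Both halves of
the proof work with these potentials for mass and momentum.

Existence: while the marker is constant, the system reduces to a scalar conservation law with
strictly concave flux `r * (w - p r)`. One shock or one rarefaction, given by the maximizers of `f r
- ξ * r`, joins the initial density on an incoming road to a trace with flux `q`. On an outgoing
road it joins such a trace to the state `rhoTilde` behind the contact of speed `v₀`. The demand and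
supply bounds are what keeps the wave speeds of the right sign. At the contact the potential
vanishes from both sides, so the initial state can be attached there. By the mixture rule, the
fluxes of mass and momentum balance at the junction (`exists_isNetworkSolution`).

Uniqueness: any network solution has potentials on each road (`IsWeakSolution.exists_isPotential`),
obtained by a du Bois-Reymond argument in the variable `t / x`. Contact arguments with weights of
linear growth show first that the marker is transported: the momentum potential `N` is `w₀ * M` on
incoming roads, and beyond the contact of an outgoing road. Between the junction and the contact the
marker is prescribed. With equal markers on both sides of a jump, the entropy condition says that
densities jump upwards. If `M₁ - M₂` had a positive maximum, the jump interval of the first solution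
would contain that of the second. The concave function `f r - ξ * r` would then give `M₁ ≤ M₂` at
that point, a contradiction. Beyond the contact a similar comparison with the constant initial state
applies. Equal potentials have equal one-sided derivatives, so the solutions agree outside countably
many rays, hence almost everywhere. -/

namespace TrafficNetwork

/-! ### Regular pressures -/

/-- The properties of a pressure law, as a function on `[0, ∞)`, on which the solution of the
Riemann problem at the junction depends. -/
structure RegularPressure (p : ℝ → ℝ) : Prop where
  zero : p 0 = 0
  continuousOn : ContinuousOn p (Ici 0)
  strictMonoOn : StrictMonoOn p (Ici 0)
  strictConcaveOn : ∀ w, StrictConcaveOn ℝ (Ici 0) fun r => r * (w - p r)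
  unbounded : ∀ K, ∃ r, 0 ≤ r ∧ K ≤ p r

/-- The second derivative of the flux is `-(2 p' + r p'')`, so genuine nonlinearity is exactly
strict concavity. -/
lemma IsPressureLaw.strictConcaveOn {p : ℝ → ℝ} (hp : IsPressureLaw p) (w : ℝ) :
    StrictConcaveOn ℝ (Ici 0) fun r => r * (w - p r) := by
  have hd : ∀ r, 0 < r → HasDerivAt p (deriv p r) r := fun r hr =>
    ((hp.contDiffOn.contDiffAt (Ioi_mem_nhds hr)).differentiableAt (by norm_num)).hasDerivAt
  have hd2 : ∀ r, 0 < r → HasDerivAt (deriv p) (deriv (deriv p) r) r := by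
    intro r hr
    have h1 : ContDiffOn ℝ 1 (deriv p) (Ioi 0) :=
      ((contDiffOn_succ_iff_deriv_of_isOpen (n := 1) isOpen_Ioi).1
        (by rw [one_add_one_eq_two]; exact hp.contDiffOn)).2.2
    exact ((h1.contDiffAt (Ioi_mem_nhds hr)).differentiableAt (by norm_num)).hasDerivAt
  have hf : ∀ r, 0 < r → HasDerivAt (fun r => r * (w - p r)) (w - p r - r * deriv p r) r := by
    intro r hr
    refine ((hasDerivAt_id' r).fun_mul ((hd r hr).const_sub w)).congr_deriv ?_
    ring
  apply strictConcaveOn_of_deriv2_neg (convex_Ici 0)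
  · exact continuousOn_id.mul (continuousOn_const.sub hp.continuousOn)
  · intro r hr
    rw [interior_Ici] at hr
    have hr : 0 < r := hr
    have h2 : HasDerivAt (fun r => w - p r - r * deriv p r)
        (-(2 * deriv p r + r * deriv (deriv p) r)) r := by
      refine (((hd r hr).const_sub w).fun_sub ((hasDerivAt_id' r).fun_mul (hd2 r hr))).congr_deriv ?_
      ring
    have h3 : deriv (fun r => r * (w - p r)) =ᶠ[𝓝 r] fun r => w - p r - r * deriv p r := by
      filter_upwards [Ioi_mem_nhds hr] with y hy using (hf y hy).deriv
    have : deriv^[2] (fun r => r * (w - p r)) r = -(2 * deriv p r + r * deriv (deriv p) r) := by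
      simp only [Function.iterate_succ, Function.iterate_zero, Function.comp, id]
      rw [h3.deriv_eq, h2.deriv]
    rw [this]
    linarith [hp.genuinely_nonlinear r hr]

lemma IsPressureLaw.regular {p : ℝ → ℝ} (hp : IsPressureLaw p) : RegularPressure p where
  zero := hp.zero
  continuousOn := hp.continuousOn
  strictMonoOn := by
    apply strictMonoOn_of_deriv_pos (convex_Ici 0) hp.continuousOn
    intro x hx
    rw [interior_Ici] at hx
    exact hp.deriv_pos x hx
  strictConcaveOn := hp.strictConcaveOn
  unbounded := by
    intro K
    by_contra! h
    have hK : 0 < K := by simpa [hp.zero] using h 0 le_rfl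
    obtain ⟨σ, hσ, hmax⟩ := hp.exists_max (K + 1) (by linarith)
    -- If `p` stayed below `K`, the flux with `w = K + 1` would be at least `r` at every `r`. This
    -- `r` exceeds both the maximal flux and `σ`.
    set r := σ * (K + 1 - p σ) + σ + 1 with hr
    have h0 : 0 ≤ σ * (K + 1 - p σ) := mul_nonneg hσ (by linarith [h σ hσ])
    have h1 := hmax r (by linarith) (by linarith)
    have h2 : r ≤ r * (K + 1 - p r) :=
      le_mul_of_one_le_right (by linarith) (by linarith [h r (by linarith)])
    linarith

/-- The flux is a linear function minus `C * r ^ (γ + 1)`. Since `γ + 1 > 1`, it is strictly concave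
even for `γ = 1`. -/
lemma RegularPressure.of_rpow {p : ℝ → ℝ} {C γ : ℝ} (hC : 0 < C) (hγ : 1 ≤ γ)
    (hp : ∀ r, 0 ≤ r → p r = C * r ^ γ) : RegularPressure p where
  zero := by rw [hp 0 le_rfl, Real.zero_rpow (by linarith), mul_zero]
  continuousOn := by
    have : ContinuousOn (fun r : ℝ => C * r ^ γ) (Ici 0) :=
      (continuous_const.mul (Real.continuous_rpow_const (by linarith))).continuousOn
    exact this.congr hp
  strictMonoOn := by
    intro a ha b hb hab
    rw [hp a ha, hp b hb]
    exact mul_lt_mul_of_pos_left (Real.rpow_lt_rpow ha hab (by linarith)) hC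
  strictConcaveOn := by
    intro w
    have h1 := strictConvexOn_rpow (p := γ + 1) (by linarith)
    refine ⟨convex_Ici 0, fun x hx y hy hxy a b ha hb hab => ?_⟩
    have h2 := h1.2 hx hy hxy ha hb hab
    have e : ∀ r, 0 ≤ r → r * (w - p r) = r * w - C * r ^ (γ + 1) := by
      intro r hr
      rw [hp r hr, Real.rpow_add_one' hr (by linarith)]
      ring
    have hx' : 0 ≤ x := hx
    have hy' : 0 ≤ y := hy
    simp only [smul_eq_mul] at h2 ⊢
    rw [e x hx', e y hy', e _ (by positivity)]
    nlinarith [mul_lt_mul_of_pos_left h2 hC]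
  unbounded := by
    intro K
    refine ⟨1 + |K| / C, by positivity, ?_⟩
    rw [hp _ (by positivity)]
    have h1 : 1 + |K| / C ≤ (1 + |K| / C) ^ γ := by
      have h0 : 1 ≤ 1 + |K| / C := by have : 0 ≤ |K| / C := by positivity
                                      linarith
      simpa using Real.rpow_le_rpow_of_exponent_le h0 hγ
    have h2 : C * (1 + |K| / C) = C + |K| := by field_simp
    nlinarith [mul_le_mul_of_nonneg_left h1 hC.le, le_abs_self K]

namespace RegularPressure

variable {p : ℝ → ℝ} (hp : RegularPressure p)
include hp

lemma nonneg {r : ℝ} (hr : 0 ≤ r) : 0 ≤ p r := by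
  have := hp.strictMonoOn.monotoneOn (mem_Ici.2 le_rfl) (mem_Ici.2 hr) hr
  rwa [hp.zero] at this

lemma le_iff {a b : ℝ} (ha : 0 ≤ a) (hb : 0 ≤ b) : p a ≤ p b ↔ a ≤ b :=
  hp.strictMonoOn.le_iff_le ha hb

lemma lt_iff {a b : ℝ} (ha : 0 ≤ a) (hb : 0 ≤ b) : p a < p b ↔ a < b :=
  hp.strictMonoOn.lt_iff_lt ha hb

lemma exists_eq {w : ℝ} (hw : 0 ≤ w) : ∃ r, 0 ≤ r ∧ p r = w := by
  obtain ⟨K, hK, hwK⟩ := hp.unbounded w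
  have := intermediate_value_Icc hK (hp.continuousOn.mono Icc_subset_Ici_self)
  obtain ⟨r, hr, hrw⟩ := this ⟨by rwa [hp.zero], hwK⟩
  exact ⟨r, hr.1, hrw⟩

lemma flux_continuousOn (w : ℝ) : ContinuousOn (fun r => r * (w - p r)) (Ici 0) :=
  continuousOn_id.mul (continuousOn_const.sub hp.continuousOn)

/-- Beyond the zero of `w - p` the flux is negative, so a maximum over a compact interval is global.
Strict concavity makes it unique, which gives `sigma` its meaning. -/
lemma exists_isFluxMax {w : ℝ} (hw : 0 < w) : ∃ σ, IsFluxMax p w σ := by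
  obtain ⟨K, hK, hKw⟩ := hp.exists_eq hw.le
  obtain ⟨σ, hσ, hmax⟩ := isCompact_Icc.exists_isMaxOn (nonempty_Icc.2 hK)
    ((hp.flux_continuousOn w).mono Icc_subset_Ici_self)
  have hmax' : ∀ r, 0 ≤ r → r * (w - p r) ≤ σ * (w - p σ) := by
    intro r hr
    rcases le_or_gt r K with h | h
    · exact hmax ⟨hr, h⟩
    · have h0 : 0 ≤ σ * (w - p σ) := by simpa using hmax ⟨le_rfl, hK⟩
      have h1 : w < p r := hKw ▸ (hp.lt_iff hK hr).2 h
      nlinarith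
  refine ⟨σ, hσ.1, fun r hr hne => lt_of_le_of_ne (hmax' r hr) fun he => hne ?_⟩
  exact (hp.strictConcaveOn w).eq_of_isMaxOn (fun s hs => (hmax' s hs).trans he.ge)
    (fun s hs => hmax' s hs) hr hσ.1

lemma isFluxMax_sigma {w : ℝ} (hw : 0 < w) : IsFluxMax p w (sigma p w) :=
  Classical.epsilon_spec (hp.exists_isFluxMax hw)

lemma sigma_nonneg {w : ℝ} (hw : 0 < w) : 0 ≤ sigma p w := (hp.isFluxMax_sigma hw).1

lemma flux_le_flux_sigma {w r : ℝ} (hw : 0 < w) (hr : 0 ≤ r) :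
    r * (w - p r) ≤ sigma p w * (w - p (sigma p w)) := by
  rcases eq_or_ne r (sigma p w) with h | h
  · rw [← h]
  · exact ((hp.isFluxMax_sigma hw).2 r hr h).le

omit hp in
lemma flux_pos_of_lt {w r : ℝ} (hr : 0 < r) (hrw : p r < w) : 0 < r * (w - p r) :=
  mul_pos hr (by linarith)

lemma flux_sigma_pos {w : ℝ} (hw : 0 < w) : 0 < sigma p w * (w - p (sigma p w)) := by
  obtain ⟨K, hK, hKw⟩ := hp.exists_eq (half_pos hw).le
  have hK0 : 0 < K := lt_of_le_of_ne hK (by rintro rfl; rw [hp.zero] at hKw; linarith)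
  exact (flux_pos_of_lt hK0 (by linarith)).trans_le (hp.flux_le_flux_sigma hw hK)

lemma sigma_pos {w : ℝ} (hw : 0 < w) : 0 < sigma p w := by
  have := hp.flux_sigma_pos hw
  rcases (hp.sigma_nonneg hw).lt_or_eq with h | h
  · exact h
  · rw [← h] at this; simp at this

/-- On an interval a concave function lies above the smaller of its endpoint values. When one
endpoint is the maximizer, that is the value at the other. -/
lemma flux_antitoneOn {w : ℝ} (hw : 0 < w) :
    AntitoneOn (fun r => r * (w - p r)) (Ici (sigma p w)) := by
  intro a ha b hb hab
  have h0 := hp.sigma_nonneg hw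
  have hb' : sigma p w ≤ b := hb
  have := (hp.strictConcaveOn w).concaveOn.min_le_of_mem_Icc (mem_Ici.2 h0)
    (mem_Ici.2 (h0.trans hb)) ⟨ha, hab⟩
  rwa [min_eq_right (hp.flux_le_flux_sigma hw (h0.trans hb))] at this

lemma flux_monotoneOn {w : ℝ} (hw : 0 < w) :
    MonotoneOn (fun r => r * (w - p r)) (Icc 0 (sigma p w)) := by
  intro a ha b hb hab
  have h0 := hp.sigma_nonneg hw
  have := (hp.strictConcaveOn w).concaveOn.min_le_of_mem_Icc (mem_Ici.2 ha.1)
    (mem_Ici.2 h0) ⟨hab, hb.2⟩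
  rwa [min_eq_left (hp.flux_le_flux_sigma hw ha.1)] at this

/-- On `[σ, ∞)` the flux takes every value between a given one and `0`. -/
lemma exists_flux_eq_right {w a q : ℝ} (hw : 0 < w) (ha : sigma p w ≤ a) (hq : 0 ≤ q)
    (hqa : q ≤ a * (w - p a)) : ∃ r, a ≤ r ∧ r * (w - p r) = q := by
  obtain ⟨K, hK, hKw⟩ := hp.exists_eq hw.le
  have h0 := (hp.sigma_pos hw).trans_le ha
  have haK : a ≤ K := by
    rw [← hp.le_iff h0.le hK, hKw]
    by_contra! h
    nlinarith
  have := intermediate_value_Icc' haK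
    ((hp.flux_continuousOn w).mono (Icc_subset_Ici_self.trans (Ici_subset_Ici.2 h0.le)))
  obtain ⟨r, hr, hrq⟩ := this ⟨by simpa [hKw] using hq, hqa⟩
  exact ⟨r, hr.1, hrq⟩

lemma exists_flux_eq_of_mem {w a b q : ℝ} (ha : 0 ≤ a) (hab : a ≤ b)
    (hq : q ∈ uIcc (a * (w - p a)) (b * (w - p b))) : ∃ r ∈ Icc a b, r * (w - p r) = q := by
  have h := intermediate_value_uIcc (a := a) (b := b) (f := fun r => r * (w - p r)) (by
    rw [uIcc_of_le hab]
    exact (hp.flux_continuousOn w).mono (Icc_subset_Ici_self.trans (Ici_subset_Ici.2 ha)))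
  obtain ⟨r, hr, hrq⟩ := h hq
  rw [uIcc_of_le hab] at hr
  exact ⟨r, hr, hrq⟩

lemma demand_nonneg {w r : ℝ} (hw : 0 < w) (hr : 0 ≤ r) (hrw : p r ≤ w) : 0 ≤ demand p r w := by
  unfold demand
  split_ifs
  · exact mul_nonneg hr (by linarith)
  · exact (hp.flux_sigma_pos hw).le

omit hp in
lemma rhoTilde_nonneg (w v : ℝ) : 0 ≤ rhoTilde p w v := by
  unfold rhoTilde
  split_ifs with h
  · exact h.choose_spec.1
  · exact le_rfl

lemma rhoTilde_spec {w v : ℝ} (hv : v ≤ w) : w - p (rhoTilde p w v) = v := by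
  have h : ∃ r, 0 ≤ r ∧ w - p r = v := by
    obtain ⟨r, hr, h⟩ := hp.exists_eq (sub_nonneg.2 hv)
    exact ⟨r, hr, by linarith⟩
  unfold rhoTilde
  rw [dif_pos h]
  exact h.choose_spec.2

lemma rhoTilde_of_lt {w v : ℝ} (hv : w < v) : rhoTilde p w v = 0 := by
  unfold rhoTilde
  rw [dif_neg]
  rintro ⟨r, hr, h⟩
  linarith [hp.nonneg hr]

/-- Together with `rhoTilde_mul` this covers the genuine intersection and the vacuum at once: the
velocity of the state is at most `v`, with equality unless its density vanishes. -/
lemma rhoTilde_velocity_le (w v : ℝ) : w - p (rhoTilde p w v) ≤ v := by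
  rcases le_or_gt v w with h | h
  · exact (hp.rhoTilde_spec h).le
  · rw [hp.rhoTilde_of_lt h, hp.zero]; linarith

lemma rhoTilde_mul (w v : ℝ) :
    rhoTilde p w v * (w - p (rhoTilde p w v) - v) = 0 := by
  rcases le_or_gt v w with h | h
  · rw [hp.rhoTilde_spec h]; ring
  · rw [hp.rhoTilde_of_lt h]; ring

lemma supply_nonneg {w v : ℝ} (hw : 0 < w) (hv : 0 ≤ v) : 0 ≤ supply p (rhoTilde p w v) w := by
  unfold supply
  split_ifs
  · exact (hp.flux_sigma_pos hw).le
  · have := hp.rhoTilde_mul w v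
    nlinarith [mul_nonneg (rhoTilde_nonneg (p := p) w v) hv]

end RegularPressure

/-- The homogenized pressure is determined on `[0, ∞)` only. This and the next lemmas show that the
supply bound sees nothing else. -/
lemma isFluxMax_congr {p p' : ℝ → ℝ} (h : ∀ r, 0 ≤ r → p r = p' r) (w σ : ℝ) :
    IsFluxMax p w σ ↔ IsFluxMax p' w σ := by
  unfold IsFluxMax
  refine and_congr_right fun hσ => forall_congr' fun r => forall_congr' fun hr => ?_
  rw [h r hr, h σ hσ]

lemma sigma_congr {p p' : ℝ → ℝ} (h : ∀ r, 0 ≤ r → p r = p' r) (w : ℝ) :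
    sigma p w = sigma p' w := by
  unfold sigma
  congr 1
  funext σ
  exact propext (isFluxMax_congr h w σ)

open Classical in
lemma rhoTilde_congr {p p' : ℝ → ℝ} (h : ∀ r, 0 ≤ r → p r = p' r) (w v : ℝ) :
    rhoTilde p w v = rhoTilde p' w v := by
  have : (fun r => 0 ≤ r ∧ w - p r = v) = fun r => 0 ≤ r ∧ w - p' r = v := by
    funext r
    refine propext (and_congr_right fun hr => ?_)
    rw [h r hr]
  exact congrArg (fun Q : ℝ → Prop => if h : ∃ r, Q r then h.choose else 0) this

lemma supply_congr {p p' : ℝ → ℝ} (hp : RegularPressure p) (h : ∀ r, 0 ≤ r → p r = p' r)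
    {ρ w : ℝ} (hρ : 0 ≤ ρ) (hw : 0 < w) : supply p ρ w = supply p' ρ w := by
  unfold supply
  rw [← sigma_congr h, h ρ hρ, h _ (hp.sigma_nonneg hw)]

end TrafficNetwork

namespace TrafficNetwork

/-! ### The approximated homogenized pressure -/

/-- Each equation `c * T⁻ᵞ = w i` has the single positive solution `(c / w i) ^ (1 / γ)`. -/
lemma isHomogenizedVolume_rpow_iff {n : ℕ} {c γ : ℝ} (hc : 0 < c) (hγ : 1 ≤ γ) {β w : Fin n → ℝ}
    (hw : ∀ i, 0 < w i) (τ : ℝ) :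
    IsHomogenizedVolume (fun ρ => c * ρ ^ γ) β w 0 τ ↔
      τ = c ^ (1 / γ) * ∑ i, β i / w i ^ (1 / γ) := by
  have hγ0 : γ ≠ 0 := by linarith
  have key : ∀ i T, 0 < T → (c * (1 / T) ^ γ = w i - 0 ↔ T = c ^ (1 / γ) / w i ^ (1 / γ)) := by
    intro i T hT
    have h1 : (1 / T) ^ γ = 1 / T ^ γ := by rw [one_div, one_div, Real.inv_rpow hT.le]
    have hTγ : 0 < T ^ γ := Real.rpow_pos_of_pos hT γ
    rw [h1, sub_zero, ← Real.div_rpow hc.le (hw i).le, mul_one_div, div_eq_iff hTγ.ne']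
    constructor
    · intro h
      have : c / w i = T ^ γ := by rw [h]; field_simp [(hw i).ne']
      rw [this, one_div, Real.rpow_rpow_inv hT.le hγ0]
    · intro h
      rw [h, one_div, Real.rpow_inv_rpow (div_pos hc (hw i)).le hγ0]
      field_simp [(hw i).ne']
  constructor
  · rintro ⟨T, hT, rfl⟩
    rw [Finset.mul_sum]
    refine Finset.sum_congr rfl fun i _ => ?_
    rw [(key i (T i) (hT i).1).1 (hT i).2]
    ring
  · rintro rfl
    have hpos : ∀ i, 0 < c ^ (1 / γ) / w i ^ (1 / γ) := fun i =>
      div_pos (Real.rpow_pos_of_pos hc _) (Real.rpow_pos_of_pos (hw i) _)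
    refine ⟨fun i => c ^ (1 / γ) / w i ^ (1 / γ), fun i => ⟨hpos i, (key i _ (hpos i)).2 rfl⟩, ?_⟩
    rw [Finset.mul_sum]
    exact Finset.sum_congr rfl fun i _ => by ring

namespace Junction

variable {n m : ℕ} (J : Junction n m)

/-- The constant in front of `ρ ^ γ` in the approximated homogenized pressure. -/
noncomputable def cbar (j : Fin m) : ℝ :=
  J.c₀ j * (∑ i, J.β i j * J.w₀ (Sum.inl i) *
    (∑ l, J.β l j / J.w₀ (Sum.inl l) ^ (1 / J.γ)) ^ J.γ)

lemma exists_β_pos (j : Fin m) : ∃ i, 0 < J.β i j := by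
  by_contra! h
  have h1 := J.β_sum j
  have h2 : ∑ i, J.β i j ≤ 0 := Finset.sum_nonpos fun i _ => h i
  linarith

lemma wbar_pos (j : Fin m) : 0 < J.wbar j := by
  obtain ⟨i, hi⟩ := J.exists_β_pos j
  exact Finset.sum_pos' (fun i _ => mul_nonneg (J.β_nonneg i j) (J.w₀_in_pos i).le)
    ⟨i, Finset.mem_univ i, mul_pos hi (J.w₀_in_pos i)⟩

lemma sum_β_div_pos (j : Fin m) : 0 < ∑ l, J.β l j / J.w₀ (Sum.inl l) ^ (1 / J.γ) := by
  obtain ⟨i, hi⟩ := J.exists_β_pos j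
  exact Finset.sum_pos'
    (fun i _ => div_nonneg (J.β_nonneg i j) (Real.rpow_nonneg (J.w₀_in_pos i).le _))
    ⟨i, Finset.mem_univ i, div_pos hi (Real.rpow_pos_of_pos (J.w₀_in_pos i) _)⟩

lemma cbar_eq (j : Fin m) :
    J.cbar j = J.c₀ j * (J.wbar j * (∑ l, J.β l j / J.w₀ (Sum.inl l) ^ (1 / J.γ)) ^ J.γ) := by
  rw [cbar, wbar, Finset.sum_mul]

lemma cbar_pos (j : Fin m) : 0 < J.cbar j := by
  rw [cbar_eq]
  exact mul_pos (J.c₀_pos j) (mul_pos (J.wbar_pos j) (Real.rpow_pos_of_pos (J.sum_β_div_pos j) _))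

/-- There is only one volume at `v = 0`, so the defining relation is a single equation for the
constant. The power `γ` undoes the exponent `1 / γ` of `c₀` in that volume. -/
lemma isApproxPressure_iff (j : Fin m) (P : ℝ → ℝ) :
    J.IsApproxPressure j P ↔ ∀ ρ, 0 ≤ ρ → P ρ = J.cbar j * ρ ^ J.γ := by
  have hc := J.c₀_pos j
  have hγ : J.γ ≠ 0 := by linarith [J.one_le_γ]
  have hS := J.sum_β_div_pos j
  have hSγ := Real.rpow_pos_of_pos hS J.γ
  have hvol : ∀ τ, IsHomogenizedVolume (J.pout j) (fun i => J.β i j)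
      (fun i => J.w₀ (Sum.inl i)) 0 τ ↔
      τ = J.c₀ j ^ (1 / J.γ) * ∑ l, J.β l j / J.w₀ (Sum.inl l) ^ (1 / J.γ) :=
    isHomogenizedVolume_rpow_iff hc J.one_le_γ J.w₀_in_pos
  have hτ : 0 < J.c₀ j ^ (1 / J.γ) * ∑ l, J.β l j / J.w₀ (Sum.inl l) ^ (1 / J.γ) :=
    mul_pos (Real.rpow_pos_of_pos hc _) hS
  have hpow : (1 / (J.c₀ j ^ (1 / J.γ) * ∑ l, J.β l j / J.w₀ (Sum.inl l) ^ (1 / J.γ))) ^ J.γ =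
      1 / (J.c₀ j * (∑ l, J.β l j / J.w₀ (Sum.inl l) ^ (1 / J.γ)) ^ J.γ) := by
    rw [one_div, Real.inv_rpow hτ.le, Real.mul_rpow (Real.rpow_nonneg hc.le _) hS.le, one_div J.γ,
      Real.rpow_inv_rpow hc.le hγ, one_div]
  unfold IsApproxPressure IsApproxHomogenizedPressure
  simp only [hvol, forall_eq, sub_zero]
  change _ ∧ _ = J.wbar j ↔ _
  rw [cbar_eq]
  constructor
  · rintro ⟨⟨c, h⟩, h1⟩ ρ hρ
    rw [h _ (by positivity), pout, hpow] at h1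
    rw [h ρ hρ, pout, ← h1]
    field_simp
  · intro h
    refine ⟨⟨J.wbar j * (∑ l, J.β l j / J.w₀ (Sum.inl l) ^ (1 / J.γ)) ^ J.γ, fun ρ hρ => ?_⟩, ?_⟩
    · rw [h ρ hρ, pout]; ring
    · rw [h _ (by positivity), hpow]
      field_simp

lemma regular_pout (j : Fin m) : RegularPressure (J.pout j) :=
  .of_rpow (J.c₀_pos j) J.one_le_γ fun _ _ => rfl

variable {J} in
lemma IsApproxPressure.regular {j : Fin m} {P : ℝ → ℝ} (h : J.IsApproxPressure j P) :
    RegularPressure P :=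
  .of_rpow (J.cbar_pos j) J.one_le_γ ((J.isApproxPressure_iff j P).1 h)

lemma v₀_nonneg (j : Fin m) : 0 ≤ J.v₀ j := by
  have := J.v₀_out_nonneg j
  unfold v₀ pout
  linarith

/-! ### Admissible fluxes -/

variable {J}

lemma IsAdmissibleFlux.congr {P P' : Fin m → ℝ → ℝ} (hP : ∀ j, RegularPressure (P j))
    (h : ∀ j r, 0 ≤ r → P j r = P' j r) {q : Fin m → Fin n → ℝ} (hq : J.IsAdmissibleFlux P q) :
    J.IsAdmissibleFlux P' q where
  nonneg := hq.nonneg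
  demand_bound := hq.demand_bound
  supply_bound j := by
    rw [← rhoTilde_congr (h j), ← supply_congr (hP j) (h j)
      (RegularPressure.rhoTilde_nonneg _ _) (J.wbar_pos j)]
    exact hq.supply_bound j
  distribution := hq.distribution
  mixture := hq.mixture

/-- Summation over `i` with `∑ β = 1` identifies the unknown `z`. -/
lemma IsAdmissibleFlux.mixture_eq {P : Fin m → ℝ → ℝ} {q : Fin m → Fin n → ℝ}
    (hq : J.IsAdmissibleFlux P q) (j : Fin m) (i : Fin n) : q j i = qout q j * J.β i j := by
  obtain ⟨z, hz⟩ := hq.mixture j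
  have : qout q j = z := by
    unfold qout
    rw [Finset.sum_congr rfl fun i _ => hz i, ← Finset.mul_sum, J.β_sum, mul_one]
  rw [this, hz]

/-- The componentwise maximum of two admissible fluxes is admissible. -/
lemma IsAdmissibleFlux.sup {P : Fin m → ℝ → ℝ} {q q' : Fin m → Fin n → ℝ}
    (hq : J.IsAdmissibleFlux P q) (hq' : J.IsAdmissibleFlux P q') :
    J.IsAdmissibleFlux P (fun j i => max (q j i) (q' j i)) ∧
      ∀ i, qin (fun j i => max (q j i) (q' j i)) i = max (qin q i) (qin q' i) := by
  -- Multiplication by the nonnegative `α` and `β` commutes with the maximum, so both linear rules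
  -- survive it.
  have hα : ∀ j i, max (q j i) (q' j i) = J.α j i * max (qin q i) (qin q' i) := by
    intro j i
    rw [mul_max_of_nonneg _ _ (J.α_nonneg j i), ← hq.distribution, ← hq'.distribution]
  have hβ : ∀ j i, max (q j i) (q' j i) = max (qout q j) (qout q' j) * J.β i j := by
    intro j i
    rw [max_mul_of_nonneg _ _ (J.β_nonneg i j), ← hq.mixture_eq, ← hq'.mixture_eq]
  have hin : ∀ i, qin (fun j i => max (q j i) (q' j i)) i = max (qin q i) (qin q' i) := by
    intro i
    unfold qin
    rw [Finset.sum_congr rfl fun j _ => hα j i, ← Finset.sum_mul, J.α_sum, one_mul]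
    rfl
  have hout : ∀ j, qout (fun j i => max (q j i) (q' j i)) j = max (qout q j) (qout q' j) := by
    intro j
    unfold qout
    rw [Finset.sum_congr rfl fun i _ => hβ j i, ← Finset.mul_sum, J.β_sum, mul_one]
    rfl
  refine ⟨⟨fun j i => (hq.nonneg j i).trans (le_max_left _ _), fun i => ?_, fun j => ?_,
    fun j i => ?_, fun j => ⟨_, hβ j⟩⟩, hin⟩
  · rw [hin]
    exact ⟨(hq.demand_bound i).1.trans (le_max_left _ _),
      max_le (hq.demand_bound i).2 (hq'.demand_bound i).2⟩
  · rw [hout]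
    exact ⟨(hq.supply_bound j).1.trans (le_max_left _ _),
      max_le (hq.supply_bound j).2 (hq'.supply_bound j).2⟩
  · rw [hin, hα]

/-- The flux that maximizes the total incoming flux is unique. -/
lemma IsAdmissibleFlux.unique {P : Fin m → ℝ → ℝ} {q q' : Fin m → Fin n → ℝ}
    (hq : J.IsAdmissibleFlux P q) (hq' : J.IsAdmissibleFlux P q')
    (hmax : ∀ r, J.IsAdmissibleFlux P r → ∑ i, qin r i ≤ ∑ i, qin q i)
    (hmax' : ∀ r, J.IsAdmissibleFlux P r → ∑ i, qin r i ≤ ∑ i, qin q' i) : q = q' := by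
  -- The maximum of the two fluxes competes with both. Since its total cannot exceed theirs, all
  -- incoming fluxes agree, and the distribution rule recovers the rest.
  obtain ⟨hs, hin⟩ := hq.sup hq'
  have aux : ∀ r : Fin m → Fin n → ℝ, (∀ i, qin r i ≤ max (qin q i) (qin q' i)) →
      (∑ i, max (qin q i) (qin q' i) ≤ ∑ i, qin r i) →
      ∀ i, qin r i = max (qin q i) (qin q' i) := by
    intro r h1 h2 i
    exact (Finset.sum_eq_sum_iff_of_le fun i _ => h1 i).1
      (le_antisymm (Finset.sum_le_sum fun i _ => h1 i) h2) i (Finset.mem_univ i)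
  have e : ∑ i, qin (fun j i => max (q j i) (q' j i)) i = ∑ i, max (qin q i) (qin q' i) :=
    Finset.sum_congr rfl fun i _ => hin i
  have h1 := aux q (fun i => le_max_left _ _) (e ▸ hmax _ hs)
  have h2 := aux q' (fun i => le_max_right _ _) (e ▸ hmax' _ hs)
  funext j i
  rw [hq.distribution, hq'.distribution, (h1 i).trans (h2 i).symm]

/-- There is a flux that maximizes the total incoming flux. -/
lemma exists_isAdmissibleFlux_max {P : Fin m → ℝ → ℝ} (hP : ∀ j, RegularPressure (P j)) :
    ∃ q, J.IsAdmissibleFlux P q ∧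
      ∀ r, J.IsAdmissibleFlux P r → ∑ i, qin r i ≤ ∑ i, qin q i := by
  have hcin : ∀ i, Continuous fun q : Fin m → Fin n → ℝ => qin q i := fun i => by
    unfold qin; fun_prop
  have hcout : ∀ j, Continuous fun q : Fin m → Fin n → ℝ => qout q j := fun j => by
    unfold qout; fun_prop
  -- With `z` eliminated from the mixture rule, every condition is visibly closed.
  have hset : {q | J.IsAdmissibleFlux P q} = {q | (∀ j i, 0 ≤ q j i) ∧
      (∀ i, 0 ≤ qin q i ∧ qin q i ≤ demand (J.pin i) (J.ρ₀ (Sum.inl i)) (J.w₀ (Sum.inl i))) ∧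
      (∀ j, 0 ≤ qout q j ∧
        qout q j ≤ supply (P j) (rhoTilde (P j) (J.wbar j) (J.v₀ j)) (J.wbar j)) ∧
      (∀ j i, q j i = J.α j i * qin q i) ∧ ∀ j i, q j i = qout q j * J.β i j} := by
    ext q
    exact ⟨fun h => ⟨h.nonneg, h.demand_bound, h.supply_bound, h.distribution, h.mixture_eq⟩,
      fun h => ⟨h.1, h.2.1, h.2.2.1, h.2.2.2.1, fun j => ⟨_, h.2.2.2.2 j⟩⟩⟩
  have hclosed : IsClosed {q | J.IsAdmissibleFlux P q} := by
    rw [hset]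
    simp only [Set.ofPred_and, Set.ofPred_forall]
    refine IsClosed.inter ?_ (IsClosed.inter ?_ (IsClosed.inter ?_ (IsClosed.inter ?_ ?_)))
    · exact isClosed_iInter fun j => isClosed_iInter fun i =>
        isClosed_le continuous_const (by fun_prop)
    · exact isClosed_iInter fun i => (isClosed_le continuous_const (hcin i)).inter
        (isClosed_le (hcin i) continuous_const)
    · exact isClosed_iInter fun j => (isClosed_le continuous_const (hcout j)).inter
        (isClosed_le (hcout j) continuous_const)
    · exact isClosed_iInter fun j => isClosed_iInter fun i =>
        isClosed_eq (by fun_prop) (continuous_const.mul (hcin i))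
    · exact isClosed_iInter fun j => isClosed_iInter fun i =>
        isClosed_eq (by fun_prop) ((hcout j).mul continuous_const)
  have hsub : {q | J.IsAdmissibleFlux P q} ⊆ Icc (fun _ _ => 0)
      (fun _ i => demand (J.pin i) (J.ρ₀ (Sum.inl i)) (J.w₀ (Sum.inl i))) := by
    intro q hq
    refine ⟨fun j i => hq.nonneg j i, fun j i => le_trans ?_ (hq.demand_bound i).2⟩
    exact Finset.single_le_sum (f := fun j => q j i) (fun j _ => hq.nonneg j i) (Finset.mem_univ j)
  have hcomp : IsCompact {q | J.IsAdmissibleFlux P q} := isCompact_Icc.of_isClosed_subset hclosed hsub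
  -- The zero flux is admissible because demand and supply are nonnegative, which uses the
  -- nonnegative initial velocities.
  have hne : {q | J.IsAdmissibleFlux P q}.Nonempty := by
    refine ⟨fun _ _ => 0, fun _ _ => le_rfl, fun i => ?_, fun j => ?_, fun j i => ?_,
      fun j => ⟨0, fun i => by simp⟩⟩
    · simpa [qin] using (J.pin_law i).regular.demand_nonneg (J.w₀_in_pos i) (J.ρ₀_in_nonneg i)
        (J.v₀_in_nonneg i)
    · simpa [qout] using (hP j).supply_nonneg (J.wbar_pos j) (J.v₀_nonneg j)
    · simp [qin]
  obtain ⟨q, hq, hmax⟩ := hcomp.exists_isMaxOn hne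
    (f := fun q : Fin m → Fin n → ℝ => ∑ i, qin q i)
    (continuous_finsetSum _ fun i _ => hcin i).continuousOn
  exact ⟨q, hq, fun r hr => hmax hr⟩

end Junction

end TrafficNetwork

namespace TrafficNetwork

/-! ### Test functions -/

/-- `φx`, `φt` and `φxt` are the partial derivatives of the test function `φ`, which vanishes
outside the square `(-K, K)²`. -/
structure IsTestFunction (φ φx φt φxt : ℝ → ℝ → ℝ) (K : ℝ) : Prop where
  pos : 0 < K
  continuous : Continuous (Function.uncurry φ)
  continuous_x : Continuous (Function.uncurry φx)
  continuous_t : Continuous (Function.uncurry φt)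
  continuous_xt : Continuous (Function.uncurry φxt)
  hasDerivAt_x : ∀ x t, HasDerivAt (fun y => φ y t) (φx x t) x
  hasDerivAt_t : ∀ x t, HasDerivAt (fun s => φ x s) (φt x t) t
  hasDerivAt_tx : ∀ x t, HasDerivAt (fun y => φt y t) (φxt x t) x
  hasDerivAt_xt : ∀ x t, HasDerivAt (fun s => φx x s) (φxt x t) t
  eq_zero : ∀ x t, K ≤ |x| ∨ K ≤ |t| → φ x t = 0
  eq_zero_x : ∀ x t, K ≤ |x| ∨ K ≤ |t| → φx x t = 0
  eq_zero_t : ∀ x t, K ≤ |x| ∨ K ≤ |t| → φt x t = 0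

lemma exists_isTestFunction {φ : ℝ → ℝ → ℝ} (h : ContDiff ℝ ∞ (Function.uncurry φ))
    (hc : HasCompactSupport (Function.uncurry φ)) :
    ∃ φxt K, IsTestFunction φ (fun x t => deriv (fun y => φ y t) x)
      (fun x t => deriv (fun s => φ x s) t) φxt K := by
  set Φ := Function.uncurry φ with hΦ
  have hd : ∀ z, HasFDerivAt Φ (fderiv ℝ Φ z) z := fun z =>
    (h.differentiable (by simp) z).hasFDerivAt
  have hd1 : ContDiff ℝ ∞ (fderiv ℝ Φ) := h.fderiv_right (by simp)
  have hd2 : ∀ z, HasFDerivAt (fderiv ℝ Φ) (fderiv ℝ (fderiv ℝ Φ) z) z := fun z =>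
    (hd1.differentiable (by simp) z).hasFDerivAt
  have lx : ∀ x t : ℝ, HasDerivAt (fun y : ℝ => (y, t)) ((1 : ℝ), (0 : ℝ)) x := fun x t =>
    (hasDerivAt_id x).prodMk (hasDerivAt_const x t)
  have lt : ∀ x t : ℝ, HasDerivAt (fun s : ℝ => (x, s)) ((0 : ℝ), (1 : ℝ)) t := fun x t =>
    (hasDerivAt_const t x).prodMk (hasDerivAt_id t)
  have hx : ∀ x t, HasDerivAt (fun y => φ y t) (fderiv ℝ Φ (x, t) (1, 0)) x := fun x t => by
    have := HasFDerivAt.comp_hasDerivAt (f := fun y => (y, t)) x (hd (x, t)) (lx x t)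
    exact this
  have ht : ∀ x t, HasDerivAt (fun s => φ x s) (fderiv ℝ Φ (x, t) (0, 1)) t := fun x t =>
    (hd (x, t)).comp_hasDerivAt t (lt x t)
  have ex : (fun x t => deriv (fun y => φ y t) x) = fun x t => fderiv ℝ Φ (x, t) (1, 0) := by
    funext x t; exact (hx x t).deriv
  have et : (fun x t => deriv (fun s => φ x s) t) = fun x t => fderiv ℝ Φ (x, t) (0, 1) := by
    funext x t; exact (ht x t).deriv
  have htx : ∀ x t, HasDerivAt (fun y => fderiv ℝ Φ (y, t) (0, 1))
      (fderiv ℝ (fderiv ℝ Φ) (x, t) (1, 0) (0, 1)) x := fun x t => by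
    have := HasFDerivAt.comp_hasDerivAt (f := fun y => (y, t)) x
      ((ContinuousLinearMap.apply ℝ ℝ ((0 : ℝ), (1 : ℝ))).hasFDerivAt.comp (x, t)
        (hd2 (x, t))) (lx x t)
    exact this
  have hxt : ∀ x t, HasDerivAt (fun s => fderiv ℝ Φ (x, s) (1, 0))
      (fderiv ℝ (fderiv ℝ Φ) (x, t) (0, 1) (1, 0)) t := fun x t =>
    ((ContinuousLinearMap.apply ℝ ℝ ((1 : ℝ), (0 : ℝ))).hasFDerivAt.comp (x, t)
      (hd2 (x, t))).comp_hasDerivAt t (lt x t)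
  have hsymm : ∀ z, fderiv ℝ (fderiv ℝ Φ) z (0, 1) (1, 0) = fderiv ℝ (fderiv ℝ Φ) z (1, 0) (0, 1) :=
    fun z => (h.contDiffAt.isSymmSndFDerivAt (by simp; exact WithTop.coe_le_coe.2 le_top)) _ _
  obtain ⟨C, hC⟩ := hc.isBounded.subset_closedBall (0 : ℝ × ℝ)
  have hout : ∀ x t, |C| + 1 ≤ |x| ∨ |C| + 1 ≤ |t| → (x, t) ∉ tsupport Φ := by
    intro x t hxt' hmem
    have := hC hmem
    rw [mem_closedBall_zero_iff, Prod.norm_def, max_le_iff] at this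
    simp only [Real.norm_eq_abs] at this
    have := le_abs_self C
    rcases hxt' with h' | h' <;> linarith
  have hc1 := hd1.continuous
  have hc2 : Continuous (fderiv ℝ (fderiv ℝ Φ)) := hd1.continuous_fderiv (by simp)
  refine ⟨fun x t => fderiv ℝ (fderiv ℝ Φ) (x, t) (1, 0) (0, 1), |C| + 1, ?_⟩
  rw [ex, et]
  have z1 : ∀ x t, (x, t) ∉ tsupport Φ → fderiv ℝ Φ (x, t) = 0 := fun x t h' =>
    image_eq_zero_of_notMem_tsupport fun h'' => h' (tsupport_fderiv_subset ℝ h'')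
  exact
    { pos := by positivity
      continuous := h.continuous
      continuous_x := hc1.clm_apply continuous_const
      continuous_t := hc1.clm_apply continuous_const
      continuous_xt := (hc2.clm_apply continuous_const).clm_apply continuous_const
      hasDerivAt_x := hx
      hasDerivAt_t := ht
      hasDerivAt_tx := htx
      hasDerivAt_xt := fun x t => hsymm (x, t) ▸ hxt x t
      eq_zero := fun x t h' => image_eq_zero_of_notMem_tsupport (f := Φ) (hout x t h')
      eq_zero_x := fun x t h' => by simp only [z1 x t (hout x t h')]; rfl
      eq_zero_t := fun x t h' => by simp only [z1 x t (hout x t h')]; rfl }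

/-- Reflection in `x` reduces incoming roads to outgoing ones. -/
lemma IsTestFunction.reflect {φ φx φt φxt : ℝ → ℝ → ℝ} {K : ℝ}
    (h : IsTestFunction φ φx φt φxt K) :
    IsTestFunction (fun x t => φ (-x) t) (fun x t => -φx (-x) t) (fun x t => φt (-x) t)
      (fun x t => -φxt (-x) t) K where
  pos := h.pos
  continuous := h.continuous.comp (continuous_fst.neg.prodMk continuous_snd)
  continuous_x := (h.continuous_x.comp (continuous_fst.neg.prodMk continuous_snd)).neg
  continuous_t := h.continuous_t.comp (continuous_fst.neg.prodMk continuous_snd)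
  continuous_xt := (h.continuous_xt.comp (continuous_fst.neg.prodMk continuous_snd)).neg
  hasDerivAt_x x t := by
    have := (h.hasDerivAt_x (-x) t).comp x (hasDerivAt_neg x)
    rwa [mul_neg_one] at this
  hasDerivAt_t x t := h.hasDerivAt_t (-x) t
  hasDerivAt_tx x t := by
    have := (h.hasDerivAt_tx (-x) t).comp x (hasDerivAt_neg x)
    rwa [mul_neg_one] at this
  hasDerivAt_xt x t := (h.hasDerivAt_xt (-x) t).neg
  eq_zero x t h' := h.eq_zero _ _ (by simpa using h')
  eq_zero_x x t h' := by simpa using h.eq_zero_x (-x) t (by simpa using h')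
  eq_zero_t x t h' := h.eq_zero_t _ _ (by simpa using h')

/-! ### Self-similar functions satisfy the weak form -/

lemma integral_Ioi_eq_of_eq_zero {g : ℝ → ℝ} {K : ℝ} (h : ∀ x, K ≤ x → g x = 0) :
    ∫ x in Ioi (0 : ℝ), g x = ∫ x in Ioc 0 K, g x := by
  refine setIntegral_eq_of_subset_of_forall_sdiff_eq_zero measurableSet_Ioi Ioc_subset_Ioi_self
    fun x hx => h x ?_
  by_contra! hxK
  exact hx.2 ⟨hx.1, hxK.le⟩

lemma setIntegral_Ioc_of_hasDerivAt {f f' : ℝ → ℝ} {K : ℝ} (hK : 0 ≤ K) {s : Set ℝ}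
    (hs : s.Countable) (hf : ContinuousOn f (Icc 0 K))
    (hd : ∀ x, 0 < x → x < K → x ∉ s → HasDerivAt f (f' x) x)
    (hi : IntegrableOn f' (Ioc 0 K)) : ∫ x in Ioc 0 K, f' x = f K - f 0 := by
  rw [← intervalIntegral.integral_of_le hK]
  exact integral_eq_of_hasDerivAt_off_countable_of_le f f' hK hs hf
    (fun x hx => hd x hx.1.1 hx.1.2 hx.2) ((intervalIntegrable_iff_integrableOn_Ioc_of_le hK).2 hi)

/-- The weak form of `∂ₜ R(x/t) + ∂ₓ F(x/t) = 0`, with `F ξ = m ξ + ξ R ξ`, on a half-line. -/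
theorem weak_form_of_hasDerivAt {R m : ℝ → ℝ} {q ρ₀ C : ℝ} (hR : Measurable R) (hm : Measurable m)
    (hRC : ∀ ξ, 0 < ξ → |R ξ| ≤ C) (hFC : ∀ ξ, 0 < ξ → |m ξ + ξ * R ξ| ≤ C) {s : Set ℝ}
    (hs : s.Countable) (hd : ∀ ξ, 0 < ξ → ξ ∉ s → HasDerivAt m (-R ξ) ξ)
    (hcont : ContinuousOn m (Ici 0)) (hm0 : m 0 = q)
    (hlim : Tendsto (fun ξ => m ξ / ξ) atTop (𝓝 (-ρ₀)))
    {φ φx φt φxt : ℝ → ℝ → ℝ} {K : ℝ} (hφ : IsTestFunction φ φx φt φxt K) :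
    (∫ t in Ioi (0 : ℝ), ∫ x in Ioi (0 : ℝ),
      (R (x / t) * φt x t + (m (x / t) + x / t * R (x / t)) * φx x t)) +
      ∫ x in Ioi (0 : ℝ), ρ₀ * φ x 0 = -(q * ∫ t in Ioi (0 : ℝ), φ 0 t) := by
  have hK := hφ.pos
  set μ : Measure ℝ := volume.restrict (Ioc 0 K) with hμ
  set F : ℝ → ℝ := fun ξ => m ξ + ξ * R ξ with hF
  have hFm : Measurable F := hm.add (measurable_id.mul hR)
  -- `U` is a potential of the conservation law: `∂ₓ U = R (x / t)` and `∂ₜ U = -F (x / t)`.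
  -- Integrating by parts in `x` in one term and in `t` in the other produces the same integral of
  -- `U * φxt` with opposite signs. Only the boundary terms from `U 0 t = -t * q` and `U x 0 = ρ₀ *
  -- x` remain.
  set U : ℝ → ℝ → ℝ := fun x t => -t * m (x / t) with hU
  have hC : 0 ≤ C := (abs_nonneg _).trans (hRC 1 one_pos)
  have hUb : ∀ x t, 0 < x → x ≤ K → 0 < t → t ≤ K → |U x t| ≤ 2 * K * C := by
    intro x t hx hxK ht htK
    have e : U x t = x * R (x / t) - t * F (x / t) := by
      simp only [hU, hF]; field_simp; ring
    rw [e]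
    have h1 := hRC (x / t) (div_pos hx ht)
    have h2 := hFC (x / t) (div_pos hx ht)
    calc |x * R (x / t) - t * F (x / t)| ≤ |x * R (x / t)| + |t * F (x / t)| := abs_sub _ _
      _ = x * |R (x / t)| + t * |F (x / t)| := by
        rw [abs_mul, abs_mul, abs_of_pos hx, abs_of_pos ht]
      _ ≤ K * C + K * C := by gcongr
      _ = 2 * K * C := by ring
  have bdd : ∀ g : ℝ → ℝ → ℝ, Continuous (Function.uncurry g) →
      ∃ B, ∀ x t, x ∈ Icc 0 K → t ∈ Icc 0 K → |g x t| ≤ B := by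
    intro g hg
    obtain ⟨B, hB⟩ := (isCompact_Icc.prod isCompact_Icc).exists_bound_of_continuousOn
      (hg.continuousOn (s := Icc 0 K ×ˢ Icc 0 K))
    exact ⟨B, fun x t hx ht => hB (x, t) ⟨hx, ht⟩⟩
  have int2 : ∀ a g : ℝ → ℝ → ℝ, Measurable (Function.uncurry a) → Continuous (Function.uncurry g) →
      (∃ A, ∀ x t, 0 < x → x ≤ K → 0 < t → t ≤ K → |a x t| ≤ A) →
      Integrable (fun z : ℝ × ℝ => a z.1 z.2 * g z.1 z.2) (μ.prod μ) := by
    rintro a g ha hg ⟨A, hA⟩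
    obtain ⟨B, hB⟩ := bdd g hg
    refine Integrable.of_bound (ha.mul hg.measurable).aestronglyMeasurable (A * B) ?_
    rw [hμ, Measure.prod_restrict]
    filter_upwards [ae_restrict_mem (measurableSet_Ioc.prod measurableSet_Ioc)] with z hz
    rw [norm_mul]
    exact mul_le_mul (hA _ _ hz.1.1 hz.1.2 hz.2.1 hz.2.2)
      (hB _ _ (Ioc_subset_Icc_self hz.1) (Ioc_subset_Icc_self hz.2)) (norm_nonneg _)
      ((abs_nonneg _).trans (hA _ _ hz.1.1 hz.1.2 hz.2.1 hz.2.2))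
  have meas2 : ∀ f : ℝ → ℝ, Measurable f →
      Measurable (Function.uncurry fun x t : ℝ => f (x / t)) := fun f hf =>
    hf.comp (measurable_fst.div measurable_snd)
  have hUm : Measurable (Function.uncurry U) := measurable_snd.neg.mul (meas2 m hm)
  have iR := int2 (fun x t => R (x / t)) φt (meas2 R hR) hφ.continuous_t
    ⟨C, fun x t hx _ ht _ => hRC _ (div_pos hx ht)⟩
  have iF := int2 (fun x t => F (x / t)) φx (meas2 F hFm) hφ.continuous_x
    ⟨C, fun x t hx _ ht _ => hFC _ (div_pos hx ht)⟩
  have iU := int2 U φxt hUm hφ.continuous_xt ⟨_, hUb⟩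
  have int1 : ∀ a g : ℝ → ℝ, Measurable a → Continuous g →
      (∃ A, ∀ x, 0 < x → x ≤ K → |a x| ≤ A) → Integrable (fun x => a x * g x) μ := by
    rintro a g ha hg ⟨A, hA⟩
    obtain ⟨B, hB⟩ := isCompact_Icc.exists_bound_of_continuousOn (hg.continuousOn (s := Icc 0 K))
    refine Integrable.of_bound (ha.mul hg.measurable).aestronglyMeasurable (A * B) ?_
    filter_upwards [ae_restrict_mem measurableSet_Ioc] with z hz
    rw [norm_mul]
    exact mul_le_mul (hA _ hz.1 hz.2) (hB _ (Ioc_subset_Icc_self hz)) (norm_nonneg _)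
      ((abs_nonneg _).trans (hA _ hz.1 hz.2))
  have sx : ∀ g : ℝ → ℝ → ℝ, Continuous (Function.uncurry g) → ∀ t, Continuous fun x => g x t :=
    fun g hg t => hg.comp (continuous_id.prodMk continuous_const)
  have st : ∀ g : ℝ → ℝ → ℝ, Continuous (Function.uncurry g) → ∀ x, Continuous fun t => g x t :=
    fun g hg x => hg.comp (continuous_const.prodMk continuous_id)
  have jR : ∀ t, 0 < t → t ≤ K → Integrable (fun x => R (x / t) * φt x t) μ := fun t ht htK =>
    int1 _ _ (hR.comp (measurable_id.div_const t)) (sx _ hφ.continuous_t t)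
      ⟨C, fun x hx _ => hRC _ (div_pos hx ht)⟩
  have jF : ∀ t, 0 < t → t ≤ K → Integrable (fun x => F (x / t) * φx x t) μ := fun t ht htK =>
    int1 _ _ (hFm.comp (measurable_id.div_const t)) (sx _ hφ.continuous_x t)
      ⟨C, fun x hx _ => hFC _ (div_pos hx ht)⟩
  have jF' : ∀ x, 0 < x → x ≤ K → Integrable (fun t => F (x / t) * φx x t) μ := fun x hx hxK =>
    int1 _ _ (hFm.comp (measurable_const.div measurable_id)) (st _ hφ.continuous_x x)
      ⟨C, fun t ht _ => hFC _ (div_pos hx ht)⟩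
  have jU : ∀ t, 0 < t → t ≤ K → Integrable (fun x => U x t * φxt x t) μ := fun t ht htK =>
    int1 _ _ (measurable_const.mul (hm.comp (measurable_id.div_const t)))
      (sx _ hφ.continuous_xt t) ⟨_, fun x hx hxK => hUb x t hx hxK ht htK⟩
  have jU' : ∀ x, 0 < x → x ≤ K → Integrable (fun t => U x t * φxt x t) μ := fun x hx hxK =>
    int1 _ _ (measurable_id.neg.mul (hm.comp (measurable_const.div measurable_id)))
      (st _ hφ.continuous_xt x) ⟨_, fun t ht htK => hUb x t hx hxK ht htK⟩
  have stepX : ∀ t, 0 < t → t ≤ K →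
      ∫ x, R (x / t) * φt x t ∂μ = q * (t * φt 0 t) - ∫ x, U x t * φxt x t ∂μ := by
    intro t ht htK
    have h := setIntegral_Ioc_of_hasDerivAt (f := fun x => U x t * φt x t)
      (f' := fun x => R (x / t) * φt x t + U x t * φxt x t) hK.le (hs.image fun ξ => ξ * t)
      (by
        refine ContinuousOn.mul ?_ (sx _ hφ.continuous_t t).continuousOn
        refine continuousOn_const.mul (hcont.comp (by fun_prop) fun x hx => ?_)
        exact div_nonneg hx.1 ht.le)
      (by
        intro x hx _ hxs
        have h1 := hd (x / t) (div_pos hx ht) fun h => hxs ⟨x / t, h, by field_simp⟩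
        have h2 := ((h1.comp x ((hasDerivAt_id x).div_const t)).const_mul (-t)).mul
          (hφ.hasDerivAt_tx x t)
        refine h2.congr_deriv ?_
        simp only [hU, Function.comp, id]
        field_simp)
      ((jR t ht htK).add (jU t ht htK))
    rw [integral_add (jR t ht htK) (jU t ht htK)] at h
    have e0 : U 0 t = -t * q := by simp only [hU, zero_div, hm0]
    rw [hφ.eq_zero_t K t (Or.inl (le_abs_self K)), e0] at h
    linarith
  have stepT : ∀ x, 0 < x → x ≤ K →
      ∫ t, F (x / t) * φx x t ∂μ = ρ₀ * (x * φx x 0) + ∫ t, U x t * φxt x t ∂μ := by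
    intro x hx hxK
    -- At `t = 0` the convention `x / 0 = 0` would give `U x 0 = 0`. The value is replaced by the
    -- limit `ρ₀ * x` supplied by `hlim`.
    have h := setIntegral_Ioc_of_hasDerivAt
      (f := fun t => (if t = 0 then ρ₀ * x else U x t) * φx x t)
      (f' := fun t => U x t * φxt x t - F (x / t) * φx x t) hK.le (hs.image fun ξ => x / ξ)
      (by
        refine ContinuousOn.mul ?_ (st _ hφ.continuous_x x).continuousOn
        intro t ht
        rcases ht.1.eq_or_lt with h0 | h0
        · subst h0
          rw [← continuousWithinAt_sdiff_self]
          refine Tendsto.congr' (f₁ := fun t => -x * (m (x / t) / (x / t))) ?_ ?_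
          · filter_upwards [self_mem_nhdsWithin] with t ht
            have : t ≠ 0 := fun h => ht.2 h
            simp only [hU, if_neg this]
            field_simp
          · have h1 : Tendsto (fun t => x / t) (𝓝[Icc 0 K \ {0}] 0) atTop := by
              have : Tendsto (fun t => x / t) (𝓝[>] (0 : ℝ)) atTop :=
                tendsto_inv_nhdsGT_zero.const_mul_atTop hx
              exact this.mono_left (nhdsWithin_mono _ fun t ht =>
                lt_of_le_of_ne ht.1.1 fun h => ht.2 h.symm)
            have h2 := (hlim.comp h1).const_mul (-x)
            simpa [mul_comm] using h2
        · have h1 : ContinuousAt (U x) t := by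
            have hc : ContinuousAt m (x / t) :=
              hcont.continuousAt (Ici_mem_nhds (div_pos hx h0))
            exact continuousAt_id.neg.mul (ContinuousAt.comp (f := fun t => x / t) hc
              (continuousAt_const.div continuousAt_id h0.ne'))
          refine (h1.congr ?_).continuousWithinAt
          filter_upwards [Ioi_mem_nhds h0] with s hs
          rw [if_neg (ne_of_gt hs)])
      (by
        intro t ht _ hts
        have h1 := hd (x / t) (div_pos hx ht) fun h => hts ⟨x / t, h, by field_simp⟩
        have h3 : HasDerivAt (fun t => x / t) (-x / t ^ 2) t := by
          have := (hasDerivAt_const t x).fun_div (hasDerivAt_id' t) ht.ne'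
          refine this.congr_deriv ?_
          ring
        have h2 : HasDerivAt (U x) (-F (x / t)) t := by
          refine ((hasDerivAt_id' t).neg.mul (h1.comp t h3)).congr_deriv ?_
          simp only [hF, Function.comp]
          field_simp
          simp
          ring
        have h4 : HasDerivAt (fun t => (if t = 0 then ρ₀ * x else U x t)) (-F (x / t)) t := by
          refine h2.congr_of_eventuallyEq ?_
          filter_upwards [Ioi_mem_nhds ht] with s hs
          rw [if_neg (ne_of_gt hs)]
        refine (h4.fun_mul (hφ.hasDerivAt_xt x t)).congr_deriv ?_
        rw [if_neg ht.ne']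
        ring)
      ((jU' x hx hxK).sub (jF' x hx hxK))
    rw [integral_sub (jU' x hx hxK) (jF' x hx hxK),
      hφ.eq_zero_x x K (Or.inr (le_abs_self K)), if_pos rfl] at h
    linarith
  have ct : Continuous fun t => φ 0 t := st _ hφ.continuous 0
  have cx : Continuous fun x => φ x 0 := sx _ hφ.continuous 0
  have ic : ∀ g : ℝ → ℝ, Continuous g → Integrable g μ := fun g hg =>
    (hg.continuousOn.integrableOn_Icc (a := 0) (b := K)).mono_set Ioc_subset_Icc_self
  have ct' : Continuous fun t => φt 0 t := st _ hφ.continuous_t 0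
  have cx' : Continuous fun x => φx x 0 := sx _ hφ.continuous_x 0
  have cmt : Continuous fun t => t * φt 0 t := continuous_id.mul ct'
  have cmx : Continuous fun x => x * φx x 0 := continuous_id.mul cx'
  have bt : ∫ t, t * φt 0 t ∂μ = -∫ t, φ 0 t ∂μ := by
    have h := setIntegral_Ioc_of_hasDerivAt (f := fun t => t * φ 0 t)
      (f' := fun t => φ 0 t + t * φt 0 t) hK.le countable_empty
      (continuous_id.mul ct).continuousOn
      (fun t _ _ _ => ((hasDerivAt_id' t).fun_mul (hφ.hasDerivAt_t 0 t)).congr_deriv (by ring))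
      ((ic _ ct).add (ic _ cmt))
    rw [integral_add (ic _ ct) (ic _ cmt),
      hφ.eq_zero 0 K (Or.inr (le_abs_self K))] at h
    linarith
  have bx : ∫ x, x * φx x 0 ∂μ = -∫ x, φ x 0 ∂μ := by
    have h := setIntegral_Ioc_of_hasDerivAt (f := fun x => x * φ x 0)
      (f' := fun x => φ x 0 + x * φx x 0) hK.le countable_empty
      (continuous_id.mul cx).continuousOn
      (fun x _ _ _ => ((hasDerivAt_id' x).fun_mul (hφ.hasDerivAt_x x 0)).congr_deriv (by ring))
      ((ic _ cx).add (ic _ cmx))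
    rw [integral_add (ic _ cx) (ic _ cmx),
      hφ.eq_zero K 0 (Or.inl (le_abs_self K))] at h
    linarith
  have e1 : ∫ t in Ioi (0 : ℝ), ∫ x in Ioi (0 : ℝ),
      (R (x / t) * φt x t + (m (x / t) + x / t * R (x / t)) * φx x t) =
      ∫ t, (∫ x, R (x / t) * φt x t ∂μ + ∫ x, F (x / t) * φx x t ∂μ) ∂μ := by
    rw [integral_Ioi_eq_of_eq_zero (K := K)]
    · refine setIntegral_congr_fun measurableSet_Ioc fun t ht => ?_
      rw [integral_Ioi_eq_of_eq_zero (K := K), ← integral_add (jR t ht.1 ht.2) (jF t ht.1 ht.2)]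
      intro x hx
      have h' : K ≤ |x| := hx.trans (le_abs_self x)
      rw [hφ.eq_zero_x x t (Or.inl h'), hφ.eq_zero_t x t (Or.inl h')]
      ring
    · intro t ht
      have h' : K ≤ |t| := ht.trans (le_abs_self t)
      simp [hφ.eq_zero_x _ t (Or.inr h'), hφ.eq_zero_t _ t (Or.inr h')]
  have e2 : ∫ x in Ioi (0 : ℝ), ρ₀ * φ x 0 = ρ₀ * ∫ x, φ x 0 ∂μ := by
    rw [integral_const_mul, integral_Ioi_eq_of_eq_zero (K := K)]
    exact fun x hx => hφ.eq_zero x 0 (Or.inl (hx.trans (le_abs_self x)))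
  have e3 : ∫ t in Ioi (0 : ℝ), φ 0 t = ∫ t, φ 0 t ∂μ :=
    integral_Ioi_eq_of_eq_zero fun t ht => hφ.eq_zero 0 t (Or.inr (ht.trans (le_abs_self t)))
  rw [e1, e2, e3, integral_add iR.integral_prod_right iF.integral_prod_right]
  have e4 : ∫ t, ∫ x, R (x / t) * φt x t ∂μ ∂μ =
      q * ∫ t, t * φt 0 t ∂μ - ∫ t, ∫ x, U x t * φxt x t ∂μ ∂μ := by
    rw [← integral_const_mul, ← integral_sub ((ic _ cmt).const_mul q)
      iU.integral_prod_right]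
    exact setIntegral_congr_fun measurableSet_Ioc fun t ht => stepX t ht.1 ht.2
  have e5 : ∫ t, ∫ x, F (x / t) * φx x t ∂μ ∂μ =
      ρ₀ * ∫ x, x * φx x 0 ∂μ + ∫ t, ∫ x, U x t * φxt x t ∂μ ∂μ := by
    have s1 : ∫ x, ∫ t, F (x / t) * φx x t ∂μ ∂μ = ∫ t, ∫ x, F (x / t) * φx x t ∂μ ∂μ :=
      integral_integral_swap iF
    have s2 : ∫ x, ∫ t, U x t * φxt x t ∂μ ∂μ = ∫ t, ∫ x, U x t * φxt x t ∂μ ∂μ :=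
      integral_integral_swap iU
    rw [← s1, ← s2, ← integral_const_mul, ← integral_add ((ic _ cmx).const_mul ρ₀) iU.integral_prod_left]
    exact setIntegral_congr_fun measurableSet_Ioc fun x hx => stepT x hx.1 hx.2
  rw [e4, e5, bt, bx]
  ring

end TrafficNetwork

namespace TrafficNetwork

/-! ### Consequences of the weak form for self-similar functions -/

lemma exists_smooth_bump : ∃ θ : ℝ → ℝ, ContDiff ℝ ∞ θ ∧ (∀ x, x ≤ 1 → θ x = 0) ∧
    (∀ x, 3 ≤ x → θ x = 0) ∧ ∫ x, θ x = 1 := by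
  let f : ContDiffBump (2 : ℝ) := ⟨1 / 2, 1, by norm_num, by norm_num⟩
  have hsupp : ∀ x, 1 ≤ |x - 2| → f.normed volume x = 0 := by
    intro x hx
    by_contra h
    have h1 : x ∈ Function.support (f.normed volume) := h
    rw [f.support_normed_eq, Metric.mem_ball, Real.dist_eq] at h1
    linarith
  refine ⟨f.normed volume, f.contDiff_normed, fun x hx => hsupp x ?_, fun x hx => hsupp x ?_,
    f.integral_normed⟩
  · exact le_abs.2 (Or.inr (by linarith))
  · exact le_abs.2 (Or.inl (by linarith))

/-- A test function on `(0, ∞)` is the restriction of the derivative of a test function on `ℝ`. -/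
lemma exists_test_antideriv {g : ℝ → ℝ} (hg : ContDiff ℝ ∞ g) (hc : HasCompactSupport g)
    (hs : tsupport g ⊆ Ioi 0) : ∃ (ψ : ℝ → ℝ) (L : ℝ), 0 < L ∧ ContDiff ℝ ∞ ψ ∧
      (∀ ζ, L ≤ |ζ| → ψ ζ = 0) ∧ (∀ ζ, 0 < ζ → HasDerivAt ψ (g ζ) ζ) ∧ (∀ ζ, ζ ≤ 0 → g ζ = 0) ∧
      (∀ ζ, L ≤ ζ → g ζ = 0) ∧ ψ 0 = -∫ ζ, g ζ := by
  obtain ⟨θ, hθ, hθ1, hθ3, hθi⟩ := exists_smooth_bump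
  obtain ⟨C, hC⟩ := hc.isBounded.subset_closedBall (0 : ℝ)
  have hg0 : ∀ ζ, ζ ≤ 0 → g ζ = 0 := fun ζ hζ =>
    image_eq_zero_of_notMem_tsupport fun h => absurd (hs h) (not_lt.2 hζ)
  set L := |C| + 3 with hL
  have hL3 : 3 ≤ L := by rw [hL]; linarith [abs_nonneg C]
  have hgL : ∀ ζ, L ≤ |ζ| → g ζ = 0 := fun ζ hζ =>
    image_eq_zero_of_notMem_tsupport fun h => by
      have := hC h
      rw [mem_closedBall_zero_iff, Real.norm_eq_abs] at this
      linarith [le_abs_self C]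
  set I := ∫ ζ, g ζ with hI
  -- A bump of the same mass on the negative axis is subtracted. The total integral becomes zero, so
  -- the primitive from `-L` has compact support, while on `ζ > 0` its derivative is still `g`; at
  -- the origin it equals `-I`.
  set h : ℝ → ℝ := fun ζ => g ζ - I * θ (-ζ) with hh
  have hsm : ContDiff ℝ ∞ h := hg.sub (contDiff_const.mul (hθ.comp contDiff_neg))
  have hcont := hsm.continuous
  have hh0 : ∀ ζ, L ≤ |ζ| → h ζ = 0 := by
    intro ζ hζ
    simp only [hh, hgL ζ hζ]
    rcases le_abs.1 hζ with h1 | h1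
    · rw [hθ1 (-ζ) (by linarith)]; ring
    · rw [hθ3 (-ζ) (by linarith)]; ring
  have hd : ∀ ζ, HasDerivAt (fun ζ => ∫ s in (-L)..ζ, h s) (h ζ) ζ := fun ζ =>
    intervalIntegral.integral_hasDerivAt_right (hcont.intervalIntegrable _ _)
      hcont.stronglyMeasurable.stronglyMeasurableAtFilter hcont.continuousAt
  have tail : ∀ f : ℝ → ℝ, (∀ ζ, L ≤ |ζ| → f ζ = 0) → ∫ s in (-L)..L, f s = ∫ s, f s := by
    intro f hf
    rw [intervalIntegral.integral_of_le (by linarith)]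
    refine setIntegral_eq_integral_of_forall_compl_eq_zero fun x hx => hf x ?_
    by_contra! hlt
    exact hx ⟨(abs_lt.1 hlt).1, (abs_lt.1 hlt).2.le⟩
  have hθn : ∀ ζ, L ≤ |ζ| → θ (-ζ) = 0 := by
    intro ζ hζ
    rcases le_abs.1 hζ with h1 | h1
    · exact hθ1 _ (by linarith)
    · exact hθ3 _ (by linarith)
  have cθ : Continuous fun ζ => I * θ (-ζ) :=
    continuous_const.mul (hθ.continuous.comp continuous_neg)
  have full : ∫ s in (-L)..L, h s = 0 := by
    simp only [hh]
    rw [intervalIntegral.integral_sub (hg.continuous.intervalIntegrable _ _)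
      (cθ.intervalIntegrable _ _), intervalIntegral.integral_const_mul, tail g hgL, tail _ hθn,
      integral_neg_eq_self (fun x => θ x), hθi, ← hI]
    ring
  have half : ∫ s in (-L)..0, h s = -I := by
    have e1 : ∫ s in (-L)..0, g s = 0 := by
      rw [intervalIntegral.integral_congr (g := fun _ => 0)]
      · simp
      · intro x hx
        rw [uIcc_of_le (by linarith)] at hx
        exact hg0 x hx.2
    have e2 : ∫ s in (-L)..0, θ (-s) = 1 := by
      rw [← hθi, ← integral_neg_eq_self (fun x => θ x),
        intervalIntegral.integral_of_le (by linarith)]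
      refine setIntegral_eq_integral_of_forall_compl_eq_zero fun x hx => ?_
      by_cases h1 : x ≤ -L
      · exact hθ3 _ (by linarith)
      · exact hθ1 _ (by
          by_contra! h2
          exact hx ⟨not_le.1 h1, by linarith⟩)
    simp only [hh]
    rw [intervalIntegral.integral_sub (hg.continuous.intervalIntegrable _ _)
      (cθ.intervalIntegrable _ _), intervalIntegral.integral_const_mul, e1, e2]
    ring
  refine ⟨fun ζ => ∫ s in (-L)..ζ, h s, L, by linarith, ?_, ?_, ?_, hg0, ?_, half⟩
  · refine contDiff_infty_iff_deriv.2 ⟨fun ζ => (hd ζ).differentiableAt, ?_⟩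
    rw [show deriv (fun ζ => ∫ s in (-L)..ζ, h s) = h from funext fun ζ => (hd ζ).deriv]
    exact hsm
  · intro ζ hζ
    rcases le_abs.1 hζ with h1 | h1
    · simp only
      rw [← intervalIntegral.integral_add_adjacent_intervals (hcont.intervalIntegrable _ L)
        (hcont.intervalIntegrable L ζ), full, zero_add,
        intervalIntegral.integral_congr (g := fun _ => 0)]
      · simp
      · intro x hx
        rw [uIcc_of_le h1] at hx
        exact hh0 x (hx.1.trans (le_abs_self x))
    · simp only
      rw [intervalIntegral.integral_congr (g := fun _ => 0)]
      · simp
      · intro x hx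
        rw [uIcc_of_ge (by linarith)] at hx
        exact hh0 x (by have := neg_le_abs x; linarith [hx.2])
  · intro ζ hζ
    have := hd ζ
    simp only [hh, hθ1 (-ζ) (by linarith), mul_zero, sub_zero] at this
    exact this
  · exact fun ζ hζ => hgL ζ (hζ.trans (le_abs_self ζ))

/-- `R(x/t)` and `F(x/t)` satisfy the weak form of `∂ₜ R + ∂ₓ F = 0` with initial value `ρ₀` on
the open half-line `x > 0`. -/
def IsHalfLineWeakSolution (R F : ℝ → ℝ) (ρ₀ : ℝ) : Prop :=
  ∀ φ : ℝ → ℝ → ℝ, ContDiff ℝ ∞ (Function.uncurry φ) → HasCompactSupport (Function.uncurry φ) →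
    (∀ t, φ 0 t = 0) →
    (∫ t in Ioi (0 : ℝ), ∫ x in Ioi (0 : ℝ), (R (x / t) * deriv (fun s => φ x s) t +
      F (x / t) * deriv (fun y => φ y t) x)) + ∫ x in Ioi (0 : ℝ), ρ₀ * φ x 0 = 0

section

variable {R F : ℝ → ℝ} {ρ₀ C : ℝ} (hR : Measurable R) (hF : Measurable F)
  (hRC : ∀ ξ, |R ξ| ≤ C) (hFC : ∀ ξ, |F ξ| ≤ C) (h : IsHalfLineWeakSolution R F ρ₀)
include hR hF hRC hFC h

/-- The test function `ψ (t / x) * θ x` separates the self-similar variable `ζ = t / x` from `x`,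
and Fubini leaves a one-dimensional identity with the constants `∫ θ = 1` and `∫ x θ' = -1`. With `ζ
= 1 / ξ` in place of `ξ`, the initial line is `ζ = 0`, so the datum appears as `ρ₀ * ψ 0`. -/
lemma IsHalfLineWeakSolution.pairing {ψ : ℝ → ℝ} {L : ℝ} (hL : 0 < L) (hψ : ContDiff ℝ ∞ ψ)
    (hψL : ∀ ζ, L ≤ |ζ| → ψ ζ = 0) :
    Integrable (fun ζ => (R ζ⁻¹ - ζ * F ζ⁻¹) * deriv ψ ζ) (volume.restrict (Ioi 0)) ∧
    Integrable (fun ζ => F ζ⁻¹ * ψ ζ) (volume.restrict (Ioi 0)) ∧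
    (∫ ζ in Ioi (0 : ℝ), (R ζ⁻¹ - ζ * F ζ⁻¹) * deriv ψ ζ) - (∫ ζ in Ioi (0 : ℝ), F ζ⁻¹ * ψ ζ) +
      ρ₀ * ψ 0 = 0 := by
  obtain ⟨θ, hθ, hθ1, hθ3, hθi⟩ := exists_smooth_bump
  set φ : ℝ → ℝ → ℝ := fun x t => ψ (t / x) * θ x with hφ
  have hsm : ContDiff ℝ ∞ (Function.uncurry φ) := by
    rw [contDiff_iff_contDiffAt]
    rintro ⟨x, t⟩
    rcases eq_or_ne x 0 with rfl | hx
    · refine (contDiffAt_const (c := (0 : ℝ))).congr_of_eventuallyEq ?_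
      have : ∀ᶠ z : ℝ × ℝ in 𝓝 (0, t), z.1 < 1 :=
        continuous_fst.continuousAt.eventually_lt continuousAt_const (by simp)
      filter_upwards [this] with z hz
      simp only [Function.uncurry, hφ, hθ1 z.1 hz.le, mul_zero]
    · exact (hψ.contDiffAt.comp (x, t) (contDiffAt_snd.div contDiffAt_fst hx)).mul
        (hθ.contDiffAt.comp (x, t) contDiffAt_fst)
  have hcs : HasCompactSupport (Function.uncurry φ) := by
    refine HasCompactSupport.intro (K := Icc 1 3 ×ˢ Icc (-(3 * L)) (3 * L))
      (isCompact_Icc.prod isCompact_Icc) ?_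
    rintro ⟨x, t⟩ hxt
    simp only [Function.uncurry, hφ]
    by_cases h1 : x ≤ 1
    · rw [hθ1 x h1, mul_zero]
    by_cases h3 : 3 ≤ x
    · rw [hθ3 x h3, mul_zero]
    push Not at h1 h3
    rw [hψL, zero_mul]
    by_contra! hlt
    rw [abs_div, abs_of_pos (by linarith : 0 < x), div_lt_iff₀ (by linarith)] at hlt
    have h4 : |t| ≤ 3 * L := by nlinarith
    exact hxt ⟨⟨h1.le, h3.le⟩, abs_le.1 h4⟩
  obtain ⟨φxt, K, htf⟩ := exists_isTestFunction hsm hcs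
  have key := h φ hsm hcs fun t => by simp only [hφ, hθ1 0 (by norm_num), mul_zero]
  have dψ : ∀ ζ, HasDerivAt ψ (deriv ψ ζ) ζ := fun ζ =>
    (hψ.differentiable (by simp) ζ).hasDerivAt
  have dθ : ∀ x, HasDerivAt θ (deriv θ x) x := fun x =>
    (hθ.differentiable (by simp) x).hasDerivAt
  have cψ' : Continuous (deriv ψ) := hψ.continuous_deriv (by simp)
  have cθ' : Continuous (deriv θ) := hθ.continuous_deriv (by simp)
  have et : ∀ x t, 0 < x → deriv (fun s => φ x s) t = deriv ψ (t / x) * x⁻¹ * θ x := by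
    intro x t hx
    have := (((dψ (t / x)).comp t ((hasDerivAt_id t).div_const x)).mul_const (θ x)).deriv
    simpa [hφ, Function.comp_def] using this
  have ex : ∀ x t, 0 < x → deriv (fun y => φ y t) x =
      ψ (t / x) * deriv θ x - t / x * deriv ψ (t / x) * x⁻¹ * θ x := by
    intro x t hx
    have h3 : HasDerivAt (fun y => t / y) (-t / x ^ 2) x := by
      have := (hasDerivAt_const x t).fun_div (hasDerivAt_id' x) hx.ne'
      refine this.congr_deriv ?_
      ring
    have := (((dψ (t / x)).comp x h3).mul (dθ x)).deriv
    simp only [hφ]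
    refine Eq.trans this ?_
    simp only [Function.comp]
    field_simp
    ring
  have supp : HasCompactSupport ψ := by
    refine HasCompactSupport.intro (isCompact_Icc (a := -L) (b := L)) fun x hx => hψL x ?_
    by_contra! hlt
    exact hx ⟨(abs_lt.1 hlt).1.le, (abs_lt.1 hlt).2.le⟩
  have bm : ∀ f g : ℝ → ℝ, Measurable f → (∀ ξ, |f ξ| ≤ C) → Continuous g → HasCompactSupport g →
      Integrable (fun ζ => f ζ⁻¹ * g ζ) (volume.restrict (Ioi 0)) := by
    intro f g hf hfC hg hgc
    exact ((hg.integrable_of_hasCompactSupport hgc).mono_measure Measure.restrict_le_self).bdd_mul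
      (c := C) (hf.comp measurable_inv).aestronglyMeasurable (Eventually.of_forall fun ζ => hfC _)
  have iB := bm F ψ hF hFC hψ.continuous supp
  have iA : Integrable (fun ζ => (R ζ⁻¹ - ζ * F ζ⁻¹) * deriv ψ ζ) (volume.restrict (Ioi 0)) := by
    have := (bm R _ hR hRC cψ' supp.deriv).sub
      (bm F (fun ζ => ζ * deriv ψ ζ) hF hFC (continuous_id.mul cψ') supp.deriv.mul_left)
    refine this.congr (Eventually.of_forall fun ζ => ?_)
    simp only [Pi.sub_apply]
    ring
  refine ⟨iA, iB, ?_⟩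
  have hZ : Integrable (fun z : ℝ × ℝ => R (z.1 / z.2) * deriv (fun s => φ z.1 s) z.2 +
      F (z.1 / z.2) * deriv (fun y => φ y z.2) z.1)
      ((volume.restrict (Ioi 0)).prod (volume.restrict (Ioi 0))) := by
    have aux : ∀ (f : ℝ → ℝ) (g : ℝ × ℝ → ℝ), Measurable f → (∀ ξ, |f ξ| ≤ C) → Continuous g →
        (∀ z, g z ≠ 0 → z ∈ Icc (-K) K ×ˢ Icc (-K) K) →
        Integrable (fun z : ℝ × ℝ => f (z.1 / z.2) * g z)
          ((volume.restrict (Ioi 0)).prod (volume.restrict (Ioi 0))) := by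
      intro f g hf hfC hg hgK
      have hgc : HasCompactSupport g :=
        HasCompactSupport.intro (isCompact_Icc.prod isCompact_Icc)
          fun z hz => by_contra fun hne => hz (hgK z hne)
      rw [Measure.prod_restrict]
      exact ((hg.integrable_of_hasCompactSupport (μ := volume.prod volume) hgc).mono_measure
        Measure.restrict_le_self).bdd_mul (c := C)
        (hf.comp (measurable_fst.div measurable_snd)).aestronglyMeasurable
        (Eventually.of_forall fun ζ => hfC _)
    have box : ∀ a : ℝ → ℝ → ℝ, (∀ x t, K ≤ |x| ∨ K ≤ |t| → a x t = 0) →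
        ∀ z : ℝ × ℝ, Function.uncurry a z ≠ 0 → z ∈ Icc (-K) K ×ˢ Icc (-K) K := by
      rintro a ha ⟨x, t⟩ hz
      have := mt (ha x t) hz
      push Not at this
      exact ⟨abs_le.1 this.1.le, abs_le.1 this.2.le⟩
    exact (aux R _ hR hRC htf.continuous_t (box _ htf.eq_zero_t)).add
      (aux F _ hF hFC htf.continuous_x (box _ htf.eq_zero_x))
  have swap : (∫ t in Ioi (0 : ℝ), ∫ x in Ioi (0 : ℝ), (R (x / t) * deriv (fun s => φ x s) t +
      F (x / t) * deriv (fun y => φ y t) x)) = ∫ x in Ioi (0 : ℝ), ∫ t in Ioi (0 : ℝ),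
      (R (x / t) * deriv (fun s => φ x s) t + F (x / t) * deriv (fun y => φ y t) x) :=
    (integral_integral_swap hZ).symm
  set A := ∫ ζ in Ioi (0 : ℝ), (R ζ⁻¹ - ζ * F ζ⁻¹) * deriv ψ ζ with hA
  set B := ∫ ζ in Ioi (0 : ℝ), F ζ⁻¹ * ψ ζ with hB
  have inner : ∀ x ∈ Ioi (0 : ℝ), ∫ t in Ioi (0 : ℝ), (R (x / t) * deriv (fun s => φ x s) t +
      F (x / t) * deriv (fun y => φ y t) x) = θ x * A + x * deriv θ x * B := by
    intro x hx
    have hx : 0 < x := hx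
    have e : ∀ t ∈ Ioi (0 : ℝ), R (x / t) * deriv (fun s => φ x s) t +
        F (x / t) * deriv (fun y => φ y t) x =
        (fun ζ => x⁻¹ * θ x * ((R ζ⁻¹ - ζ * F ζ⁻¹) * deriv ψ ζ) +
          deriv θ x * (F ζ⁻¹ * ψ ζ)) (x⁻¹ * t) := by
      intro t ht
      have e1 : x⁻¹ * t = t / x := by ring
      simp only
      rw [et x t hx, ex x t hx, e1, inv_div]
      ring
    have sc := integral_comp_mul_left_Ioi (fun ζ => x⁻¹ * θ x * ((R ζ⁻¹ - ζ * F ζ⁻¹) * deriv ψ ζ) +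
      deriv θ x * (F ζ⁻¹ * ψ ζ)) 0 (inv_pos.2 hx)
    rw [setIntegral_congr_fun measurableSet_Ioi e]
    refine sc.trans ?_
    rw [mul_zero, integral_add (iA.const_mul _) (iB.const_mul _), integral_const_mul,
      integral_const_mul, inv_inv, smul_eq_mul, ← hA, ← hB]
    field_simp
  have θint : Integrable θ := by
    refine hθ.continuous.integrable_of_hasCompactSupport
      (HasCompactSupport.intro (isCompact_Icc (a := 1) (b := 3)) fun x hx => ?_)
    by_cases h1 : x ≤ 1
    · exact hθ1 x h1
    · exact hθ3 x (by
        by_contra! h3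
        exact hx ⟨(not_le.1 h1).le, h3.le⟩)
  have I1 : ∫ x in Ioi (0 : ℝ), θ x = 1 := by
    rw [← hθi]
    exact setIntegral_eq_integral_of_forall_compl_eq_zero fun x hx =>
      hθ1 x (by have : x ≤ 0 := not_lt.1 hx
                linarith)
  have I2 : ∫ x in Ioi (0 : ℝ), x * deriv θ x = -1 := by
    have hz : ∀ x : ℝ, 4 ≤ x → x * deriv θ x = 0 := by
      intro x hx
      have : θ =ᶠ[𝓝 x] fun _ => 0 := by
        filter_upwards [Ioi_mem_nhds (show 3 < x by linarith)] with y hy using hθ3 y (le_of_lt hy)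
      rw [this.deriv_eq]
      simp
    have hθ4 : ∀ x : ℝ, 4 ≤ x → θ x = 0 := fun x hx => hθ3 x (by linarith)
    have c1 : IntegrableOn (fun x => x * deriv θ x) (Ioc 0 4) :=
      ((continuous_id.mul cθ').continuousOn.integrableOn_Icc).mono_set Ioc_subset_Icc_self
    have h1 := setIntegral_Ioc_of_hasDerivAt (K := 4) (f := fun x => x * θ x)
      (f' := fun x => θ x + x * deriv θ x) (by norm_num) countable_empty
      (continuous_id.mul hθ.continuous).continuousOn
      (fun x _ _ _ => ((hasDerivAt_id' x).fun_mul (dθ x)).congr_deriv (by ring))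
      (θint.integrableOn.add c1)
    rw [integral_add θint.integrableOn c1, ← integral_Ioi_eq_of_eq_zero hz,
      ← integral_Ioi_eq_of_eq_zero hθ4, I1, hθ3 4 (by norm_num)] at h1
    linarith
  -- A non-integrable function would have integral `0` by convention, not `-1`.
  have hxθ : IntegrableOn (fun x => x * deriv θ x) (Ioi 0) := by
    by_contra hn
    rw [integral_undef hn] at I2
    norm_num at I2
  rw [swap, setIntegral_congr_fun measurableSet_Ioi inner,
    integral_add (θint.integrableOn.mul_const A) (hxθ.mul_const B), integral_mul_const,
    integral_mul_const, I1, I2] at key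
  have e3 : ∫ x in Ioi (0 : ℝ), ρ₀ * φ x 0 = ρ₀ * ψ 0 := by
    simp only [hφ, zero_div]
    rw [integral_const_mul, integral_const_mul, I1, mul_one]
  rw [e3] at key
  linarith

/-- Du Bois-Reymond: each `g` supported in `(0, ∞)` is there the derivative of an admissible `ψ`.
Moving the derivative onto the primitive of `F` turns `pairing` into orthogonality to all such `g`;
`ψ 0 = -∫ g` contributes the constant `ρ₀`. -/
lemma IsHalfLineWeakSolution.ae_eq :
    ∀ᵐ ζ : ℝ, ζ ∈ Ioi 0 → R ζ⁻¹ - ζ * F ζ⁻¹ - ρ₀ + ∫ s in (0 : ℝ)..ζ, F s⁻¹ = 0 := by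
  have hC : 0 ≤ C := (abs_nonneg _).trans (hRC 0)
  have hFi : Measurable fun s : ℝ => F s⁻¹ := hF.comp measurable_inv
  have iF : ∀ a b, IntervalIntegrable (fun s : ℝ => F s⁻¹) volume a b := fun a b =>
    (intervalIntegrable_const (c := C)).mono_fun hFi.aestronglyMeasurable
      (Eventually.of_forall fun s => by
        simpa [Real.norm_eq_abs, abs_of_nonneg hC] using hFC s⁻¹)
  set G : ℝ → ℝ := fun ζ => ∫ s in (0 : ℝ)..ζ, F s⁻¹ with hG
  have cG : Continuous G := intervalIntegral.continuous_primitive iF 0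
  have hloc : LocallyIntegrable (fun ζ => R ζ⁻¹ - ζ * F ζ⁻¹ - ρ₀ + G ζ) := by
    refine LocallyIntegrable.mono
      (f := fun ζ => C + |ζ| * C + |ρ₀| + |G ζ|) (by fun_prop : Continuous _).locallyIntegrable
      ?_ (Eventually.of_forall fun ζ => ?_)
    · exact ((((hR.comp measurable_inv).sub (measurable_id.mul hFi)).sub
        measurable_const).add cG.measurable).aestronglyMeasurable
    · have h1 := hRC ζ⁻¹
      have h2 : |ζ * F ζ⁻¹| ≤ |ζ| * C := by
        rw [abs_mul]; exact mul_le_mul_of_nonneg_left (hFC _) (abs_nonneg _)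
      rw [Real.norm_eq_abs, Real.norm_eq_abs]
      refine le_trans ?_ (le_abs_self _)
      calc _ ≤ |R ζ⁻¹ - ζ * F ζ⁻¹ - ρ₀| + |G ζ| := abs_add_le _ _
        _ ≤ |R ζ⁻¹ - ζ * F ζ⁻¹| + |ρ₀| + |G ζ| := by gcongr; exact abs_sub _ _
        _ ≤ |R ζ⁻¹| + |ζ * F ζ⁻¹| + |ρ₀| + |G ζ| := by gcongr; exact abs_sub _ _
        _ ≤ _ := by gcongr
  refine (isOpen_Ioi (a := (0 : ℝ))).ae_eq_zero_of_integral_contDiff_smul_eq_zero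
    (hloc.locallyIntegrableOn _) fun g hg hgc hgs => ?_
  obtain ⟨ψ, L, hL, hψ, hψL, hψd, hg0, hgL, hψ0⟩ := exists_test_antideriv hg hgc hgs
  obtain ⟨iA, iB, key⟩ := h.pairing hR hF hRC hFC hL hψ hψL
  have hG0 : G 0 = 0 := by simp [hG]
  have cψ' : Continuous (deriv ψ) := hψ.continuous_deriv (by simp)
  -- `F` is merely bounded and measurable, so its primitive `G` is only absolutely continuous and
  -- differentiable almost everywhere.
  have ac : ∫ ζ in (0 : ℝ)..L, deriv G ζ * ψ ζ + G ζ * deriv ψ ζ = 0 := by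
    rw [AbsolutelyContinuousOnInterval.integral_deriv_mul_eq_sub
      ((iF 0 L).absolutelyContinuousOnInterval_intervalIntegral (by simp))
      (hψ.contDiffOn.of_le (by simp)).absolutelyContinuousOnInterval, hψL L (le_abs_self L)]
    change _ - G 0 * _ = _
    rw [hG0]
    ring
  have dG : ∀ᵐ ζ, ζ ∈ uIcc 0 L → HasDerivAt G (F ζ⁻¹) ζ := by
    filter_upwards [(iF 0 L).ae_hasDerivAt_integral] with ζ hζ hmem
    exact hζ hmem 0 (by simp)
  have e1 : ∫ ζ in Ioc 0 L, (F ζ⁻¹ * ψ ζ + G ζ * g ζ) = 0 := by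
    refine Eq.trans ?_ ac
    rw [intervalIntegral.integral_of_le hL.le]
    refine setIntegral_congr_ae measurableSet_Ioc ?_
    filter_upwards [dG] with ζ hζ hmem
    rw [(hζ (by rw [uIcc_of_le hL.le]; exact Ioc_subset_Icc_self hmem)).deriv,
      (hψd ζ hmem.1).deriv]
  have e2 : ∫ ζ in Ioi (0 : ℝ), (R ζ⁻¹ - ζ * F ζ⁻¹) * deriv ψ ζ =
      ∫ ζ in Ioi (0 : ℝ), (R ζ⁻¹ - ζ * F ζ⁻¹) * g ζ :=
    setIntegral_congr_fun measurableSet_Ioi fun ζ hζ => by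
      rw [(hψd ζ hζ).deriv]
  have iA' : Integrable (fun ζ => (R ζ⁻¹ - ζ * F ζ⁻¹) * g ζ) (volume.restrict (Ioi 0)) := by
    refine iA.congr ?_
    filter_upwards [ae_restrict_mem measurableSet_Ioi] with ζ hζ
    rw [(hψd ζ hζ).deriv]
  have sub : Ioc 0 L ⊆ Ioi 0 := Ioc_subset_Ioi_self
  have e3 : ∫ ζ in Ioi (0 : ℝ), (R ζ⁻¹ - ζ * F ζ⁻¹) * g ζ =
      ∫ ζ in Ioc 0 L, (R ζ⁻¹ - ζ * F ζ⁻¹) * g ζ :=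
    integral_Ioi_eq_of_eq_zero fun ζ hζ => by rw [hgL ζ hζ, mul_zero]
  have e4 : ∫ ζ in Ioi (0 : ℝ), F ζ⁻¹ * ψ ζ = ∫ ζ in Ioc 0 L, F ζ⁻¹ * ψ ζ :=
    integral_Ioi_eq_of_eq_zero fun ζ hζ => by rw [hψL ζ (hζ.trans (le_abs_self ζ)), mul_zero]
  have tot : ∀ f : ℝ → ℝ, ∫ ζ, g ζ * f ζ = ∫ ζ in Ioc 0 L, g ζ * f ζ := by
    intro f
    refine (setIntegral_eq_integral_of_forall_compl_eq_zero fun x hx => ?_).symm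
    by_cases h1 : x ≤ 0
    · rw [hg0 x h1, zero_mul]
    · rw [hgL x (by
        by_contra! h3
        exact hx ⟨not_le.1 h1, h3.le⟩), zero_mul]
  have e5 : ∫ ζ, g ζ = ∫ ζ in Ioc 0 L, g ζ := by simpa using tot fun _ => 1
  have cont_int : ∀ f : ℝ → ℝ, Continuous f → IntegrableOn f (Ioc 0 L) := fun f hf =>
    (hf.continuousOn.integrableOn_Icc).mono_set Ioc_subset_Icc_self
  have iGg : IntegrableOn (fun ζ => G ζ * g ζ) (Ioc 0 L) := cont_int _ (cG.mul hg.continuous)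
  have ig := cont_int _ hg.continuous
  rw [integral_add (iB.mono_measure (Measure.restrict_mono sub le_rfl)) iGg] at e1
  rw [e2, e3, e4, hψ0, e5] at key
  simp only [smul_eq_mul]
  rw [tot]
  have e6 : ∫ ζ in Ioc 0 L, g ζ * (R ζ⁻¹ - ζ * F ζ⁻¹ - ρ₀ + G ζ) =
      (∫ ζ in Ioc 0 L, (R ζ⁻¹ - ζ * F ζ⁻¹) * g ζ) - ρ₀ * (∫ ζ in Ioc 0 L, g ζ) +
        ∫ ζ in Ioc 0 L, G ζ * g ζ := by
    rw [← integral_const_mul, ← integral_sub (iA'.mono_measure (Measure.restrict_mono sub le_rfl))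
      (ig.const_mul ρ₀), ← integral_add]
    · exact integral_congr_ae (Eventually.of_forall fun ζ => by simp only; ring)
    · exact (iA'.mono_measure (Measure.restrict_mono sub le_rfl)).sub (ig.const_mul ρ₀)
    · exact iGg
  rw [e6]
  linarith

end

end TrafficNetwork

namespace TrafficNetwork

/-! ### Potentials -/

/-- `M` is the continuous representative of `F ξ - ξ R ξ` for a weak solution of
`-ξ R' + F' = 0` on `I`; it satisfies `M' = -R` in the sense of one-sided derivatives. -/
structure IsPotential (I : Set ℝ) (R F M : ℝ → ℝ) : Prop where
  continuousOn : ContinuousOn M I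
  left : ∀ ξ ∈ I, ∀ r f, Tendsto R (𝓝[<] ξ) (𝓝 r) → Tendsto F (𝓝[<] ξ) (𝓝 f) →
    M ξ = f - ξ * r ∧ HasDerivWithinAt M (-r) (Iio ξ) ξ
  right : ∀ ξ ∈ I, ∀ r f, Tendsto R (𝓝[>] ξ) (𝓝 r) → Tendsto F (𝓝[>] ξ) (𝓝 f) →
    M ξ = f - ξ * r ∧ HasDerivWithinAt M (-r) (Ioi ξ) ξ

lemma tendsto_inv_nhdsGT_inv {ξ : ℝ} (hξ : 0 < ξ) :
    Tendsto (fun ζ : ℝ => ζ⁻¹) (𝓝[>] ξ⁻¹) (𝓝[<] ξ) := by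
  refine tendsto_nhdsWithin_iff.2 ⟨?_, ?_⟩
  · have := (continuousAt_inv₀ (inv_pos.2 hξ).ne').tendsto
    rw [inv_inv] at this
    exact this.mono_left nhdsWithin_le_nhds
  · filter_upwards [self_mem_nhdsWithin] with ζ hζ
    exact inv_lt_of_inv_lt₀ hξ hζ

lemma tendsto_inv_nhdsLT_inv {ξ : ℝ} (hξ : 0 < ξ) :
    Tendsto (fun ζ : ℝ => ζ⁻¹) (𝓝[<] ξ⁻¹) (𝓝[>] ξ) := by
  refine tendsto_nhdsWithin_iff.2 ⟨?_, ?_⟩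
  · have := (continuousAt_inv₀ (inv_pos.2 hξ).ne').tendsto
    rw [inv_inv] at this
    exact this.mono_left nhdsWithin_le_nhds
  · filter_upwards [self_mem_nhdsWithin, mem_nhdsWithin_of_mem_nhds (Ioi_mem_nhds (inv_pos.2 hξ))]
      with ζ hζ hζ0
    have hζ0 : 0 < ζ := hζ0
    exact (lt_inv_comm₀ hζ0 hξ).1 hζ

lemma frequently_of_ae_of_nhdsGT {P : ℝ → Prop} {a : ℝ} (h : ∀ᵐ x, a < x → P x) :
    ∃ᶠ x in 𝓝[>] a, P x := by
  intro hn
  obtain ⟨u, hu, hsub⟩ := mem_nhdsGT_iff_exists_Ioo_subset.1 hn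
  have h0 : volume (Ioo a u) = 0 := by
    refine measure_mono_null (fun x hx => ?_) (ae_iff.1 h)
    intro hc
    exact hsub hx (hc hx.1)
  rw [Real.volume_Ioo, ENNReal.ofReal_eq_zero] at h0
  have : a < u := hu
  linarith

lemma frequently_of_ae_of_nhdsLT {P : ℝ → Prop} {a b : ℝ} (hb : b < a)
    (h : ∀ᵐ x, b < x → P x) : ∃ᶠ x in 𝓝[<] a, P x := by
  intro hn
  obtain ⟨u, hu, hsub⟩ := mem_nhdsLT_iff_exists_Ioo_subset.1 hn
  have h0 : volume (Ioo (max u b) a) = 0 := by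
    refine measure_mono_null (fun x hx => ?_) (ae_iff.1 h)
    intro hc
    exact hsub ⟨(le_max_left _ _).trans_lt hx.1, hx.2⟩ (hc ((le_max_right _ _).trans_lt hx.1))
  rw [Real.volume_Ioo, ENNReal.ofReal_eq_zero] at h0
  have : max u b < a := max_lt hu hb
  linarith

/-- With `G` the primitive of `F s⁻¹`, the function `-ξ * (ρ₀ - G ξ⁻¹)` equals `F ξ - ξ * R ξ`
almost everywhere by `ae_eq`, and it is continuous. Where `R` and `F` have one-sided limits, `G` has
the matching one-sided derivative and the chain rule gives `M' = -R`. The limit at infinity comes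
from `G 0 = 0`. -/
lemma IsHalfLineWeakSolution.exists_isPotential {R F : ℝ → ℝ} {ρ₀ C : ℝ} (hR : Measurable R)
    (hF : Measurable F) (hRC : ∀ ξ, |R ξ| ≤ C) (hFC : ∀ ξ, |F ξ| ≤ C)
    (h : IsHalfLineWeakSolution R F ρ₀) :
    ∃ M, IsPotential (Ioi 0) R F M ∧ Tendsto (fun ξ => M ξ / ξ) atTop (𝓝 (-ρ₀)) := by
  have hC : 0 ≤ C := (abs_nonneg _).trans (hRC 0)
  have hFi : Measurable fun s : ℝ => F s⁻¹ := hF.comp measurable_inv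
  have iF : ∀ a b, IntervalIntegrable (fun s : ℝ => F s⁻¹) volume a b := fun a b =>
    (intervalIntegrable_const (c := C)).mono_fun hFi.aestronglyMeasurable
      (Eventually.of_forall fun s => by
        simpa [Real.norm_eq_abs, abs_of_nonneg hC] using hFC s⁻¹)
  have hae := h.ae_eq hR hF hRC hFC
  set G : ℝ → ℝ := fun ζ => ∫ s in (0 : ℝ)..ζ, F s⁻¹ with hG
  have cG : Continuous G := intervalIntegral.continuous_primitive iF 0
  set M : ℝ → ℝ := fun ξ => -ξ * (ρ₀ - G ξ⁻¹) with hM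
  have dM : ∀ ξ, 0 < ξ → ∀ (S T : Set ℝ) (f : ℝ), HasDerivWithinAt G f T ξ⁻¹ →
      MapsTo (fun ξ : ℝ => ξ⁻¹) S T → HasDerivWithinAt M (-(ρ₀ - G ξ⁻¹) - ξ⁻¹ * f) S ξ := by
    intro ξ hξ S T f hd hmap
    have h1 := hd.comp ξ (hasDerivAt_inv hξ.ne').hasDerivWithinAt hmap
    have h2 := (hasDerivWithinAt_id ξ S).neg.mul (h1.const_sub ρ₀)
    refine h2.congr_deriv ?_
    simp only [Function.comp]
    field_simp
    simp
    ring
  refine ⟨M, ⟨?_, ?_, ?_⟩, ?_⟩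
  · intro ξ hξ
    have hξ : 0 < ξ := hξ
    refine ContinuousAt.continuousWithinAt ?_
    exact continuousAt_id.neg.mul (continuousAt_const.sub
      (ContinuousAt.comp (f := fun ξ : ℝ => ξ⁻¹) cG.continuousAt (continuousAt_inv₀ hξ.ne')))
  · intro ξ hξ r f hr hf
    have hξ : 0 < ξ := hξ
    have hζ : 0 < ξ⁻¹ := inv_pos.2 hξ
    have t := tendsto_inv_nhdsGT_inv hξ
    -- The identity holds almost everywhere, hence at points arbitrarily close to `ξ⁻¹`. That
    -- suffices in the limit.
    have val : r - ξ⁻¹ * f - ρ₀ + G ξ⁻¹ = 0 := by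
      refine tendsto_nhds_unique_of_frequently_eq (f := fun ζ => R ζ⁻¹ - ζ * F ζ⁻¹ - ρ₀ + G ζ)
        (g := fun _ => 0) (l := 𝓝[>] ξ⁻¹) ?_ tendsto_const_nhds ?_
      · exact (((hr.comp t).sub ((tendsto_id.mono_left nhdsWithin_le_nhds).mul (hf.comp t))).sub
          tendsto_const_nhds).add (cG.continuousAt.mono_left nhdsWithin_le_nhds)
      · refine frequently_of_ae_of_nhdsGT ?_
        filter_upwards [hae] with ζ h1 h2 using h1 (hζ.trans h2)
    have dG : HasDerivWithinAt G f (Ici ξ⁻¹) ξ⁻¹ :=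
      intervalIntegral.integral_hasDerivWithinAt_of_tendsto_ae_right (iF 0 ξ⁻¹) (t := Ioi ξ⁻¹)
        hFi.stronglyMeasurable.stronglyMeasurableAtFilter ((hf.comp t).mono_left inf_le_left)
    constructor
    · simp only [hM]
      have : ρ₀ - G ξ⁻¹ = r - ξ⁻¹ * f := by linarith
      rw [this]
      field_simp
      ring
    · have := dM ξ hξ (Ioo 0 ξ) (Ici ξ⁻¹) f dG fun y hy => inv_anti₀ hy.1 hy.2.le
      refine (this.mono_of_mem_nhdsWithin (Ioo_mem_nhdsLT hξ)).congr_deriv ?_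
      linarith
  · intro ξ hξ r f hr hf
    have hξ : 0 < ξ := hξ
    have hζ : 0 < ξ⁻¹ := inv_pos.2 hξ
    have t := tendsto_inv_nhdsLT_inv hξ
    have val : r - ξ⁻¹ * f - ρ₀ + G ξ⁻¹ = 0 := by
      refine tendsto_nhds_unique_of_frequently_eq (f := fun ζ => R ζ⁻¹ - ζ * F ζ⁻¹ - ρ₀ + G ζ)
        (g := fun _ => 0) (l := 𝓝[<] ξ⁻¹) ?_ tendsto_const_nhds ?_
      · exact (((hr.comp t).sub ((tendsto_id.mono_left nhdsWithin_le_nhds).mul (hf.comp t))).sub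
          tendsto_const_nhds).add (cG.continuousAt.mono_left nhdsWithin_le_nhds)
      · exact frequently_of_ae_of_nhdsLT hζ hae
    have dG : HasDerivWithinAt G f (Iic ξ⁻¹) ξ⁻¹ :=
      intervalIntegral.integral_hasDerivWithinAt_of_tendsto_ae_right (iF 0 ξ⁻¹) (t := Iic ξ⁻¹)
        hFi.stronglyMeasurable.stronglyMeasurableAtFilter (by
          refine (hf.comp t).mono_left ?_
          rw [← Iic_sdiff_right, sdiff_eq, nhdsWithin_inter']
          exact inf_le_inf_left _ (le_principal_iff.2 (compl_mem_ae_iff.2 (measure_singleton _))))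
    constructor
    · simp only [hM]
      have : ρ₀ - G ξ⁻¹ = r - ξ⁻¹ * f := by linarith
      rw [this]
      field_simp
      ring
    · have := dM ξ hξ (Ioi ξ) (Iic ξ⁻¹) f dG fun y hy => inv_anti₀ hξ (le_of_lt hy)
      refine this.congr_deriv ?_
      linarith
  · have : Tendsto (fun ξ : ℝ => -(ρ₀ - G ξ⁻¹)) atTop (𝓝 (-(ρ₀ - G 0))) :=
      ((cG.tendsto 0).comp tendsto_inv_atTop_zero).const_sub ρ₀ |>.neg
    have hG0 : G 0 = 0 := by simp [hG]
    rw [hG0, sub_zero] at this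
    refine this.congr' ?_
    filter_upwards [eventually_gt_atTop 0] with ξ hξ
    simp only [hM]
    field_simp

lemma IsPotential.reflect {R F M : ℝ → ℝ}
    (h : IsPotential (Ioi 0) (fun ξ => R (-ξ)) (fun ξ => -F (-ξ)) M) :
    IsPotential (Iio 0) R F (fun ξ => -M (-ξ)) where
  continuousOn := (h.continuousOn.comp (s := Iio 0) continuous_neg.continuousOn
    fun ξ hξ => mem_Ioi.2 (neg_pos.2 (mem_Iio.1 hξ))).neg
  left ξ hξ r f hr hf := by
    have t : Tendsto (fun y : ℝ => -y) (𝓝[>] (-ξ)) (𝓝[<] ξ) := tendsto_neg_nhdsGT_neg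
    obtain ⟨h1, h2⟩ := h.right (-ξ) (mem_Ioi.2 (neg_pos.2 (mem_Iio.1 hξ))) r (-f) (hr.comp t) (hf.comp t).neg
    refine ⟨by rw [h1]; ring, ?_⟩
    have h3 := (h2.comp ξ (hasDerivAt_neg ξ).hasDerivWithinAt
      (fun y hy => mem_Ioi.2 (neg_lt_neg (mem_Iio.1 hy)))).neg
    exact h3.congr_deriv (by ring)
  right ξ hξ r f hr hf := by
    have t : Tendsto (fun y : ℝ => -y) (𝓝[<] (-ξ)) (𝓝[>] ξ) := tendsto_neg_nhdsLT_neg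
    obtain ⟨h1, h2⟩ := h.left (-ξ) (mem_Ioi.2 (neg_pos.2 (mem_Iio.1 hξ))) r (-f) (hr.comp t) (hf.comp t).neg
    refine ⟨by rw [h1]; ring, ?_⟩
    have h3 := (h2.comp ξ (hasDerivAt_neg ξ).hasDerivWithinAt
      (fun y hy => mem_Iio.2 (neg_lt_neg (mem_Ioi.1 hy)))).neg
    exact h3.congr_deriv (by ring)

/-- A function whose left limits all vanish vanishes off a countable set. -/
lemma countable_ne_zero_of_tendsto {I : Set ℝ} {d : ℝ → ℝ}
    (h : ∀ ξ ∈ I, Tendsto d (𝓝[<] ξ) (𝓝 0)) : {ξ ∈ I | d ξ ≠ 0}.Countable := by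
  have hsub : {ξ ∈ I | d ξ ≠ 0} ⊆ ⋃ n : ℕ, {ξ ∈ I | 1 / ((n : ℝ) + 1) < |d ξ|} := by
    rintro ξ ⟨hξ, hne⟩
    obtain ⟨n, hn⟩ := exists_nat_one_div_lt (abs_pos.2 hne)
    exact mem_iUnion.2 ⟨n, hξ, hn⟩
  refine Countable.mono hsub (countable_iUnion fun n => ?_)
  -- Just to the left of `ξ` the function is below the threshold, so every point of the superlevel
  -- set is isolated in it from the left.
  refine Countable.mono ?_ (countable_setOfPred_isolated_left_within
    (s := {ξ ∈ I | 1 / ((n : ℝ) + 1) < |d ξ|}))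
  intro ξ hξ
  refine ⟨hξ, ?_⟩
  rw [← empty_mem_iff_bot]
  have h1 : ∀ᶠ y in 𝓝[<] ξ, |d y| < 1 / ((n : ℝ) + 1) := by
    have := (h ξ hξ.1).abs
    rw [abs_zero] at this
    exact this.eventually (gt_mem_nhds (by positivity))
  rw [inter_comm, nhdsWithin_inter']
  refine mem_inf_of_inter h1 (mem_principal_self _) ?_
  intro y hy
  exact absurd hy.2.2 (not_lt.2 (le_of_lt hy.1))

end TrafficNetwork

namespace TrafficNetwork

/-! ### Waves of the scalar conservation law with concave flux -/

/-- `R` is a self-similar entropy solution of `∂ₜ ρ + ∂ₓ f(ρ) = 0` with values in `[0, K]`, and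
`m ξ = f (R ξ) - ξ R ξ`. -/
structure IsWave (f R m : ℝ → ℝ) (K : ℝ) : Prop where
  measurable : Measurable R
  nonneg : ∀ ξ, 0 ≤ R ξ
  le : ∀ ξ, R ξ ≤ K
  eq : ∀ ξ, m ξ = f (R ξ) - ξ * R ξ
  continuous : Continuous m
  hasDerivAt : ∃ s : Set ℝ, s.Countable ∧ ∀ ξ, ξ ∉ s → HasDerivAt m (-R ξ) ξ
  limits : ∀ ξ, ∃ a b, Tendsto R (𝓝[<] ξ) (𝓝 a) ∧ Tendsto R (𝓝[>] ξ) (𝓝 b) ∧ a ≤ b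

/-- By the Rankine-Hugoniot relation the two affine branches of `m` meet at `s`. As `a ≤ b`, `m` is
their minimum, hence continuous. -/
lemma isWave_shock {f : ℝ → ℝ} {a b s : ℝ} (ha : 0 ≤ a) (hab : a ≤ b)
    (hs : f b - f a = s * (b - a)) :
    IsWave f (fun ξ => if ξ < s then a else b)
      (fun ξ => if ξ < s then f a - ξ * a else f b - ξ * b) b where
  measurable := Measurable.ite measurableSet_Iio measurable_const measurable_const
  nonneg ξ := by split_ifs; exacts [ha, ha.trans hab]
  le ξ := by split_ifs; exacts [hab, le_rfl]
  eq ξ := by split_ifs <;> rfl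
  continuous := by
    have : (fun ξ => if ξ < s then f a - ξ * a else f b - ξ * b) =
        fun ξ => min (f a - ξ * a) (f b - ξ * b) := by
      funext ξ
      split_ifs with h
      · rw [min_eq_left]; nlinarith
      · rw [min_eq_right]; nlinarith
    rw [this]
    fun_prop
  hasDerivAt := by
    refine ⟨{s}, countable_singleton s, fun ξ hξ => ?_⟩
    have d : ∀ r : ℝ, HasDerivAt (fun ξ => f r - ξ * r) (-r) ξ := fun r =>
      (((hasDerivAt_id' ξ).mul_const r).const_sub (f r)).congr_deriv (by ring)
    rcases lt_or_gt_of_ne (hξ : ξ ≠ s) with h | h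
    · simp only [if_pos h]
      refine (d a).congr_of_eventuallyEq ?_
      filter_upwards [Iio_mem_nhds h] with y hy using if_pos hy
    · simp only [if_neg h.not_gt]
      refine (d b).congr_of_eventuallyEq ?_
      filter_upwards [Ioi_mem_nhds h] with y hy using if_neg (not_lt.2 (le_of_lt hy))
  limits := by
    intro ξ
    have L : ∀ (F : Filter ℝ) (c : ℝ), (∀ᶠ y in F, (if y < s then a else b) = c) →
        Tendsto (fun y => if y < s then a else b) F (𝓝 c) := fun F c h =>
      (tendsto_congr' h).2 tendsto_const_nhds
    rcases lt_trichotomy ξ s with h | h | h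
    · have h1 : ∀ᶠ y in 𝓝 ξ, (if y < s then a else b) = a := by
        filter_upwards [Iio_mem_nhds h] with y hy using if_pos hy
      exact ⟨a, a, L _ _ (h1.filter_mono nhdsWithin_le_nhds),
        L _ _ (h1.filter_mono nhdsWithin_le_nhds), le_rfl⟩
    · subst h
      refine ⟨a, b, L _ _ ?_, L _ _ ?_, hab⟩
      · filter_upwards [self_mem_nhdsWithin] with y hy using if_pos hy
      · filter_upwards [self_mem_nhdsWithin] with y hy using if_neg (not_lt.2 (le_of_lt hy))
    · have h1 : ∀ᶠ y in 𝓝 ξ, (if y < s then a else b) = b := by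
        filter_upwards [Ioi_mem_nhds h] with y hy using if_neg (not_lt.2 (le_of_lt hy))
      exact ⟨b, b, L _ _ (h1.filter_mono nhdsWithin_le_nhds),
        L _ _ (h1.filter_mono nhdsWithin_le_nhds), le_rfl⟩

/-- A rarefaction wave: the density at `ξ` maximizes `f r - ξ r` among `r ∈ [a, b]`. -/
lemma exists_isWave_rarefaction {f : ℝ → ℝ} {a b : ℝ} (ha : 0 ≤ a) (hab : a ≤ b)
    (hc : ContinuousOn f (Ici 0)) (hf : StrictConcaveOn ℝ (Ici 0) f) :
    ∃ R m, IsWave f R m b ∧ (∀ ξ, R ξ ∈ Icc a b) ∧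
      ∀ ξ, ∀ r ∈ Icc a b, f r - ξ * r ≤ m ξ := by
  have hsub : Icc a b ⊆ Ici 0 := Icc_subset_Ici_self.trans (Ici_subset_Ici.2 ha)
  have hcI : ContinuousOn f (Icc a b) := hc.mono hsub
  have hex : ∀ ξ, ∃ r ∈ Icc a b, ∀ y ∈ Icc a b, f y - ξ * y ≤ f r - ξ * r := fun ξ =>
    isCompact_Icc.exists_isMaxOn (nonempty_Icc.2 hab)
      (hcI.sub (by fun_prop : ContinuousOn (fun r => ξ * r) (Icc a b)))
  choose R hR hmax using hex
  have huniq : ∀ ξ r, r ∈ Icc a b → (∀ y ∈ Icc a b, f y - ξ * y ≤ f r - ξ * r) → r = R ξ := by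
    intro ξ r hr hrmax
    have hg : StrictConcaveOn ℝ (Icc a b) fun r => f r - ξ * r := by
      refine (hf.subset hsub (convex_Icc a b)).sub_convexOn ?_
      refine ⟨convex_Icc a b, fun x _ y _ s t _ _ _ => le_of_eq ?_⟩
      simp only [smul_eq_mul]; ring
    exact hg.eq_of_isMaxOn hrmax (hmax ξ) hr (hR ξ)
  -- Adding the optimality inequalities at `ξ` and `η` gives `(η - ξ) * (R ξ - R η) ≥ 0`.
  have hanti : Antitone R := by
    intro ξ η h
    rcases h.eq_or_lt with rfl | h
    · exact le_rfl
    by_contra! hlt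
    have h1 := hmax ξ (R η) (hR η)
    have h2 := hmax η (R ξ) (hR ξ)
    nlinarith
  -- As a maximum of affine functions of slope `-r` with `r ∈ [a, b]`, `m` is a Legendre transform:
  -- it is Lipschitz, and `m' = -R` by the envelope argument below.
  set m : ℝ → ℝ := fun ξ => f (R ξ) - ξ * R ξ with hm
  have hlow : ∀ ξ η, m ξ - (η - ξ) * R ξ ≤ m η := by
    intro ξ η
    have := hmax η (R ξ) (hR ξ)
    simp only [hm]; linarith
  have hb0 : 0 ≤ b := ha.trans hab
  have hlip : LipschitzWith b.toNNReal m := by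
    refine LipschitzWith.of_le_add_mul _ fun ξ η => ?_
    rw [Real.coe_toNNReal b hb0, Real.dist_eq]
    have h1 := hlow ξ η
    have h2 : (η - ξ) * R ξ ≤ b * |ξ - η| := by
      rw [abs_sub_comm, mul_comm]
      exact (mul_le_mul_of_nonneg_left (le_abs_self _) (ha.trans (hR ξ).1)).trans
        (mul_le_mul_of_nonneg_right (hR ξ).2 (abs_nonneg _))
    linarith
  -- A limit of maximizers is a maximizer, and strict concavity leaves only one. The monotone `R`
  -- therefore has no jumps.
  have hlimit : ∀ ξ (F : Filter ℝ) (c : ℝ) [F.NeBot], F ≤ 𝓝 ξ → Tendsto R F (𝓝 c) → c = R ξ := by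
    intro ξ F c _ hF hc'
    have hcI' : c ∈ Icc a b := isClosed_Icc.mem_of_tendsto hc' (Eventually.of_forall hR)
    have hf' : Tendsto (fun y => f (R y)) F (𝓝 (f c)) :=
      (hcI c hcI').tendsto.comp (tendsto_nhdsWithin_iff.2 ⟨hc', Eventually.of_forall hR⟩)
    refine huniq ξ c hcI' fun y hy => ?_
    have hid : Tendsto (fun η : ℝ => η) F (𝓝 ξ) := hF
    refine le_of_tendsto_of_tendsto' (tendsto_const_nhds.sub (hid.mul_const y))
      (hf'.sub (hid.mul hc')) fun η => hmax η y hy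
  have hlims : ∀ ξ, Tendsto R (𝓝[<] ξ) (𝓝 (R ξ)) ∧ Tendsto R (𝓝[>] ξ) (𝓝 (R ξ)) := by
    intro ξ
    have h1 := hanti.tendsto_nhdsLT ξ
    have h2 := hanti.tendsto_nhdsGT ξ
    have e1 := hlimit ξ _ _ nhdsWithin_le_nhds h1
    have e2 := hlimit ξ _ _ nhdsWithin_le_nhds h2
    rw [e1] at h1
    rw [e2] at h2
    exact ⟨h1, h2⟩
  have hcont : Continuous R := continuous_iff_continuousAt.2 fun ξ =>
    continuousAt_iff_continuous_left'_right'.2 ⟨(hlims ξ).1, (hlims ξ).2⟩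
  refine ⟨R, m, ⟨hcont.measurable, fun ξ => ha.trans (hR ξ).1, fun ξ => (hR ξ).2, fun ξ => rfl,
    hlip.continuous, ⟨∅, countable_empty, fun ξ _ => ?_⟩,
    fun ξ => ⟨R ξ, R ξ, (hlims ξ).1, (hlims ξ).2, le_rfl⟩⟩, hR, hmax⟩
  rw [hasDerivAt_iff_isLittleO]
  have h1 : (fun η => R η - R ξ) =o[𝓝 ξ] fun _ => (1 : ℝ) := by
    rw [Asymptotics.isLittleO_one_iff]
    simpa using (hcont.tendsto ξ).sub_const (R ξ)
  -- Optimality at both points gives `0 ≤ m η - m ξ + (η - ξ) * R ξ ≤ -(η - ξ) * (R η - R ξ)`.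
  have h2 : (fun η => m η - m ξ - (η - ξ) • -R ξ) =O[𝓝 ξ] fun η => (η - ξ) * (R η - R ξ) := by
    refine Asymptotics.IsBigO.of_bound 1 (Eventually.of_forall fun η => ?_)
    have e1 := hlow ξ η
    have e2 := hlow η ξ
    rw [one_mul, Real.norm_eq_abs, Real.norm_eq_abs, smul_eq_mul, abs_of_nonneg (by linarith)]
    refine le_trans ?_ (neg_le_abs _)
    linarith
  refine h2.trans_isLittleO ?_
  simpa using (Asymptotics.isBigO_refl (fun η => η - ξ) (𝓝 ξ)).mul_isLittleO h1

lemma IsWave.tendsto_div {f R m : ℝ → ℝ} {K C ρ₀ : ℝ} (h : IsWave f R m K)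
    (hC : ∀ r ∈ Icc 0 K, |f r| ≤ C) {l : Filter ℝ} (hl : Tendsto (fun ξ : ℝ => ξ⁻¹) l (𝓝 0))
    (hl0 : ∀ᶠ ξ in l, ξ ≠ 0) (hR : Tendsto R l (𝓝 ρ₀)) :
    Tendsto (fun ξ => m ξ / ξ) l (𝓝 (-ρ₀)) := by
  have h1 : Tendsto (fun ξ => f (R ξ) * ξ⁻¹) l (𝓝 0) := by
    refine (bdd_le_mul_tendsto_zero' C (Eventually.of_forall fun ξ => ?_) hl)
    exact hC _ ⟨h.nonneg ξ, h.le ξ⟩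
  have h2 := h1.sub hR
  rw [zero_sub] at h2
  refine h2.congr' ?_
  filter_upwards [hl0] with ξ hξ
  rw [h.eq]
  field_simp

end TrafficNetwork

namespace TrafficNetwork

/-! ### Riemann problems on the roads -/

namespace RegularPressure

variable {p : ℝ → ℝ} (hp : RegularPressure p)
include hp

lemma exists_flux_bound (w K : ℝ) : ∃ C, ∀ r ∈ Icc 0 K, |r * (w - p r)| ≤ C :=
  isCompact_Icc.exists_bound_of_continuousOn
    ((hp.flux_continuousOn w).mono Icc_subset_Ici_self)

/-- If `q` is at most the flux of `ρ₀`, a shock of speed at most `0` leads up to a state with flux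
`q` on the decreasing branch. Otherwise the demand bound forces `ρ₀ > σ`, and a rarefaction leads
down to such a state in `[σ, ρ₀]`; since the flux decreases there, `ξ = 0` selects the smallest
density. -/
lemma exists_isWave_incoming {w ρ₀ q : ℝ} (hw : 0 < w) (hρ : 0 ≤ ρ₀) (hq : 0 ≤ q)
    (hqd : q ≤ demand p ρ₀ w) : ∃ R m K, IsWave (fun r => r * (w - p r)) R m K ∧ m 0 = q ∧
      Tendsto R atBot (𝓝 ρ₀) := by
  rcases le_or_gt q (ρ₀ * (w - p ρ₀)) with hle | hlt
  · have hmax : q ≤ max ρ₀ (sigma p w) * (w - p (max ρ₀ (sigma p w))) := by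
      rcases le_total ρ₀ (sigma p w) with h | h
      · rw [max_eq_right h]; exact hle.trans (hp.flux_le_flux_sigma hw hρ)
      · rwa [max_eq_left h]
    obtain ⟨ρ₁, h1, h1q⟩ := hp.exists_flux_eq_right hw (le_max_right _ _) hq hmax
    have h01 : ρ₀ ≤ ρ₁ := (le_max_left _ _).trans h1
    set s := (q - ρ₀ * (w - p ρ₀)) / (ρ₁ - ρ₀) with hs
    have hs0 : s ≤ 0 := div_nonpos_of_nonpos_of_nonneg (by linarith) (by linarith)
    have hrh : ρ₁ * (w - p ρ₁) - ρ₀ * (w - p ρ₀) = s * (ρ₁ - ρ₀) := by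
      rcases h01.eq_or_lt with h | h
      · rw [← h]; ring
      · rw [hs, h1q, div_mul_cancel₀ _ (by linarith)]
    refine ⟨_, _, _, isWave_shock hρ h01 hrh, ?_, ?_⟩
    · simp only [not_lt.2 hs0, if_false]
      linarith
    · refine (tendsto_congr' ?_).2 tendsto_const_nhds
      filter_upwards [eventually_lt_atBot s] with ξ hξ using if_pos hξ
  · have hσ : sigma p w < ρ₀ := by
      by_contra! h
      rw [demand, if_pos h] at hqd
      linarith
    have hqσ : q ≤ sigma p w * (w - p (sigma p w)) := by rwa [demand, if_neg hσ.not_ge] at hqd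
    obtain ⟨ρ₁, h1, h1q⟩ := hp.exists_flux_eq_of_mem (w := w) (hp.sigma_nonneg hw) hσ.le
      (mem_uIcc_of_ge hlt.le hqσ)
    have h10 : 0 ≤ ρ₁ := (hp.sigma_nonneg hw).trans h1.1
    obtain ⟨R, m, hW, hR, hmax⟩ := exists_isWave_rarefaction h10 h1.2 (hp.flux_continuousOn w)
      (hp.strictConcaveOn w)
    refine ⟨R, m, _, hW, le_antisymm ?_ ?_, ?_⟩
    · rw [hW.eq, ← h1q]
      have := hp.flux_antitoneOn hw (mem_Ici.2 h1.1) (mem_Ici.2 (h1.1.trans (hR 0).1)) (hR 0).1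
      linarith
    · have := hmax 0 ρ₁ ⟨le_rfl, h1.2⟩
      linarith
    -- Wave speeds need not be bounded for a merely continuous pressure. Optimality against `ρ₀`
    -- gives `(ρ₀ - R ξ) * (-ξ) ≤ 2 * C`, hence convergence.
    · obtain ⟨C, hC⟩ := hp.exists_flux_bound w ρ₀
      have hlow : Tendsto (fun ξ : ℝ => ρ₀ - 2 * C * (-ξ)⁻¹) atBot (𝓝 ρ₀) := by
        have := (tendsto_inv_atTop_zero.comp (tendsto_neg_atBot_atTop (G := ℝ))).const_mul (2 * C)
        simpa using this.const_sub ρ₀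
      refine tendsto_of_tendsto_of_tendsto_of_le_of_le' hlow tendsto_const_nhds ?_
        (Eventually.of_forall fun ξ => (hR ξ).2)
      filter_upwards [eventually_lt_atBot 0] with ξ hξ
      have h2 := hmax ξ ρ₀ ⟨h1.2, le_rfl⟩
      rw [hW.eq] at h2
      have h3 := abs_le.1 (hC (R ξ) ⟨hW.nonneg ξ, hW.le ξ⟩)
      have h4 := abs_le.1 (hC ρ₀ ⟨hρ, le_rfl⟩)
      have h5 : (ρ₀ - R ξ) * (-ξ) ≤ 2 * C := by linarith
      rw [← le_div_iff₀ (by linarith), div_eq_mul_inv] at h5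
      linarith

/-- The wave ends at `rhoTilde`, which either has velocity `v` or is vacuum. If `q` is at most its
flux, a shock from the increasing branch with speed in `[0, v]` reaches it; otherwise the supply
bound puts it below `σ` and a rarefaction is used. The condition `m v = 0` says that no mass crosses
the ray `x = v * t`, where the initial state is to be attached. -/
lemma exists_isWave_outgoing {w v q : ℝ} (hw : 0 < w) (hv : 0 ≤ v) (hq : 0 ≤ q)
    (hqs : q ≤ supply p (rhoTilde p w v) w) :
    ∃ R m K, IsWave (fun r => r * (w - p r)) R m K ∧ m 0 = q ∧ m v = 0 := by
  set r := rhoTilde p w v with hr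
  have hr0 : 0 ≤ r := rhoTilde_nonneg w v
  have hσ := hp.sigma_nonneg hw
  have hrv : w - p r ≤ v := hp.rhoTilde_velocity_le w v
  have hrv0 : r * (w - p r - v) = 0 := hp.rhoTilde_mul w v
  rcases le_or_gt q (r * (w - p r)) with hle | hlt
  · have hle' : q ≤ min r (sigma p w) * (w - p (min r (sigma p w))) := by
      rcases le_total r (sigma p w) with h | h
      · rwa [min_eq_left h]
      · rw [min_eq_right h]; exact hle.trans (hp.flux_le_flux_sigma hw hr0)
    obtain ⟨ρ₁, h1, h1q⟩ := hp.exists_flux_eq_of_mem (w := w) le_rfl (le_min hr0 hσ)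
      (mem_uIcc_of_le (by simpa using hq) hle')
    have h1r : ρ₁ ≤ r := h1.2.trans (min_le_left _ _)
    set s := (r * (w - p r) - q) / (r - ρ₁) with hs
    have hs0 : 0 ≤ s := div_nonneg (by linarith) (by linarith)
    have hrh : r * (w - p r) - ρ₁ * (w - p ρ₁) = s * (r - ρ₁) := by
      rcases h1r.eq_or_lt with h | h
      · rw [← h]; ring
      · rw [hs, h1q, div_mul_cancel₀ _ (by linarith)]
    -- If `ρ₁ < r`, then `r` is not vacuum and has velocity `v`, while the smaller density `ρ₁`
    -- moves at least as fast. Hence `r * v - q ≤ v * (r - ρ₁)`.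
    have hsv : s ≤ v := by
      rcases h1r.eq_or_lt with h | h
      · rw [hs, h]; simpa using hv
      · have hr' : 0 < r := h1.1.trans_lt h
        have e : w - p r = v := by
          rcases mul_eq_zero.1 hrv0 with h0 | h0 <;> linarith
        have h2 : p ρ₁ ≤ p r := (hp.le_iff h1.1 hr0).2 h1r
        rw [hs, div_le_iff₀ (by linarith), ← h1q, e]
        nlinarith [h1.1]
    refine ⟨_, _, _, isWave_shock h1.1 h1r hrh, ?_, ?_⟩
    · split_ifs with h
      · simpa using h1q
      · have : s = 0 := le_antisymm (not_lt.1 h) hs0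
        rw [this] at hrh
        linarith
    · rw [if_neg (not_lt.2 hsv)]
      linarith
  · have hrσ : r ≤ sigma p w := by
      by_contra! h
      rw [supply, if_neg h.not_ge] at hqs
      linarith
    rw [supply, if_pos hrσ] at hqs
    obtain ⟨ρ₁, h1, h1q⟩ := hp.exists_flux_eq_of_mem (w := w) hr0 hrσ
      (mem_uIcc_of_le hlt.le hqs)
    obtain ⟨R, m, hW, hR, hmax⟩ := exists_isWave_rarefaction hr0 h1.1 (hp.flux_continuousOn w)
      (hp.strictConcaveOn w)
    refine ⟨R, m, _, hW, le_antisymm ?_ ?_, le_antisymm ?_ ?_⟩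
    · rw [hW.eq, ← h1q]
      have := hp.flux_monotoneOn hw ⟨hW.nonneg 0, (hR 0).2.trans h1.2⟩
        ⟨hr0.trans h1.1, h1.2⟩ (hR 0).2
      linarith
    · have := hmax 0 ρ₁ ⟨h1.1, le_rfl⟩
      linarith
    · rw [hW.eq]
      have h2 : p r ≤ p (R v) := (hp.le_iff hr0 (hW.nonneg v)).2 (hR v).1
      nlinarith [hW.nonneg v]
    · have := hmax v r ⟨le_rfl, h1.1⟩
      linarith

end RegularPressure

/-! ### Profiles of solutions on the roads -/

/-- Sufficient conditions on the profile `R` of a conserved density on an outgoing road with initial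
value `ρ₀` and boundary flux `q`. -/
structure IsOutgoingProfile (R m : ℝ → ℝ) (q ρ₀ : ℝ) : Prop where
  measurable : Measurable R
  measurable_m : Measurable m
  bounded : ∃ C, ∀ ξ, 0 < ξ → |R ξ| ≤ C ∧ |m ξ + ξ * R ξ| ≤ C
  hasDerivAt : ∃ s : Set ℝ, s.Countable ∧ ∀ ξ, 0 < ξ → ξ ∉ s → HasDerivAt m (-R ξ) ξ
  continuousOn : ContinuousOn m (Ici 0)
  boundary : m 0 = q
  initial : Tendsto (fun ξ => m ξ / ξ) atTop (𝓝 (-ρ₀))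

/-- Sufficient conditions on the profile `R` of a conserved density on an incoming road with initial
value `ρ₀` and boundary flux `q`. -/
def IsIncomingProfile (R m : ℝ → ℝ) (q ρ₀ : ℝ) : Prop :=
  IsOutgoingProfile (fun ξ => R (-ξ)) (fun ξ => -m (-ξ)) (-q) ρ₀

lemma IsOutgoingProfile.weak_form {R m : ℝ → ℝ} {q ρ₀ : ℝ} (h : IsOutgoingProfile R m q ρ₀)
    {u f : ℝ → ℝ → ℝ} (hu : ∀ x t, 0 < x → 0 < t → u x t = R (x / t))
    (hf : ∀ x t, 0 < x → 0 < t → f x t = m (x / t) + x / t * R (x / t))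
    {φ φx φt φxt : ℝ → ℝ → ℝ} {K : ℝ} (hφ : IsTestFunction φ φx φt φxt K) :
    (∫ t in Ioi (0 : ℝ), ∫ x in Ioi (0 : ℝ), (u x t * φt x t + f x t * φx x t)) +
      ∫ x in Ioi (0 : ℝ), ρ₀ * φ x 0 = -(q * ∫ t in Ioi (0 : ℝ), φ 0 t) := by
  obtain ⟨C, hC⟩ := h.bounded
  obtain ⟨s, hs, hd⟩ := h.hasDerivAt
  rw [← weak_form_of_hasDerivAt h.measurable h.measurable_m (fun ξ hξ => (hC ξ hξ).1)
    (fun ξ hξ => (hC ξ hξ).2) hs hd h.continuousOn h.boundary h.initial hφ]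
  congr 1
  refine setIntegral_congr_fun measurableSet_Ioi fun t ht =>
    setIntegral_congr_fun measurableSet_Ioi fun x hx => ?_
  simp only [hu x t hx ht, hf x t hx ht]

lemma integral_Iio_zero_eq (g : ℝ → ℝ) : ∫ x in Iio (0 : ℝ), g x = ∫ x in Ioi (0 : ℝ), g (-x) := by
  rw [← integral_Iic_eq_integral_Iio]
  simp

lemma IsIncomingProfile.weak_form {R m : ℝ → ℝ} {q ρ₀ : ℝ} (h : IsIncomingProfile R m q ρ₀)
    {u f : ℝ → ℝ → ℝ} (hu : ∀ x t, x < 0 → 0 < t → u x t = R (x / t))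
    (hf : ∀ x t, x < 0 → 0 < t → f x t = m (x / t) + x / t * R (x / t))
    {φ φx φt φxt : ℝ → ℝ → ℝ} {K : ℝ} (hφ : IsTestFunction φ φx φt φxt K) :
    (∫ t in Ioi (0 : ℝ), ∫ x in Iio (0 : ℝ), (u x t * φt x t + f x t * φx x t)) +
      ∫ x in Iio (0 : ℝ), ρ₀ * φ x 0 = q * ∫ t in Ioi (0 : ℝ), φ 0 t := by
  have := IsOutgoingProfile.weak_form h (u := fun x t => u (-x) t) (f := fun x t => -f (-x) t)
    (fun x t hx ht => by rw [hu (-x) t (by linarith) ht, neg_div])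
    (fun x t hx ht => by rw [hf (-x) t (by linarith) ht, neg_div]; ring) hφ.reflect
  simp only [neg_zero, neg_mul, mul_neg, neg_neg] at this
  simpa only [integral_Iio_zero_eq] using this

lemma IsOutgoingProfile.const_mul {R m : ℝ → ℝ} {q ρ₀ : ℝ} (h : IsOutgoingProfile R m q ρ₀)
    (a : ℝ) : IsOutgoingProfile (fun ξ => a * R ξ) (fun ξ => a * m ξ) (a * q) (a * ρ₀) where
  measurable := h.measurable.const_mul a
  measurable_m := h.measurable_m.const_mul a
  bounded := by
    obtain ⟨C, hC⟩ := h.bounded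
    refine ⟨|a| * C, fun ξ hξ => ⟨?_, ?_⟩⟩
    · rw [abs_mul]; exact mul_le_mul_of_nonneg_left (hC ξ hξ).1 (abs_nonneg a)
    · rw [show a * m ξ + ξ * (a * R ξ) = a * (m ξ + ξ * R ξ) by ring, abs_mul]
      exact mul_le_mul_of_nonneg_left (hC ξ hξ).2 (abs_nonneg a)
  hasDerivAt := by
    obtain ⟨s, hs, hd⟩ := h.hasDerivAt
    exact ⟨s, hs, fun ξ hξ hξs => ((hd ξ hξ hξs).const_mul a).congr_deriv (by ring)⟩
  continuousOn := continuousOn_const.mul h.continuousOn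
  boundary := by rw [h.boundary]
  initial := by
    have := h.initial.const_mul a
    rw [mul_neg] at this
    exact this.congr fun ξ => by ring

lemma IsIncomingProfile.const_mul {R m : ℝ → ℝ} {q ρ₀ : ℝ} (h : IsIncomingProfile R m q ρ₀)
    (a : ℝ) : IsIncomingProfile (fun ξ => a * R ξ) (fun ξ => a * m ξ) (a * q) (a * ρ₀) := by
  have := IsOutgoingProfile.const_mul h a
  simpa only [IsIncomingProfile, mul_neg] using this

lemma IsWave.isIncomingProfile {f R m : ℝ → ℝ} {K q ρ₀ : ℝ} (h : IsWave f R m K)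
    (hf : ∃ C, ∀ r ∈ Icc 0 K, |f r| ≤ C) (hq : m 0 = q) (hR : Tendsto R atBot (𝓝 ρ₀)) :
    IsIncomingProfile R m q ρ₀ := by
  obtain ⟨C, hC⟩ := hf
  have hlim := h.tendsto_div hC tendsto_inv_atBot_zero (eventually_ne_atBot 0) hR
  exact
    { measurable := h.measurable.comp measurable_neg
      measurable_m := (h.continuous.measurable.comp measurable_neg).neg
      bounded := by
        refine ⟨max K C, fun ξ hξ => ⟨?_, ?_⟩⟩
        · rw [abs_of_nonneg (h.nonneg _)]
          exact (h.le _).trans (le_max_left _ _)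
        · rw [h.eq]
          refine le_trans ?_ ((hC _ ⟨h.nonneg (-ξ), h.le (-ξ)⟩).trans (le_max_right _ _))
          rw [← abs_neg]
          exact le_of_eq (congrArg _ (by ring))
      hasDerivAt := by
        obtain ⟨s, hs, hd⟩ := h.hasDerivAt
        refine ⟨Neg.neg '' s, hs.image _, fun ξ hξ hξs => ?_⟩
        have h1 := hd (-ξ) fun hmem => hξs ⟨-ξ, hmem, neg_neg ξ⟩
        exact (h1.comp ξ (hasDerivAt_neg ξ)).neg.congr_deriv (by ring)
      continuousOn := (h.continuous.comp continuous_neg).neg.continuousOn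
      boundary := by rw [neg_zero, hq]
      initial := by
        refine (hlim.comp tendsto_neg_atTop_atBot).congr fun ξ => ?_
        simp only [Function.comp, div_neg, neg_div] }

/-- Both potentials vanish on the ray `ξ = v`, so the wave and the initial state fit together
whatever the factors. The factors `a`, `b` are `1` for mass and the two markers for momentum. -/
lemma IsWave.isOutgoingProfile {f R m : ℝ → ℝ} {K q v ρ₀ : ℝ} (h : IsWave f R m K)
    (hf : ∃ C, ∀ r ∈ Icc 0 K, |f r| ≤ C) (hv : 0 ≤ v) (hq : m 0 = q) (hmv : m v = 0) (a b : ℝ) :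
    IsOutgoingProfile (fun ξ => if v ≤ ξ then b * ρ₀ else a * R ξ)
      (fun ξ => if v ≤ ξ then b * ρ₀ * (v - ξ) else a * m ξ) (a * q) (b * ρ₀) := by
  obtain ⟨C, hC⟩ := hf
  have hcont : Continuous fun ξ => if v ≤ ξ then b * ρ₀ * (v - ξ) else a * m ξ :=
    Continuous.if_le (by fun_prop) (continuous_const.mul h.continuous) continuous_const
      continuous_id fun ξ hξ => by rw [← hξ, hmv]; ring
  exact
    { measurable := Measurable.ite measurableSet_Ici measurable_const (h.measurable.const_mul a)
      measurable_m := hcont.measurable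
      bounded := by
        refine ⟨|b * ρ₀| + |b * ρ₀ * v| + |a| * K + |a| * C, fun ξ hξ => ?_⟩
        have hK : 0 ≤ K := (h.nonneg 0).trans (h.le 0)
        have hC0 : 0 ≤ C := (abs_nonneg _).trans (hC 0 ⟨le_rfl, hK⟩)
        have e1 : 0 ≤ |a| * K := by positivity
        have e2 : 0 ≤ |a| * C := by positivity
        have e3 := abs_nonneg (b * ρ₀)
        have e4 := abs_nonneg (b * ρ₀ * v)
        split_ifs with hξv
        · refine ⟨by linarith, ?_⟩
          rw [show b * ρ₀ * (v - ξ) + ξ * (b * ρ₀) = b * ρ₀ * v by ring]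
          linarith
        · rw [h.eq, show a * (f (R ξ) - ξ * R ξ) + ξ * (a * R ξ) = a * f (R ξ) by ring, abs_mul a,
            abs_mul a, abs_of_nonneg (h.nonneg ξ)]
          have h1 := mul_le_mul_of_nonneg_left (h.le ξ) (abs_nonneg a)
          have h2 := mul_le_mul_of_nonneg_left (hC _ ⟨h.nonneg ξ, h.le ξ⟩) (abs_nonneg a)
          exact ⟨by linarith, by linarith⟩
      hasDerivAt := by
        obtain ⟨s, hs, hd⟩ := h.hasDerivAt
        refine ⟨s ∪ {v}, hs.union (countable_singleton v), fun ξ hξ hξs => ?_⟩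
        rw [mem_union, not_or] at hξs
        rcases lt_or_gt_of_ne (hξs.2 : ξ ≠ v) with h1 | h1
        · rw [if_neg h1.not_ge]
          refine HasDerivAt.congr_of_eventuallyEq
            (((hd ξ hξs.1).const_mul a).congr_deriv (by ring)) ?_
          filter_upwards [Iio_mem_nhds h1] with y hy using if_neg (not_le.2 hy)
        · rw [if_pos h1.le]
          refine HasDerivAt.congr_of_eventuallyEq
            ((((hasDerivAt_id' ξ).const_sub v).const_mul (b * ρ₀)).congr_deriv (by ring)) ?_
          filter_upwards [Ioi_mem_nhds h1] with y hy using if_pos (le_of_lt hy)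
      continuousOn := hcont.continuousOn
      boundary := by
        -- For `v = 0` there is no region behind the contact, and `m v = 0` forces `q = 0`.
        split_ifs with h0
        · have : v = 0 := le_antisymm h0 hv
          rw [this] at hmv ⊢
          rw [← hq, hmv]
          ring
        · rw [hq]
      initial := by
        have h1 : Tendsto (fun ξ : ℝ => b * ρ₀ * v * ξ⁻¹ - b * ρ₀) atTop (𝓝 (-(b * ρ₀))) := by
          simpa using (tendsto_inv_atTop_zero.const_mul (b * ρ₀ * v)).sub_const (b * ρ₀)
        refine h1.congr' ?_
        filter_upwards [eventually_ge_atTop v, eventually_gt_atTop 0] with ξ hξ hξ0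
        rw [if_pos hξ]
        field_simp }

/-- The density may jump at `0`, but `f (R ξ) = m ξ + ξ * R ξ`, where `m` is continuous and the last
term tends to `0`. -/
lemma IsWave.tendsto_flux {f R m : ℝ → ℝ} {K : ℝ} (h : IsWave f R m K) :
    Tendsto (fun ξ => f (R ξ)) (𝓝 0) (𝓝 (m 0)) := by
  have h1 : Tendsto (fun ξ => R ξ * ξ) (𝓝 0) (𝓝 0) := by
    refine bdd_le_mul_tendsto_zero' K (Eventually.of_forall fun ξ => ?_) tendsto_id
    rw [abs_of_nonneg (h.nonneg ξ)]
    exact h.le ξ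
  have h2 := (h.continuous.tendsto 0).add h1
  rw [add_zero] at h2
  refine h2.congr fun ξ => ?_
  rw [h.eq]
  ring

end TrafficNetwork

namespace TrafficNetwork

/-! ### Existence of a network solution -/

/-- Conserved densities given by profiles whose boundary fluxes balance at the junction solve the
weak form on the network. -/
lemma isWeakSolution_of_profiles {n m : ℕ} {u f : Fin n ⊕ Fin m → ℝ → ℝ → ℝ}
    {u₀ : Fin n ⊕ Fin m → ℝ} {q : Fin m → Fin n → ℝ} {a : Fin n → ℝ} {b : Fin m → ℝ}
    (hab : ∀ j, ∑ i, q j i * a i = b j)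
    (hin : ∀ i, ∃ R m, IsIncomingProfile R m (a i * qin q i) (u₀ (Sum.inl i)) ∧
      (∀ x t, x < 0 → 0 < t → u (Sum.inl i) x t = R (x / t)) ∧
      ∀ x t, x < 0 → 0 < t → f (Sum.inl i) x t = m (x / t) + x / t * R (x / t))
    (hout : ∀ j, ∃ R m, IsOutgoingProfile R m (b j) (u₀ (Sum.inr j)) ∧
      (∀ x t, 0 < x → 0 < t → u (Sum.inr j) x t = R (x / t)) ∧
      ∀ x t, 0 < x → 0 < t → f (Sum.inr j) x t = m (x / t) + x / t * R (x / t)) :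
    IsWeakSolution u f u₀ := by
  intro φ hφ
  have h1 : ∀ i, ((∫ t in Ioi (0 : ℝ), ∫ x in road (Sum.inl i : Fin n ⊕ Fin m),
        (u (Sum.inl i) x t * deriv (fun s => φ (Sum.inl i) x s) t +
          f (Sum.inl i) x t * deriv (fun y => φ (Sum.inl i) y t) x)) +
      ∫ x in road (Sum.inl i : Fin n ⊕ Fin m), u₀ (Sum.inl i) * φ (Sum.inl i) x 0) =
      ∑ j, q j i * a i * ∫ t in Ioi (0 : ℝ), φ (Sum.inl i) 0 t := by
    intro i
    obtain ⟨R, m', hR, hu, hf⟩ := hin i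
    obtain ⟨φxt, K, htf⟩ := exists_isTestFunction (hφ.1 (Sum.inl i)).1 (hφ.1 (Sum.inl i)).2
    refine (hR.weak_form hu hf htf).trans ?_
    rw [← Finset.sum_mul, ← Finset.sum_mul, qin, mul_comm (a i)]
  have h2 : ∀ j, ((∫ t in Ioi (0 : ℝ), ∫ x in road (Sum.inr j : Fin n ⊕ Fin m),
        (u (Sum.inr j) x t * deriv (fun s => φ (Sum.inr j) x s) t +
          f (Sum.inr j) x t * deriv (fun y => φ (Sum.inr j) y t) x)) +
      ∫ x in road (Sum.inr j : Fin n ⊕ Fin m), u₀ (Sum.inr j) * φ (Sum.inr j) x 0) =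
      -∑ i, q j i * a i * ∫ t in Ioi (0 : ℝ), φ (Sum.inr j) 0 t := by
    intro j
    obtain ⟨R, m', hR, hu, hf⟩ := hout j
    obtain ⟨φxt, K, htf⟩ := exists_isTestFunction (hφ.1 (Sum.inr j)).1 (hφ.1 (Sum.inr j)).2
    refine (hR.weak_form hu hf htf).trans ?_
    rw [← Finset.sum_mul, hab]
  rw [Fintype.sum_sum_type, Finset.sum_congr rfl fun i _ => h1 i,
    Finset.sum_congr rfl fun j _ => h2 j, Finset.sum_neg_distrib, Finset.sum_comm, ← sub_eq_add_neg,
    sub_eq_zero]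
  refine Finset.sum_congr rfl fun j _ => Finset.sum_congr rfl fun i _ => ?_
  congr 1
  exact setIntegral_congr_fun measurableSet_Ioi fun t ht => hφ.2 i j t (le_of_lt ht)

lemma tendsto_div_nhdsLT (x : ℝ) {t : ℝ} (ht : 0 < t) :
    Tendsto (fun y => y / t) (𝓝[<] x) (𝓝[<] (x / t)) :=
  tendsto_nhdsWithin_iff.2
    ⟨((continuous_id.div_const t).tendsto x).mono_left nhdsWithin_le_nhds, by
      filter_upwards [self_mem_nhdsWithin] with y hy
      exact div_lt_div_of_pos_right hy ht⟩

lemma tendsto_div_nhdsGT (x : ℝ) {t : ℝ} (ht : 0 < t) :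
    Tendsto (fun y => y / t) (𝓝[>] x) (𝓝[>] (x / t)) :=
  tendsto_nhdsWithin_iff.2
    ⟨((continuous_id.div_const t).tendsto x).mono_left nhdsWithin_le_nhds, by
      filter_upwards [self_mem_nhdsWithin] with y hy
      exact div_lt_div_of_pos_right hy ht⟩

lemma div_mem_road {n m : ℕ} {r : Fin n ⊕ Fin m} {x t : ℝ} (ht : 0 < t) (hx : x ∈ road r) :
    x / t ∈ road r := by
  cases r with
  | inl i => exact div_neg_of_neg_of_pos hx ht
  | inr j => exact div_pos hx ht

lemma isOpen_road {n m : ℕ} (r : Fin n ⊕ Fin m) : IsOpen (road r) := by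
  cases r with
  | inl i => exact isOpen_Iio
  | inr j => exact isOpen_Ioi

namespace Junction

variable {n m : ℕ} (J : Junction n m)

lemma velocity_div (S : NetworkState n m) (r : Fin n ⊕ Fin m) {x t : ℝ} (ht : 0 < t)
    (hρ : S.ρ r x t = S.ρ r (x / t) 1) (hw : S.w r x t = S.w r (x / t) 1) :
    J.velocity S r x t = J.velocity S r (x / t) 1 := by
  unfold velocity
  rw [hρ, hw]
  cases r with
  | inl i => rfl
  | inr j =>
    have : x < t * J.v₀ j ↔ x / t < 1 * J.v₀ j := by rw [div_lt_iff₀ ht, one_mul, mul_comm]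
    simp only [pressureAt, this]

lemma _root_.TrafficNetwork.RegularPressure.tendsto_comp {p : ℝ → ℝ} (hp : RegularPressure p)
    {R : ℝ → ℝ} {l : Filter ℝ} {a : ℝ} [l.NeBot] (hR : ∀ᶠ ξ in l, 0 ≤ R ξ)
    (h : Tendsto R l (𝓝 a)) : 0 ≤ a ∧ Tendsto (fun ξ => p (R ξ)) l (𝓝 (p a)) := by
  have ha : 0 ≤ a := ge_of_tendsto h hR
  exact ⟨ha, (hp.continuousOn a ha).tendsto.comp (tendsto_nhdsWithin_iff.2 ⟨h, hR⟩)⟩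

theorem exists_isNetworkSolution : ∃ S : NetworkState n m, J.IsNetworkSolution S := by
  set P : Fin m → ℝ → ℝ := fun j ρ => J.cbar j * ρ ^ J.γ with hPdef
  have hP : ∀ j, J.IsApproxPressure j (P j) := fun j =>
    (J.isApproxPressure_iff j (P j)).2 fun ρ _ => rfl
  have hPr : ∀ j, RegularPressure (P j) := fun j => (hP j).regular
  have hpr : ∀ i, RegularPressure (J.pin i) := fun i => (J.pin_law i).regular
  obtain ⟨q, hq, hqmax⟩ := exists_isAdmissibleFlux_max (J := J) hPr
  have hin := fun i => (hpr i).exists_isWave_incoming (J.w₀_in_pos i) (J.ρ₀_in_nonneg i)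
    (hq.demand_bound i).1 (hq.demand_bound i).2
  have hout := fun j => (hPr j).exists_isWave_outgoing (J.wbar_pos j) (J.v₀_nonneg j)
    (hq.supply_bound j).1 (hq.supply_bound j).2
  choose Ri mi Ki hWi hqi hρi using hin
  choose Ro mo Ko hWo hqo hvo using hout
  set ρ' : Fin n ⊕ Fin m → ℝ → ℝ := fun r ξ => match r with
    | Sum.inl i => Ri i ξ
    | Sum.inr j => if J.v₀ j ≤ ξ then J.ρ₀ (Sum.inr j) else Ro j ξ with hρ'
  set w' : Fin n ⊕ Fin m → ℝ → ℝ := fun r ξ => match r with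
    | Sum.inl i => J.w₀ (Sum.inl i)
    | Sum.inr j => if J.v₀ j ≤ ξ then J.w₀ (Sum.inr j) else J.wbar j with hw'
  set S : NetworkState n m := ⟨fun r x t => ρ' r (x / t), fun r x t => w' r (x / t), P⟩ with hS
  have hmρ : ∀ r, Measurable (ρ' r) := by
    rintro (i | j)
    · exact (hWi i).measurable
    · exact Measurable.ite measurableSet_Ici measurable_const (hWo j).measurable
  have hmw : ∀ r, Measurable (w' r) := by
    rintro (i | j)
    · exact measurable_const
    · exact Measurable.ite measurableSet_Ici measurable_const measurable_const
  have hρ0 : ∀ r ξ, 0 ≤ ρ' r ξ := by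
    rintro (i | j) ξ
    · exact (hWi i).nonneg ξ
    · simp only [hρ']
      split_ifs
      exacts [(J.ρ₀_out_pos j).le, (hWo j).nonneg ξ]
  have hbd : ∀ r, ∃ M, ∀ ξ, |ρ' r ξ| ≤ M ∧ |w' r ξ| ≤ M := by
    rintro (i | j)
    · refine ⟨max (Ki i) |J.w₀ (Sum.inl i)|, fun ξ => ⟨?_, le_max_right _ _⟩⟩
      exact (abs_of_nonneg ((hWi i).nonneg ξ)).le.trans (((hWi i).le ξ).trans (le_max_left _ _))
    · refine ⟨max (max (J.ρ₀ (Sum.inr j)) (Ko j)) (max |J.w₀ (Sum.inr j)| |J.wbar j|),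
        fun ξ => ⟨?_, ?_⟩⟩
      · refine (abs_of_nonneg (hρ0 (Sum.inr j) ξ)).le.trans (le_trans ?_ (le_max_left _ _))
        simp only [hρ']
        split_ifs
        exacts [le_max_left _ _, ((hWo j).le ξ).trans (le_max_right _ _)]
      · refine le_trans ?_ (le_max_right _ _)
        simp only [hw']
        split_ifs
        exacts [le_max_left _ _, le_max_right _ _]
  have hself : ∀ r x t, S.ρ r x t = S.ρ r (x / t) 1 ∧ S.w r x t = S.w r (x / t) 1 := by
    intro r x t
    simp only [hS, div_one, and_self]
  have hvin : ∀ i x t, J.velocity S (Sum.inl i) x t =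
      J.w₀ (Sum.inl i) - J.pin i (Ri i (x / t)) := fun i x t => rfl
  have hvout : ∀ j x t, 0 < t → J.velocity S (Sum.inr j) x t =
      if J.v₀ j ≤ x / t then J.v₀ j else J.wbar j - P j (Ro j (x / t)) := by
    intro j x t ht
    have : x < t * J.v₀ j ↔ ¬ J.v₀ j ≤ x / t := by rw [not_le, div_lt_iff₀ ht, mul_comm]
    simp only [velocity, pressureAt, hS, hρ', hw', this]
    split_ifs with h
    · rfl
    · rfl
  -- One computation serves both conservation laws: mass has all factors equal to `1`, while
  -- momentum takes the incoming, homogenized and initial markers. The balance condition for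
  -- momentum is the mixture rule.
  have weak : ∀ a : Fin n → ℝ, ∀ b c : Fin m → ℝ, (∀ j, ∑ i, q j i * a i = b j * qout q j) →
      IsWeakSolution (fun r x t => S.ρ r x t * match r with
        | Sum.inl i => a i
        | Sum.inr j => if J.v₀ j ≤ x / t then c j else b j)
      (fun r x t => S.ρ r x t * J.velocity S r x t * match r with
        | Sum.inl i => a i
        | Sum.inr j => if J.v₀ j ≤ x / t then c j else b j)
      (fun r => J.ρ₀ r * match r with
        | Sum.inl i => a i
        | Sum.inr j => c j) := by
    intro a b c hab
    refine isWeakSolution_of_profiles (q := q) hab (fun i => ?_) (fun j => ?_)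
    · have h := ((hWi i).isIncomingProfile ((hpr i).exists_flux_bound _ _) (hqi i)
        (hρi i)).const_mul (a i)
      refine ⟨_, _, mul_comm (a i) (J.ρ₀ (Sum.inl i)) ▸ h, fun x t _ _ => mul_comm _ _,
        fun x t _ _ => ?_⟩
      simp only [hvin, (hWi i).eq]
      simp only [hS, hρ']
      ring
    · have h := (hWo j).isOutgoingProfile ((hPr j).exists_flux_bound _ _) (J.v₀_nonneg j) (hqo j)
        (hvo j) (ρ₀ := J.ρ₀ (Sum.inr j)) (b j) (c j)
      refine ⟨_, _, mul_comm (c j) (J.ρ₀ (Sum.inr j)) ▸ h, fun x t _ ht => ?_, fun x t _ ht => ?_⟩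
      · simp only [hS, hρ']
        split_ifs <;> ring
      · simp only [hvout j x t ht, (hWo j).eq]
        simp only [hS, hρ']
        split_ifs <;> ring
  have entropy1 : ∀ r, ∀ ξ ∈ (road r : Set ℝ), ∃ ρl ρr wl wr vl vr : ℝ,
      Tendsto (fun y => S.ρ r y 1) (𝓝[<] ξ) (𝓝 ρl) ∧
      Tendsto (fun y => S.ρ r y 1) (𝓝[>] ξ) (𝓝 ρr) ∧
      Tendsto (fun y => S.w r y 1) (𝓝[<] ξ) (𝓝 wl) ∧
      Tendsto (fun y => S.w r y 1) (𝓝[>] ξ) (𝓝 wr) ∧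
      Tendsto (fun y => J.velocity S r y 1) (𝓝[<] ξ) (𝓝 vl) ∧
      Tendsto (fun y => J.velocity S r y 1) (𝓝[>] ξ) (𝓝 vr) ∧
      (0 < ρl → 0 < ρr ∧ vr ≤ vl) := by
    rintro (i | j) ξ hξ
    · obtain ⟨a, b, ha, hb, hab⟩ := (hWi i).limits ξ
      obtain ⟨ha0, hpa⟩ := (hpr i).tendsto_comp (Eventually.of_forall (hWi i).nonneg) ha
      obtain ⟨hb0, hpb⟩ := (hpr i).tendsto_comp (Eventually.of_forall (hWi i).nonneg) hb
      refine ⟨a, b, _, _, J.w₀ (Sum.inl i) - J.pin i a, J.w₀ (Sum.inl i) - J.pin i b, ?_, ?_,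
        tendsto_const_nhds, tendsto_const_nhds,
        ?_, ?_, fun h => ⟨h.trans_le hab, ?_⟩⟩
      · simpa [hS, hρ'] using ha
      · simpa [hS, hρ'] using hb
      · simpa [hvin] using hpa.const_sub (J.w₀ (Sum.inl i))
      · simpa [hvin] using hpb.const_sub (J.w₀ (Sum.inl i))
      · exact sub_le_sub_left (((hpr i).le_iff ha0 hb0).2 hab) _
    · obtain ⟨a, b, ha, hb, hab⟩ := (hWo j).limits ξ
      obtain ⟨ha0, hpa⟩ := (hPr j).tendsto_comp (Eventually.of_forall (hWo j).nonneg) ha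
      obtain ⟨hb0, hpb⟩ := (hPr j).tendsto_comp (Eventually.of_forall (hWo j).nonneg) hb
      have low : ∀ (l : Filter ℝ) (c : ℝ), (∀ᶠ y in l, y < J.v₀ j) → Tendsto (Ro j) l (𝓝 c) →
          Tendsto (fun ξ => P j (Ro j ξ)) l (𝓝 (P j c)) →
          Tendsto (fun y => S.ρ (Sum.inr j) y 1) l (𝓝 c) ∧
          Tendsto (fun y => S.w (Sum.inr j) y 1) l (𝓝 (J.wbar j)) ∧
          Tendsto (fun y => J.velocity S (Sum.inr j) y 1) l (𝓝 (J.wbar j - P j c)) := by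
        intro l c hl h1 h2
        refine ⟨h1.congr' ?_, tendsto_const_nhds.congr' ?_, (h2.const_sub (J.wbar j)).congr' ?_⟩
        · filter_upwards [hl] with y hy
          simp only [hS, hρ', div_one, if_neg (not_le.2 hy)]
        · filter_upwards [hl] with y hy
          simp only [hS, hw', div_one, if_neg (not_le.2 hy)]
        · filter_upwards [hl] with y hy
          simp only [hvout j y 1 one_pos, div_one, if_neg (not_le.2 hy)]
      have high : ∀ (l : Filter ℝ), (∀ᶠ y in l, J.v₀ j ≤ y) →
          Tendsto (fun y => S.ρ (Sum.inr j) y 1) l (𝓝 (J.ρ₀ (Sum.inr j))) ∧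
          Tendsto (fun y => S.w (Sum.inr j) y 1) l (𝓝 (J.w₀ (Sum.inr j))) ∧
          Tendsto (fun y => J.velocity S (Sum.inr j) y 1) l (𝓝 (J.v₀ j)) := by
        intro l hl
        refine ⟨tendsto_const_nhds.congr' ?_, tendsto_const_nhds.congr' ?_,
          tendsto_const_nhds.congr' ?_⟩
        · filter_upwards [hl] with y hy
          simp only [hS, hρ', div_one, if_pos hy]
        · filter_upwards [hl] with y hy
          simp only [hS, hw', div_one, if_pos hy]
        · filter_upwards [hl] with y hy
          simp only [hvout j y 1 one_pos, div_one, if_pos hy]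
      rcases lt_trichotomy ξ (J.v₀ j) with h | h | h
      · have hev : ∀ᶠ y in 𝓝 ξ, y < J.v₀ j := Iio_mem_nhds h
        have hl := low _ a (hev.filter_mono nhdsWithin_le_nhds) ha hpa
        have hr := low _ b (hev.filter_mono nhdsWithin_le_nhds) hb hpb
        exact ⟨_, _, _, _, _, _, hl.1, hr.1, hl.2.1, hr.2.1, hl.2.2, hr.2.2,
          fun h => ⟨h.trans_le hab, sub_le_sub_left (((hPr j).le_iff ha0 hb0).2 hab) _⟩⟩
      · have hl := low (𝓝[<] ξ) a (by
          filter_upwards [self_mem_nhdsWithin] with y hy using h ▸ hy) ha hpa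
        have hr := high (𝓝[>] ξ) (by
          filter_upwards [self_mem_nhdsWithin] with y hy using h ▸ le_of_lt hy)
        refine ⟨_, _, _, _, _, _, hl.1, hr.1, hl.2.1, hr.2.1, hl.2.2, hr.2.2,
          fun ha' => ⟨J.ρ₀_out_pos j, ?_⟩⟩
        -- The vanishing potential at the contact forces the left velocity to be `v₀` unless the
        -- left state is vacuum.
        have e : (0 : ℝ) = a * (J.wbar j - P j a) - ξ * a := by
          have h1 : Tendsto (mo j) (𝓝[<] ξ) (𝓝 (mo j ξ)) :=
            (hWo j).continuous.continuousAt.mono_left nhdsWithin_le_nhds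
          rw [h, hvo j, ← h] at h1
          have hid : Tendsto (fun y : ℝ => y) (𝓝[<] ξ) (𝓝 ξ) := nhdsWithin_le_nhds
          refine tendsto_nhds_unique h1
            (((ha.mul (hpa.const_sub (J.wbar j))).sub (hid.mul ha)).congr fun y => ?_)
          rw [(hWo j).eq]
        have e2 : a * (J.wbar j - P j a - J.v₀ j) = 0 := by rw [← h]; linarith
        rcases mul_eq_zero.1 e2 with h0 | h0 <;> linarith
      · have hev : ∀ᶠ y in 𝓝 ξ, J.v₀ j ≤ y := by
          filter_upwards [Ioi_mem_nhds h] with y hy using le_of_lt hy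
        have hl := high _ (hev.filter_mono (nhdsWithin_le_nhds (s := Iio ξ)))
        have hr := high _ (hev.filter_mono (nhdsWithin_le_nhds (s := Ioi ξ)))
        exact ⟨_, _, _, _, _, _, hl.1, hr.1, hl.2.1, hr.2.1, hl.2.2, hr.2.2,
          fun _ => ⟨J.ρ₀_out_pos j, le_rfl⟩⟩
  refine ⟨S, ?_⟩
  exact
    { measurable_ρ := fun r => (hmρ r).comp (measurable_fst.div measurable_snd)
      measurable_w := fun r => (hmw r).comp (measurable_fst.div measurable_snd)
      bounded := by
        choose M hM using hbd
        have hM0 : ∀ r, 0 ≤ M r := fun r => (abs_nonneg _).trans (hM r 0).1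
        refine ⟨∑ r, M r, fun r x _ t _ => ?_⟩
        have := Finset.single_le_sum (f := M) (fun r _ => hM0 r) (Finset.mem_univ r)
        exact ⟨(hM r _).1.trans this, (hM r _).2.trans this⟩
      ρ_nonneg := fun r x _ t _ => hρ0 r _
      self_similar := fun r x _ t _ => hself r x t
      mass := by
        have := weak (fun _ => 1) (fun _ => 1) (fun _ => 1) fun j => by simp [qout]
        convert this using 1
        · funext r x t
          cases r <;> simp
        · funext r x t
          cases r <;> simp
        · funext r
          cases r <;> simp
      momentum := by
        have := weak (fun i => J.w₀ (Sum.inl i)) J.wbar (fun j => J.w₀ (Sum.inr j)) fun j => by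
          rw [wbar, Finset.sum_mul]
          refine Finset.sum_congr rfl fun i _ => ?_
          rw [hq.mixture_eq]
          ring
        refine fun φ hφ => Eq.trans (Finset.sum_congr rfl fun r _ => ?_) (this φ hφ)
        cases r <;> rfl
      entropy := by
        intro r t ht x hx
        obtain ⟨ρl, ρr, wl, wr, vl, vr, h1, h2, h3, h4, h5, h6, h7⟩ :=
          entropy1 r (x / t) (div_mem_road ht hx)
        have tl := tendsto_div_nhdsLT x ht
        have tr := tendsto_div_nhdsGT x ht
        have hv : ∀ y, J.velocity S r (y / t) 1 = J.velocity S r y t := fun y =>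
          (J.velocity_div S r ht (hself r y t).1 (hself r y t).2).symm
        exact ⟨ρl, ρr, wl, wr, vl, vr, (h1.comp tl).congr fun y => (hself r y t).1.symm,
          (h2.comp tr).congr fun y => (hself r y t).1.symm,
          (h3.comp tl).congr fun y => (hself r y t).2.symm,
          (h4.comp tr).congr fun y => (hself r y t).2.symm,
          (h5.comp tl).congr hv, (h6.comp tr).congr hv, h7⟩
      pressure := hP
      marker := by
        intro j x t ht _ hxt
        simp only [hS, hw']
        rw [if_neg]
        rw [not_le, div_lt_iff₀ ht, mul_comm]
        exact hxt
      flux := by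
        refine ⟨q, hq, hqmax, fun i t ht => ?_, fun j t ht => ?_⟩
        · have h1 := (hWi i).tendsto_flux
          rw [hqi] at h1
          have h2 : Tendsto (fun x : ℝ => x / t) (𝓝[<] 0) (𝓝 0) := by
            simpa using (tendsto_div_nhdsLT 0 ht).mono_right nhdsWithin_le_nhds
          exact h1.comp h2
        · have h2 : Tendsto (fun x : ℝ => x / t) (𝓝[>] 0) (𝓝[>] 0) := by
            simpa using tendsto_div_nhdsGT 0 ht
          -- If `v₀ = 0`, the trace at the junction is that of the initial state, whose flux is `0`.
          -- This agrees with `q`, as the potential vanishes at `v₀`.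
          rcases (J.v₀_nonneg j).eq_or_lt with h0 | h0
          · have hq0 : qout q j = 0 :=
              (hqo j).symm.trans ((congrArg (mo j) h0).trans (hvo j))
            rw [hq0]
            refine tendsto_const_nhds.congr' ?_
            filter_upwards [self_mem_nhdsWithin] with x hx
            rw [hvout j x t ht, if_pos (h0 ▸ (div_pos hx ht).le), ← h0, mul_zero]
          · have h1 := ((hWo j).tendsto_flux).comp (h2.mono_right nhdsWithin_le_nhds)
            rw [hqo] at h1
            refine h1.congr' ?_
            filter_upwards [h2.eventually (mem_nhdsWithin_of_mem_nhds (Iio_mem_nhds h0))] with x hx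
            have hx : x / t < J.v₀ j := hx
            rw [hvout j x t ht, if_neg (not_le.2 hx)]
            simp only [hS, hρ', if_neg (not_le.2 hx)]
            rfl }

end Junction

end TrafficNetwork

namespace TrafficNetwork

/-! ### Comparison principles for potentials -/

lemma nonneg_of_hasDerivWithinAt_Iio {y : ℝ → ℝ} {ξ d : ℝ} (h : HasDerivWithinAt y d (Iio ξ) ξ)
    (hm : ∀ᶠ η in 𝓝[<] ξ, y η ≤ y ξ) : 0 ≤ d := by
  refine ge_of_tendsto ((hasDerivWithinAt_iff_tendsto_slope' (by simp)).1 h) ?_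
  filter_upwards [hm, self_mem_nhdsWithin] with η h1 h2
  rw [slope_def_field]
  exact div_nonneg_of_nonpos (sub_nonpos.2 h1) (sub_nonpos.2 (le_of_lt h2))

lemma nonpos_of_hasDerivWithinAt_Ioi {y : ℝ → ℝ} {ξ d : ℝ} (h : HasDerivWithinAt y d (Ioi ξ) ξ)
    (hm : ∀ᶠ η in 𝓝[>] ξ, y η ≤ y ξ) : d ≤ 0 := by
  refine le_of_tendsto ((hasDerivWithinAt_iff_tendsto_slope' (by simp)).1 h) ?_
  filter_upwards [hm, self_mem_nhdsWithin] with η h1 h2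
  rw [slope_def_field]
  exact div_nonpos_of_nonpos_of_nonneg (sub_nonpos.2 h1) (sub_nonneg.2 (le_of_lt h2))

/-- A function that is positive at `ξ₀` and no larger than a multiple of `g` away from `[a, b]`
touches a positive multiple of the weight `g` from below. -/
lemma exists_touching {D g : ℝ → ℝ} {I : Set ℝ} {a b ξ₀ : ℝ} (hab : Icc a b ⊆ I)
    (hD : ContinuousOn D I) (hg : ContinuousOn g I) (hpos : ∀ ξ ∈ I, 0 < g ξ)
    (hξ₀ : ξ₀ ∈ Icc a b) (h0 : 0 < D ξ₀) (ha : ∀ ξ ∈ I, ξ < a → D ξ / g ξ ≤ D ξ₀ / g ξ₀)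
    (hb : ∀ ξ ∈ I, b < ξ → D ξ / g ξ ≤ D ξ₀ / g ξ₀) :
    ∃ ξ ∈ I, ∃ c, 0 < c ∧ D ξ = c * g ξ ∧ ∀ η ∈ I, D η ≤ c * g η := by
  obtain ⟨ξ, hξ, hmax⟩ := isCompact_Icc.exists_isMaxOn ⟨ξ₀, hξ₀⟩
    ((hD.div hg fun ξ hξ => (hpos ξ hξ).ne').mono hab)
  have hle : D ξ₀ / g ξ₀ ≤ D ξ / g ξ := hmax hξ₀
  refine ⟨ξ, hab hξ, D ξ / g ξ, (div_pos h0 (hpos _ (hab hξ₀))).trans_le hle,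
    (div_mul_cancel₀ _ (hpos _ (hab hξ)).ne').symm, fun η hη => ?_⟩
  rw [← div_le_iff₀ (hpos η hη)]
  rcases lt_or_ge η a with h | h
  · exact (ha η hη h).trans hle
  rcases lt_or_ge b η with h' | h'
  · exact (hb η hη h').trans hle
  · exact hmax ⟨h, h'⟩

lemma antitoneOn_of_hasDerivWithinAt_Ioi {M : ℝ → ℝ} {I : Set ℝ} [OrdConnected I]
    (hM : ContinuousOn M I) (h : ∀ ξ ∈ I, ∃ r, 0 ≤ r ∧ HasDerivWithinAt M (-r) (Ioi ξ) ξ) :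
    AntitoneOn M I := by
  intro a ha b hb hab
  choose! r hr hd using h
  have hsub : Icc a b ⊆ I := Set.Icc_subset I ha hb
  exact image_le_of_deriv_right_le_deriv_boundary (hM.mono hsub) (B := fun _ => M a)
    (fun x hx => (hd x (hsub (Ico_subset_Icc_self hx))).Ici_of_Ioi) le_rfl continuousOn_const
    (fun x _ => hasDerivWithinAt_const x _ _)
    (fun x hx => neg_nonpos.2 (hr x (hsub (Ico_subset_Icc_self hx)))) (right_mem_Icc.2 hab)

/-- The potential of a self-similar solution of the conservation law with flux `f` whose jumps are
all increasing. -/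
structure IsEntropyPotential (f : ℝ → ℝ) (I : Set ℝ) (M : ℝ → ℝ) : Prop where
  continuousOn : ContinuousOn M I
  traces : ∀ ξ ∈ I, ∃ a b, 0 ≤ a ∧ a ≤ b ∧ M ξ = f a - ξ * a ∧ M ξ = f b - ξ * b ∧
    HasDerivWithinAt M (-a) (Iio ξ) ξ ∧ HasDerivWithinAt M (-b) (Ioi ξ) ξ

/-- This is where the entropy condition enters: at a jump `f r - ξ * r` has the same value at both
ends, and by concavity it is no smaller in between. -/
lemma concaveOn_le_of_nested {f : ℝ → ℝ} (hf : ConcaveOn ℝ (Ici 0) f) {ξ a b c x y : ℝ}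
    (ha : 0 ≤ a) (hac : a ≤ c) (hcb : c ≤ b) (hx : x = f a - ξ * a) (hx' : x = f b - ξ * b)
    (hy : y = f c - ξ * c) : x ≤ y := by
  have hconv : ConcaveOn ℝ (Ici 0) fun r => f r - ξ * r := by
    have h1 : ConvexOn ℝ (Ici (0 : ℝ)) fun r => ξ * r :=
      ((LinearMap.mulLeft ℝ ξ).convexOn (convex_Ici 0))
    exact hf.sub h1
  have := hconv.min_le_of_mem_Icc (x := a) (y := b) (z := c) ha (ha.trans (hac.trans hcb)) ⟨hac, hcb⟩
  rw [← hx, ← hx', min_self] at this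
  exact hy ▸ this

/-- Comparison on a bounded interval. -/
lemma IsEntropyPotential.le_of_Ioo {f M₁ M₂ : ℝ → ℝ} {a b : ℝ} (hf : ConcaveOn ℝ (Ici 0) f)
    (h₁ : IsEntropyPotential f (Ioo a b) M₁) (h₂ : IsEntropyPotential f (Ioo a b) M₂)
    (ha : Tendsto (fun ξ => M₁ ξ - M₂ ξ) (𝓝[>] a) (𝓝 0))
    (hb : Tendsto (fun ξ => M₁ ξ - M₂ ξ) (𝓝[<] b) (𝓝 0)) : ∀ ξ ∈ Ioo a b, M₁ ξ ≤ M₂ ξ := by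
  intro ξ₀ hξ₀
  by_contra! hlt
  have h0 : 0 < M₁ ξ₀ - M₂ ξ₀ := sub_pos.2 hlt
  obtain ⟨u, hu, hua⟩ := mem_nhdsGT_iff_exists_Ioo_subset.1 (ha.eventually (gt_mem_nhds h0))
  obtain ⟨v, hv, hvb⟩ := mem_nhdsLT_iff_exists_Ioo_subset.1 (hb.eventually (gt_mem_nhds h0))
  have hu' : a < min u ξ₀ := lt_min hu hξ₀.1
  have hv' : max v ξ₀ < b := max_lt hv hξ₀.2
  obtain ⟨ξ, hξ, c, hc, he, hle⟩ := exists_touching (D := fun ξ => M₁ ξ - M₂ ξ) (g := fun _ => 1)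
    (I := Ioo a b) (a := min u ξ₀) (b := max v ξ₀) (ξ₀ := ξ₀)
    (fun x hx => ⟨hu'.trans_le hx.1, hx.2.trans_lt hv'⟩)
    (h₁.continuousOn.sub h₂.continuousOn) continuousOn_const (fun _ _ => one_pos)
    ⟨min_le_right _ _, le_max_right _ _⟩ h0
    (fun ξ hξ h => by
      simpa using (le_of_lt (hua ⟨hξ.1, h.trans_le (min_le_left _ _)⟩) : M₁ ξ - M₂ ξ ≤ M₁ ξ₀ - M₂ ξ₀))
    (fun ξ hξ h => by
      simpa using (le_of_lt (hvb ⟨(le_max_left _ _).trans_lt h, hξ.2⟩) : M₁ ξ - M₂ ξ ≤ M₁ ξ₀ - M₂ ξ₀))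
  obtain ⟨a₁, b₁, ha₁, hab₁, e₁, e₁', d₁, d₁'⟩ := h₁.traces ξ hξ
  obtain ⟨a₂, b₂, ha₂, hab₂, e₂, e₂', d₂, d₂'⟩ := h₂.traces ξ hξ
  have hev : ∀ᶠ η in 𝓝 ξ, M₁ η - M₂ η ≤ M₁ ξ - M₂ ξ := by
    filter_upwards [isOpen_Ioo.mem_nhds hξ] with η hη using (hle η hη).trans_eq he.symm
  -- At a positive maximum of `M₁ - M₂` the one-sided derivatives give `a₁ ≤ a₂` and `b₂ ≤ b₁`. The
  -- jump intervals are nested, hence `M₁ ≤ M₂` at this point.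
  have k1 := nonneg_of_hasDerivWithinAt_Iio (d₁.fun_sub d₂) (hev.filter_mono nhdsWithin_le_nhds)
  have k2 := nonpos_of_hasDerivWithinAt_Ioi (d₁'.fun_sub d₂') (hev.filter_mono nhdsWithin_le_nhds)
  have := concaveOn_le_of_nested hf ha₁ (by linarith : a₁ ≤ a₂) (by linarith : a₂ ≤ b₁) e₁ e₁' e₂
  simp only [mul_one] at he
  linarith

lemma RegularPressure.le_of_mul_le {p : ℝ → ℝ} (hp : RegularPressure p) {a b : ℝ} (ha : 0 ≤ a)
    (hb : 0 ≤ b) (h : a * p a ≤ b * p b) : a ≤ b := by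
  by_contra! hlt
  have h1 := (hp.lt_iff hb ha).2 hlt
  have h2 := hp.nonneg hb
  nlinarith

lemma RegularPressure.concaveOn {p : ℝ → ℝ} (hp : RegularPressure p) (w : ℝ) :
    ConcaveOn ℝ (Ici 0) fun r => r * (w - p r) := (hp.strictConcaveOn w).concaveOn

/-- Comparison on the negative half-line for data that agree at the origin and at infinity. -/
lemma IsEntropyPotential.le_of_Iio {p M₁ M₂ : ℝ → ℝ} {w : ℝ} (hp : RegularPressure p) (hw : 0 < w)
    (h₁ : IsEntropyPotential (fun r => r * (w - p r)) (Iio 0) M₁)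
    (h₂ : IsEntropyPotential (fun r => r * (w - p r)) (Iio 0) M₂)
    (hbot : Tendsto (fun ξ => (M₁ ξ - M₂ ξ) / (w - ξ)) atBot (𝓝 0))
    (hzero : Tendsto (fun ξ => M₁ ξ - M₂ ξ) (𝓝[<] 0) (𝓝 0)) : ∀ ξ < 0, M₁ ξ ≤ M₂ ξ := by
  intro ξ₀ hξ₀
  by_contra! hlt
  have h0 : 0 < M₁ ξ₀ - M₂ ξ₀ := sub_pos.2 hlt
  have hq : 0 < (M₁ ξ₀ - M₂ ξ₀) / (w - ξ₀) := div_pos h0 (by linarith)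
  obtain ⟨u, hu⟩ := eventually_atBot.1 (hbot.eventually (gt_mem_nhds hq))
  have hz : Tendsto (fun ξ => (M₁ ξ - M₂ ξ) / (w - ξ)) (𝓝[<] 0) (𝓝 0) := by
    have h1 : Tendsto (fun ξ : ℝ => w - ξ) (𝓝[<] 0) (𝓝 (w - 0)) :=
      (tendsto_const_nhds.sub tendsto_id).mono_left nhdsWithin_le_nhds
    have h2 := hzero.div h1 (by simpa using hw.ne')
    rw [zero_div] at h2
    exact h2
  obtain ⟨v, hv, hvb⟩ := mem_nhdsLT_iff_exists_Ioo_subset.1 (hz.eventually (gt_mem_nhds hq))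
  have hv' : max v ξ₀ < 0 := max_lt hv hξ₀
  obtain ⟨ξ, hξ, c, hc, he, hle⟩ := exists_touching (D := fun ξ => M₁ ξ - M₂ ξ)
    (g := fun ξ => w - ξ)
    (I := Iio 0) (a := min u ξ₀) (b := max v ξ₀) (ξ₀ := ξ₀)
    (fun x hx => hx.2.trans_lt hv')
    (h₁.continuousOn.sub h₂.continuousOn) (continuous_const.sub continuous_id).continuousOn
    (fun ξ hξ => by linarith [mem_Iio.1 hξ])
    ⟨min_le_right _ _, le_max_right _ _⟩ h0
    (fun ξ hξ h => le_of_lt (hu ξ (h.le.trans (min_le_left _ _))))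
    (fun ξ hξ h => le_of_lt (hvb ⟨(le_max_left _ _).trans_lt h, hξ⟩))
  obtain ⟨a₁, b₁, ha₁, hab₁, e₁, e₁', d₁, d₁'⟩ := h₁.traces ξ hξ
  obtain ⟨a₂, b₂, ha₂, hab₂, e₂, e₂', d₂, d₂'⟩ := h₂.traces ξ hξ
  have hlin : HasDerivAt (fun ξ : ℝ => c * (w - ξ)) (-c) ξ :=
    (((hasDerivAt_id' ξ).const_sub w).const_mul c).congr_deriv (by ring)
  have hev : ∀ᶠ η in 𝓝 ξ, M₁ η - M₂ η - c * (w - η) ≤ M₁ ξ - M₂ ξ - c * (w - ξ) := by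
    filter_upwards [isOpen_Iio.mem_nhds hξ] with η hη
    linarith [hle η hη]
  have k1 := nonneg_of_hasDerivWithinAt_Iio ((d₁.fun_sub d₂).fun_sub hlin.hasDerivWithinAt)
    (hev.filter_mono nhdsWithin_le_nhds)
  have k2 := nonpos_of_hasDerivWithinAt_Ioi ((d₁'.fun_sub d₂').fun_sub hlin.hasDerivWithinAt)
    (hev.filter_mono nhdsWithin_le_nhds)
  have hwξ : 0 < w - ξ := by linarith [mem_Iio.1 hξ]
  -- The difference is only `o(ξ)` at infinity, hence a weight of linear growth. For the weight `w -
  -- ξ` the linear parts combine to `a₁ * p a₁ - a₂ * p a₂ = (a₁ - a₂ - c) * (w - ξ)`, which is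
  -- nonpositive by `k1`. The same identity and `k2` treat `b₁`, `b₂`.
  have k3 : a₁ ≤ a₂ := hp.le_of_mul_le ha₁ ha₂ (by nlinarith)
  have k4 : b₂ ≤ b₁ := hp.le_of_mul_le (ha₂.trans hab₂) (ha₁.trans hab₁) (by nlinarith)
  have := concaveOn_le_of_nested (hp.concaveOn w) ha₁ k3 (hab₂.trans k4) e₁ e₁' e₂
  nlinarith [mul_pos hc hwξ]

/-! ### Self-similar solutions on one road -/

/-- One-sided trace at `ξ`, from the side `s`, of a self-similar solution with density `R`, marker
`W` and velocity `V`, and of its mass and momentum potentials. -/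
structure IsTrace (R W V M N : ℝ → ℝ) (s : Set ℝ) (ξ r w v : ℝ) : Prop where
  nonneg : 0 ≤ r
  tendsto_density : Tendsto R (𝓝[s] ξ) (𝓝 r)
  tendsto_marker : Tendsto W (𝓝[s] ξ) (𝓝 w)
  tendsto_velocity : Tendsto V (𝓝[s] ξ) (𝓝 v)
  mass : M ξ = r * (v - ξ)
  momentum : N ξ = r * w * (v - ξ)
  hasDerivWithinAt_mass : HasDerivWithinAt M (-r) s ξ
  hasDerivWithinAt_momentum : HasDerivWithinAt N (-(r * w)) s ξ

lemma IsTrace.velocity_eq {R W V M N p : ℝ → ℝ} {s : Set ℝ} {ξ r w v : ℝ} [(𝓝[s] ξ).NeBot]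
    (h : IsTrace R W V M N s ξ r w v) (hp : RegularPressure p)
    (hV : ∀ᶠ η in 𝓝[s] ξ, 0 ≤ R η ∧ V η = W η - p (R η)) : v = w - p r := by
  have h1 := (hp.tendsto_comp (hV.mono fun _ h => h.1) h.tendsto_density).2
  exact tendsto_nhds_unique_of_eventuallyEq h.tendsto_velocity (h.tendsto_marker.sub h1)
    (hV.mono fun _ h => h.2)

/-- A self-similar entropy solution of the Aw-Rascle-Zhang system on the open set `I`, with its
mass and momentum potentials. -/
structure IsRoadSolution (I : Set ℝ) (R W V M N : ℝ → ℝ) (C : ℝ) : Prop where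
  isOpen : IsOpen I
  nonneg : ∀ ξ ∈ I, 0 ≤ R ξ
  abs_density_le : ∀ ξ ∈ I, |R ξ| ≤ C
  abs_velocity_le : ∀ ξ ∈ I, |V ξ| ≤ C
  mass : IsPotential I R (fun ξ => R ξ * V ξ) M
  momentum : IsPotential I (fun ξ => R ξ * W ξ) (fun ξ => R ξ * V ξ * W ξ) N
  entropy : ∀ ξ ∈ I, ∃ rl rr wl wr vl vr : ℝ,
    Tendsto R (𝓝[<] ξ) (𝓝 rl) ∧ Tendsto R (𝓝[>] ξ) (𝓝 rr) ∧
    Tendsto W (𝓝[<] ξ) (𝓝 wl) ∧ Tendsto W (𝓝[>] ξ) (𝓝 wr) ∧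
    Tendsto V (𝓝[<] ξ) (𝓝 vl) ∧ Tendsto V (𝓝[>] ξ) (𝓝 vr) ∧ (0 < rl → 0 < rr ∧ vr ≤ vl)

namespace IsRoadSolution

variable {I : Set ℝ} {R W V M N : ℝ → ℝ} {C : ℝ}

lemma exists_isTrace (h : IsRoadSolution I R W V M N C) {ξ : ℝ} (hξ : ξ ∈ I) :
    ∃ rl wl vl rr wr vr, IsTrace R W V M N (Iio ξ) ξ rl wl vl ∧
      IsTrace R W V M N (Ioi ξ) ξ rr wr vr ∧ (0 < rl → 0 < rr ∧ vr ≤ vl) ∧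
      rl ≤ C ∧ rr ≤ C ∧ |vl| ≤ C ∧ |vr| ≤ C := by
  obtain ⟨rl, rr, wl, wr, vl, vr, h1, h2, h3, h4, h5, h6, h7⟩ := h.entropy ξ hξ
  have hev : ∀ᶠ η in 𝓝 ξ, η ∈ I := h.isOpen.mem_nhds hξ
  have hl : ∀ᶠ η in 𝓝[<] ξ, η ∈ I := hev.filter_mono nhdsWithin_le_nhds
  have hr : ∀ᶠ η in 𝓝[>] ξ, η ∈ I := hev.filter_mono nhdsWithin_le_nhds
  obtain ⟨m1, d1⟩ := h.mass.left ξ hξ _ _ h1 (h1.mul h5)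
  obtain ⟨m2, d2⟩ := h.momentum.left ξ hξ _ _ (h1.mul h3) ((h1.mul h5).mul h3)
  obtain ⟨m3, d3⟩ := h.mass.right ξ hξ _ _ h2 (h2.mul h6)
  obtain ⟨m4, d4⟩ := h.momentum.right ξ hξ _ _ (h2.mul h4) ((h2.mul h6).mul h4)
  refine ⟨rl, wl, vl, rr, wr, vr,
    ⟨ge_of_tendsto h1 (hl.mono h.nonneg), h1, h3, h5, by rw [m1]; ring, by rw [m2]; ring, d1, d2⟩,
    ⟨ge_of_tendsto h2 (hr.mono h.nonneg), h2, h4, h6, by rw [m3]; ring, by rw [m4]; ring, d3, d4⟩,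
    h7, le_of_tendsto h1 (hl.mono fun η hη => (le_abs_self _).trans (h.abs_density_le η hη)),
    le_of_tendsto h2 (hr.mono fun η hη => (le_abs_self _).trans (h.abs_density_le η hη)),
    le_of_tendsto h5.abs (hl.mono h.abs_velocity_le),
    le_of_tendsto h6.abs (hr.mono h.abs_velocity_le)⟩

lemma mono (h : IsRoadSolution I R W V M N C) {U : Set ℝ} (hU : IsOpen U) (hUI : U ⊆ I) :
    IsRoadSolution U R W V M N C where
  isOpen := hU
  nonneg ξ hξ := h.nonneg ξ (hUI hξ)
  abs_density_le ξ hξ := h.abs_density_le ξ (hUI hξ)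
  abs_velocity_le ξ hξ := h.abs_velocity_le ξ (hUI hξ)
  mass := ⟨h.mass.continuousOn.mono hUI, fun ξ hξ => h.mass.left ξ (hUI hξ),
    fun ξ hξ => h.mass.right ξ (hUI hξ)⟩
  momentum := ⟨h.momentum.continuousOn.mono hUI, fun ξ hξ => h.momentum.left ξ (hUI hξ),
    fun ξ hξ => h.momentum.right ξ (hUI hξ)⟩
  entropy ξ hξ := h.entropy ξ (hUI hξ)

lemma antitoneOn_mass (h : IsRoadSolution I R W V M N C) [OrdConnected I] : AntitoneOn M I :=
  antitoneOn_of_hasDerivWithinAt_Ioi h.mass.continuousOn fun ξ hξ => by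
    obtain ⟨rl, wl, vl, rr, wr, vr, -, hr, -⟩ := h.exists_isTrace hξ
    exact ⟨rr, hr.nonneg, hr.hasDerivWithinAt_mass⟩

lemma velocity_left (h : IsRoadSolution I R W V M N C) {p : ℝ → ℝ} (hp : RegularPressure p)
    (hV : ∀ ξ ∈ I, V ξ = W ξ - p (R ξ)) {ξ r w v : ℝ} (hξ : ξ ∈ I)
    (ht : IsTrace R W V M N (Iio ξ) ξ r w v) : v = w - p r :=
  ht.velocity_eq hp <| by
    filter_upwards [mem_nhdsWithin_of_mem_nhds (h.isOpen.mem_nhds hξ)] with η hη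
    exact ⟨h.nonneg η hη, hV η hη⟩

lemma velocity_right (h : IsRoadSolution I R W V M N C) {p : ℝ → ℝ} (hp : RegularPressure p)
    (hV : ∀ ξ ∈ I, V ξ = W ξ - p (R ξ)) {ξ r w v : ℝ} (hξ : ξ ∈ I)
    (ht : IsTrace R W V M N (Ioi ξ) ξ r w v) : v = w - p r :=
  ht.velocity_eq hp <| by
    filter_upwards [mem_nhdsWithin_of_mem_nhds (h.isOpen.mem_nhds hξ)] with η hη
    exact ⟨h.nonneg η hη, hV η hη⟩

/-- The boundary value of the mass potential at an endpoint at the origin is the boundary flux. -/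
lemma tendsto_mass (h : IsRoadSolution I R W V M N C) {q : ℝ}
    (hI : ∀ᶠ ξ in 𝓝[I] (0 : ℝ), ξ ∈ I)
    (hq : Tendsto (fun ξ => R ξ * V ξ) (𝓝[I] 0) (𝓝 q)) : Tendsto M (𝓝[I] 0) (𝓝 q) := by
  have h1 : Tendsto (fun ξ => R ξ * ξ) (𝓝[I] 0) (𝓝 0) := by
    refine bdd_le_mul_tendsto_zero' C (hI.mono h.abs_density_le) ?_
    exact tendsto_id.mono_left nhdsWithin_le_nhds
  have h2 : Tendsto (fun ξ => R ξ * V ξ - R ξ * ξ) (𝓝[I] 0) (𝓝 q) := by simpa using hq.sub h1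
  refine Metric.tendsto_nhds.2 fun ε hε => ?_
  -- `M ξ` is the left limit of `R V - η R` at `ξ`, so closeness to `q` must hold at all points near
  -- `ξ` before passing to that limit.
  have h3 := eventually_eventually_nhdsWithin.2 (Metric.tendsto_nhds.1 h2 (ε / 2) (half_pos hε))
  filter_upwards [h3, hI] with ξ hξ hξI
  obtain ⟨rl, wl, vl, rr, wr, vr, hl, -⟩ := h.exists_isTrace hξI
  have h4 : Tendsto (fun η => R η * V η - R η * η) (𝓝[<] ξ) (𝓝 (M ξ)) := by
    have hid : Tendsto (fun y : ℝ => y) (𝓝[<] ξ) (𝓝 ξ) := nhdsWithin_le_nhds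
    have := (hl.tendsto_density.mul hl.tendsto_velocity).sub (hl.tendsto_density.mul hid)
    rwa [← mul_sub, ← hl.mass] at this
  rw [h.isOpen.nhdsWithin_eq hξI] at hξ
  have h5 : dist (M ξ) q ≤ ε / 2 :=
    le_of_tendsto (h4.dist tendsto_const_nhds)
      ((hξ.filter_mono nhdsWithin_le_nhds).mono fun _ h => le_of_lt h)
  linarith

end IsRoadSolution

/-- Solutions with the same potentials agree outside a countable set. -/
lemma IsRoadSolution.countable_ne {U : Set ℝ} {R₁ W₁ V₁ M₁ N₁ R₂ W₂ V₂ M₂ N₂ : ℝ → ℝ} {C₁ C₂ : ℝ}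
    (h₁ : IsRoadSolution U R₁ W₁ V₁ M₁ N₁ C₁) (h₂ : IsRoadSolution U R₂ W₂ V₂ M₂ N₂ C₂)
    (hM : ∀ ξ ∈ U, M₁ ξ = M₂ ξ) (hN : ∀ ξ ∈ U, N₁ ξ = N₂ ξ) :
    {ξ ∈ U | ¬ (R₁ ξ = R₂ ξ ∧ R₁ ξ * W₁ ξ = R₂ ξ * W₂ ξ)}.Countable := by
  have key : ∀ ξ ∈ U, Tendsto (fun η => R₁ η - R₂ η) (𝓝[<] ξ) (𝓝 0) ∧
      Tendsto (fun η => R₁ η * W₁ η - R₂ η * W₂ η) (𝓝[<] ξ) (𝓝 0) := by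
    intro ξ hξ
    obtain ⟨r₁, w₁, v₁, -, -, -, t₁, -⟩ := h₁.exists_isTrace hξ
    obtain ⟨r₂, w₂, v₂, -, -, -, t₂, -⟩ := h₂.exists_isTrace hξ
    have hev : ∀ᶠ η in 𝓝[<] ξ, η ∈ U :=
      mem_nhdsWithin_of_mem_nhds (h₁.isOpen.mem_nhds hξ)
    -- Equal potentials have equal left derivatives, so the differences of the conserved densities
    -- have vanishing left limits.
    have e1 : -r₁ = -r₂ := (uniqueDiffWithinAt_Iio ξ).eq_deriv _ t₁.hasDerivWithinAt_mass
      (t₂.hasDerivWithinAt_mass.congr_of_eventuallyEq (hev.mono hM) (hM ξ hξ))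
    have e2 : -(r₁ * w₁) = -(r₂ * w₂) :=
      (uniqueDiffWithinAt_Iio ξ).eq_deriv _ t₁.hasDerivWithinAt_momentum
        (t₂.hasDerivWithinAt_momentum.congr_of_eventuallyEq (hev.mono hN) (hN ξ hξ))
    constructor
    · have := t₁.tendsto_density.sub t₂.tendsto_density
      rwa [neg_inj.1 e1, sub_self] at this
    · have := (t₁.tendsto_density.mul t₁.tendsto_marker).sub
        (t₂.tendsto_density.mul t₂.tendsto_marker)
      rwa [neg_inj.1 e2, sub_self] at this
  refine ((countable_ne_zero_of_tendsto fun ξ hξ => (key ξ hξ).1).union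
    (countable_ne_zero_of_tendsto fun ξ hξ => (key ξ hξ).2)).mono fun ξ hξ => ?_
  rcases not_and_or.1 hξ.2 with h | h
  · exact Or.inl ⟨hξ.1, sub_ne_zero.2 h⟩
  · exact Or.inr ⟨hξ.1, sub_ne_zero.2 h⟩

end TrafficNetwork

/-! ### Determination of the marker and of the initial state on each road -/

namespace TrafficNetwork

lemma tendsto_div_const_sub_atBot {D : ℝ → ℝ} {L : ℝ} (hL : 0 ≤ L)
    (h : Tendsto (fun ξ => D ξ / ξ) atBot (𝓝 0)) :
    Tendsto (fun ξ => D ξ / (L - ξ)) atBot (𝓝 0) := by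
  refine squeeze_zero_norm' ?_ (by simpa using h.abs)
  filter_upwards [eventually_lt_atBot 0] with ξ hξ
  rw [norm_div, abs_div]
  refine div_le_div_of_nonneg_left (abs_nonneg _) (abs_pos.2 hξ.ne) ?_
  rw [abs_of_neg hξ, Real.norm_of_nonneg (by linarith)]
  linarith

lemma tendsto_div_add_const_atTop {D : ℝ → ℝ} {L : ℝ} (hL : 0 ≤ L)
    (h : Tendsto (fun ξ => D ξ / ξ) atTop (𝓝 0)) :
    Tendsto (fun ξ => D ξ / (ξ + L)) atTop (𝓝 0) := by
  refine squeeze_zero_norm' ?_ (by simpa using h.abs)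
  filter_upwards [eventually_gt_atTop 0] with ξ hξ
  rw [norm_div, abs_div]
  refine div_le_div_of_nonneg_left (abs_nonneg _) (abs_pos.2 hξ.ne') ?_
  rw [abs_of_pos hξ, Real.norm_of_nonneg (by linarith)]
  linarith

namespace IsRoadSolution

variable {R W V M N : ℝ → ℝ} {C : ℝ}

/-! #### Incoming roads -/

/-- `N - w₀ * M` obeys a transport equation whose characteristics come from `-∞` wherever `M > 0`,
because there `v > ξ`. At a contact with `c * (C + 1 - ξ)` the left derivative bounds the momentum
excess by `c`, hence `N - w₀ * M` by `c * (v - ξ)`, which is too small since `v ≤ C`. The factor `ε`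
is used with both signs. -/
lemma momentum_le_of_Iio (h : IsRoadSolution (Iio 0) R W V M N C) {w₀ ρ₀ ε : ℝ}
    (hM0 : ∀ ξ < 0, 0 ≤ M ξ) (hM : Tendsto (fun ξ => M ξ / ξ) atBot (𝓝 (-ρ₀)))
    (hN : Tendsto (fun ξ => N ξ / ξ) atBot (𝓝 (-(ρ₀ * w₀)))) {ξ₀ : ℝ} (hξ₀ : ξ₀ < 0) :
    ε * (N ξ₀ - w₀ * M ξ₀) ≤ 0 := by
  by_contra! h0
  have hC : 0 ≤ C := (abs_nonneg _).trans (h.abs_velocity_le ξ₀ hξ₀)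
  have hD : Tendsto (fun ξ => ε * (N ξ - w₀ * M ξ) / ξ) atBot (𝓝 0) := by
    have := (hN.sub (hM.const_mul w₀)).const_mul ε
    rw [show ε * (-(ρ₀ * w₀) - w₀ * -ρ₀) = 0 by ring] at this
    exact this.congr fun ξ => by ring
  have hD' := tendsto_div_const_sub_atBot (by linarith : (0 : ℝ) ≤ C + 1) hD
  obtain ⟨u, hu⟩ := eventually_atBot.1
    (hD'.eventually (gt_mem_nhds (div_pos h0 (by linarith : 0 < C + 1 - ξ₀))))
  have hsub : Iic ξ₀ ⊆ Iio 0 := fun ξ hξ => lt_of_le_of_lt hξ hξ₀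
  obtain ⟨ξ, hξ, c, hc, he, hle⟩ := exists_touching (D := fun ξ => ε * (N ξ - w₀ * M ξ))
    (g := fun ξ => C + 1 - ξ) (I := Iic ξ₀) (a := min u ξ₀) (b := ξ₀) (ξ₀ := ξ₀)
    (fun x hx => hx.2)
    (((h.momentum.continuousOn.sub (h.mass.continuousOn.const_smul w₀)).const_smul ε).mono hsub)
    (continuous_const.sub continuous_id).continuousOn
    (fun ξ hξ => by linarith [mem_Iio.1 (hsub hξ)])
    ⟨min_le_right _ _, le_rfl⟩ h0
    (fun ξ hξ h => le_of_lt (hu ξ (h.le.trans (min_le_left _ _))))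
    (fun ξ hξ h => absurd h (not_lt.2 hξ))
  obtain ⟨r, w, v, -, -, -, t, -, -, -, -, hv, -⟩ := h.exists_isTrace (hsub hξ)
  have hlin : HasDerivAt (fun ξ : ℝ => c * (C + 1 - ξ)) (-c) ξ :=
    (((hasDerivAt_id' ξ).const_sub (C + 1)).const_mul c).congr_deriv (by ring)
  have k1 := nonneg_of_hasDerivWithinAt_Iio
    (((t.hasDerivWithinAt_momentum.fun_sub (t.hasDerivWithinAt_mass.const_mul w₀)).const_mul
      ε).fun_sub hlin.hasDerivWithinAt) (by
    filter_upwards [self_mem_nhdsWithin] with η hη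
    have := hle η (mem_Iic.2 ((le_of_lt (mem_Iio.1 hη)).trans hξ))
    linarith)
  have hMξ := hM0 ξ (hsub hξ)
  rw [t.mass] at hMξ he
  rw [t.momentum] at he
  have hξ0 : ξ < 0 := hsub hξ
  have hvC := (abs_le.1 hv).2
  have hpos : 0 < c * (C + 1 - ξ) := mul_pos hc (by linarith)
  rcases le_or_gt (v - ξ) 0 with h1 | h1
  · have h2 : r * (v - ξ) = 0 := le_antisymm (mul_nonpos_of_nonneg_of_nonpos t.nonneg h1) hMξ
    have : ε * (r * w * (v - ξ) - w₀ * (r * (v - ξ))) = ε * (w - w₀) * (r * (v - ξ)) := by ring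
    rw [this, h2, mul_zero] at he
    linarith
  · have h3 : ε * (r * w - w₀ * r) ≤ c := by linarith
    nlinarith

/-- The identity `N = w₀ * M` forces the marker to be `w₀` wherever `M > 0`. Equal markers turn the
inequality between velocities into one between densities. -/
lemma isEntropyPotential_of_Iio (h : IsRoadSolution (Iio 0) R W V M N C) {p : ℝ → ℝ}
    (hp : RegularPressure p) (hV : ∀ ξ ∈ Iio 0, V ξ = W ξ - p (R ξ)) {w₀ ρ₀ q : ℝ} (hq : 0 ≤ q)
    (hMq : Tendsto M (𝓝[<] 0) (𝓝 q)) (hM : Tendsto (fun ξ => M ξ / ξ) atBot (𝓝 (-ρ₀)))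
    (hN : Tendsto (fun ξ => N ξ / ξ) atBot (𝓝 (-(ρ₀ * w₀)))) :
    IsEntropyPotential (fun r => r * (w₀ - p r)) (Iio 0) M ∧ ∀ ξ < 0, N ξ = w₀ * M ξ := by
  have hanti := h.antitoneOn_mass
  have hMle : ∀ ξ < 0, q ≤ M ξ := fun ξ hξ => by
    refine le_of_tendsto hMq ?_
    filter_upwards [Ioo_mem_nhdsLT hξ] with η hη using hanti hξ hη.2 hη.1.le
  have hM0 : ∀ ξ < 0, 0 ≤ M ξ := fun ξ hξ => hq.trans (hMle ξ hξ)
  have hNM : ∀ ξ < 0, N ξ = w₀ * M ξ := fun ξ hξ => by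
    have h1 := h.momentum_le_of_Iio (ε := 1) hM0 hM hN hξ
    have h2 := h.momentum_le_of_Iio (ε := -1) hM0 hM hN hξ
    linarith
  refine ⟨⟨h.mass.continuousOn, fun ξ hξ => ?_⟩, hNM⟩
  obtain ⟨rl, wl, vl, rr, wr, vr, tl, tr, hent, -⟩ := h.exists_isTrace hξ
  have el := h.velocity_left hp hV hξ tl
  have er := h.velocity_right hp hV hξ tr
  -- Where the nonincreasing, nonnegative `M` vanishes, it vanishes up to the junction. The right
  -- density is then `0`, and the entropy condition forbids a jump into vacuum, so the left density
  -- is `0` as well.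
  rcases (hM0 ξ hξ).eq_or_lt with h0 | h0
  · have hz : ∀ η ∈ Ioo ξ 0, M η = 0 := fun η hη =>
      le_antisymm (h0 ▸ hanti hξ hη.2 hη.1.le) (hM0 η hη.2)
    have hrr : rr = 0 := by
      have h1 : HasDerivWithinAt M 0 (Ioi ξ) ξ :=
        (hasDerivWithinAt_const ξ (Ioi ξ) (0 : ℝ)).congr_of_eventuallyEq
          (by filter_upwards [Ioo_mem_nhdsGT hξ] with η hη using hz η hη) h0.symm
      linarith [(uniqueDiffWithinAt_Ioi ξ).eq_deriv _ tr.hasDerivWithinAt_mass h1]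
    have hrl : rl = 0 := by
      by_contra hne
      exact (hent (tl.nonneg.lt_of_ne' hne)).1.ne' hrr
    have dl := tl.hasDerivWithinAt_mass
    have dr := tr.hasDerivWithinAt_mass
    rw [hrl] at dl
    rw [hrr] at dr
    exact ⟨0, 0, le_rfl, le_rfl, by simp [← h0], by simp [← h0], dl, dr⟩
  · have hw : ∀ r w v, M ξ = r * (v - ξ) → N ξ = r * w * (v - ξ) → w = w₀ := by
      intro r w v e1 e2
      have e3 := hNM ξ hξ
      have : (w - w₀) * M ξ = 0 := by rw [e1] at e3 ⊢; rw [e2] at e3; linarith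
      rcases mul_eq_zero.1 this with h1 | h1
      · linarith
      · exact absurd h1 h0.ne'
    have hwl := hw _ _ _ tl.mass tl.momentum
    have hwr := hw _ _ _ tr.mass tr.momentum
    refine ⟨rl, rr, tl.nonneg, ?_, ?_, ?_, tl.hasDerivWithinAt_mass, tr.hasDerivWithinAt_mass⟩
    · rcases tl.nonneg.eq_or_lt with h1 | h1
      · exact h1 ▸ tr.nonneg
      · have h2 := (hent h1).2
        rw [el, er, hwl, hwr] at h2
        exact (hp.le_iff tl.nonneg tr.nonneg).1 (by linarith)
    · rw [tl.mass, el, hwl]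
      ring
    · rw [tr.mass, er, hwr]
      ring

/-! #### Outgoing roads behind the first contact -/

/-- With the marker prescribed, the two one-sided markers agree even in vacuum, and no transport
argument is needed. -/
lemma isEntropyPotential_of_marker {I : Set ℝ} (h : IsRoadSolution I R W V M N C) {p : ℝ → ℝ}
    (hp : RegularPressure p) (hV : ∀ ξ ∈ I, V ξ = W ξ - p (R ξ)) {w : ℝ}
    (hW : ∀ ξ ∈ I, W ξ = w) :
    IsEntropyPotential (fun r => r * (w - p r)) I M ∧ ∀ ξ ∈ I, N ξ = w * M ξ := by
  have key : ∀ ξ ∈ I, ∃ rl wl vl rr wr vr, IsTrace R W V M N (Iio ξ) ξ rl wl vl ∧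
      IsTrace R W V M N (Ioi ξ) ξ rr wr vr ∧ (0 < rl → 0 < rr ∧ vr ≤ vl) ∧ wl = w ∧ wr = w := by
    intro ξ hξ
    obtain ⟨rl, wl, vl, rr, wr, vr, tl, tr, hent, -⟩ := h.exists_isTrace hξ
    have hev := h.isOpen.mem_nhds hξ
    have hl : ∀ᶠ η in 𝓝[<] ξ, W η = w := 
      Filter.mem_of_superset (mem_nhdsWithin_of_mem_nhds hev) hW
    have hr : ∀ᶠ η in 𝓝[>] ξ, W η = w := 
      Filter.mem_of_superset (mem_nhdsWithin_of_mem_nhds hev) hW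
    exact ⟨rl, wl, vl, rr, wr, vr, tl, tr, hent,
      tendsto_nhds_unique_of_eventuallyEq tl.tendsto_marker tendsto_const_nhds hl,
      tendsto_nhds_unique_of_eventuallyEq tr.tendsto_marker tendsto_const_nhds hr⟩
  refine ⟨⟨h.mass.continuousOn, fun ξ hξ => ?_⟩, fun ξ hξ => ?_⟩
  · obtain ⟨rl, wl, vl, rr, wr, vr, tl, tr, hent, hwl, hwr⟩ := key ξ hξ
    have el := h.velocity_left hp hV hξ tl
    have er := h.velocity_right hp hV hξ tr
    refine ⟨rl, rr, tl.nonneg, ?_, ?_, ?_, tl.hasDerivWithinAt_mass, tr.hasDerivWithinAt_mass⟩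
    · rcases tl.nonneg.eq_or_lt with h1 | h1
      · exact h1 ▸ tr.nonneg
      · have h2 := (hent h1).2
        rw [el, er, hwl, hwr] at h2
        exact (hp.le_iff tl.nonneg tr.nonneg).1 (by linarith)
    · rw [tl.mass, el, hwl]
      ring
    · rw [tr.mass, er, hwr]
      ring
  · obtain ⟨rl, wl, vl, rr, wr, vr, tl, tr, hent, hwl, hwr⟩ := key ξ hξ
    rw [tl.mass, tl.momentum, hwl]
    ring

/-! #### Outgoing roads beyond the first contact -/

/-- Mirror image of `momentum_le_of_Iio`: where `M < 0` one has `v < ξ`, and the marker is carried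
in from `+∞`. As `M` is nonincreasing, its sign persists on all of `[ξ₀, ∞)`, and right derivatives
suffice there. -/
lemma momentum_le_of_Ioi {b : ℝ} (hb : 0 ≤ b) (h : IsRoadSolution (Ioi b) R W V M N C)
    {w₀ ρ₀ ε : ℝ} (hM : Tendsto (fun ξ => M ξ / ξ) atTop (𝓝 (-ρ₀)))
    (hN : Tendsto (fun ξ => N ξ / ξ) atTop (𝓝 (-(ρ₀ * w₀)))) {ξ₀ : ℝ} (hξ₀ : b < ξ₀)
    (hM0 : M ξ₀ < 0) : ε * (N ξ₀ - w₀ * M ξ₀) ≤ 0 := by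
  by_contra! h0
  have hC : 0 ≤ C := (abs_nonneg _).trans (h.abs_velocity_le ξ₀ hξ₀)
  have hD : Tendsto (fun ξ => ε * (N ξ - w₀ * M ξ) / ξ) atTop (𝓝 0) := by
    have := (hN.sub (hM.const_mul w₀)).const_mul ε
    rw [show ε * (-(ρ₀ * w₀) - w₀ * -ρ₀) = 0 by ring] at this
    exact this.congr fun ξ => by ring
  have hD' := tendsto_div_add_const_atTop (by linarith : (0 : ℝ) ≤ C + 1) hD
  obtain ⟨u, hu⟩ := eventually_atTop.1
    (hD'.eventually (gt_mem_nhds (div_pos h0 (by linarith : 0 < ξ₀ + (C + 1)))))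
  have hsub : Ici ξ₀ ⊆ Ioi b := fun ξ hξ => lt_of_lt_of_le hξ₀ hξ
  obtain ⟨ξ, hξ, c, hc, he, hle⟩ := exists_touching (D := fun ξ => ε * (N ξ - w₀ * M ξ))
    (g := fun ξ => ξ + (C + 1)) (I := Ici ξ₀) (a := ξ₀) (b := max u ξ₀) (ξ₀ := ξ₀)
    (fun x hx => hx.1)
    (((h.momentum.continuousOn.sub (h.mass.continuousOn.const_smul w₀)).const_smul ε).mono hsub)
    (continuous_id.add continuous_const).continuousOn
    (fun ξ hξ => by linarith [mem_Ioi.1 (hsub hξ)])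
    ⟨le_rfl, le_max_right _ _⟩ h0
    (fun ξ hξ h => absurd h (not_lt.2 hξ))
    (fun ξ hξ h => le_of_lt (hu ξ ((le_max_left _ _).trans h.le)))
  obtain ⟨-, -, -, r, w, v, -, t, -, -, -, -, hv⟩ := h.exists_isTrace (hsub hξ)
  have hlin : HasDerivAt (fun ξ : ℝ => c * (ξ + (C + 1))) c ξ :=
    (((hasDerivAt_id' ξ).add_const (C + 1)).const_mul c).congr_deriv (by ring)
  have k1 := nonpos_of_hasDerivWithinAt_Ioi
    (((t.hasDerivWithinAt_momentum.fun_sub (t.hasDerivWithinAt_mass.const_mul w₀)).const_mul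
      ε).fun_sub hlin.hasDerivWithinAt) (by
    filter_upwards [self_mem_nhdsWithin] with η hη
    have := hle η (mem_Ici.2 (le_trans hξ (le_of_lt (mem_Ioi.1 hη))))
    linarith)
  have hMξ : M ξ < 0 := (h.antitoneOn_mass hξ₀ (hsub hξ) hξ).trans_lt hM0
  rw [t.mass] at hMξ he
  rw [t.momentum] at he
  have hvC := (abs_le.1 hv).1
  have h1 : v - ξ < 0 := by
    by_contra! h1
    exact absurd (mul_nonneg t.nonneg h1) (not_le.2 hMξ)
  have h3 : -c ≤ ε * (r * w - w₀ * r) := by linarith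
  nlinarith

end IsRoadSolution

/-- Slopes of a concave function decrease, so the secant over `[K, K + 1]` bounds from below all
secants over `[0, K]`, without differentiability of `f`. -/
lemma concaveOn_sub_le_mul_sub {f : ℝ → ℝ} (hf : ConcaveOn ℝ (Ici 0) f) {a b K : ℝ} (ha : 0 ≤ a)
    (hab : a < b) (hbK : b ≤ K) : f a - f b ≤ (b - a) * (f K - f (K + 1)) := by
  have hb : 0 ≤ b := ha.trans hab.le
  have h1 := hf.slope_anti_adjacent (x := a) (y := b) (z := K + 1) ha
    (mem_Ici.2 (by linarith)) hab (by linarith)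
  have h2 : f (K + 1) - f K ≤ (f (K + 1) - f b) / (K + 1 - b) := by
    rcases hbK.eq_or_lt with rfl | hbK
    · simp
    have h3 := hf.slope_anti_adjacent (x := b) (y := K) (z := K + 1) hb
      (mem_Ici.2 (by linarith)) hbK (by linarith)
    rw [show K + 1 - K = 1 by ring, div_one, le_div_iff₀ (by linarith)] at h3
    rw [le_div_iff₀ (by linarith)]
    linarith
  have h4 := h2.trans h1
  rw [le_div_iff₀ (by linarith)] at h4
  linarith

namespace IsRoadSolution

variable {R W V M N : ℝ → ℝ} {C : ℝ}

/-- The potential is compared from both sides with `ρ₀ * (b - ξ)`, that of the constant initial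
state. At a contact with a multiple of `ξ + L` the density lies on one side or the other of `ρ₀`. On
one side monotonicity of `p` contradicts the contact; on the other the secant bound with slope `-L`
does. -/
lemma mass_eq_of_neg {b : ℝ} (hb : 0 ≤ b) (h : IsRoadSolution (Ioi b) R W V M N C) {p : ℝ → ℝ}
    (hp : RegularPressure p) (hV : ∀ ξ ∈ Ioi b, V ξ = W ξ - p (R ξ)) {w₀ ρ₀ : ℝ} (hρ₀ : 0 < ρ₀)
    (hv : w₀ - p ρ₀ = b) (hM : Tendsto (fun ξ => M ξ / ξ) atTop (𝓝 (-ρ₀)))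
    (hNM : ∀ ξ, b < ξ → M ξ < 0 → N ξ = w₀ * M ξ) {ξ₀ : ℝ} (hξ₀ : b < ξ₀) (hM0 : M ξ₀ < 0) :
    M ξ₀ = ρ₀ * (b - ξ₀) := by
  set f : ℝ → ℝ := fun r => r * (w₀ - p r) with hf
  -- `K` dominates every density that can occur, and `L` strictly exceeds the steepest descent of
  -- the flux on `[0, K]`.
  set K := max C ρ₀ with hK
  set L := |f K - f (K + 1)| + 1 with hL
  have hL1 : f K - f (K + 1) < L := by linarith [le_abs_self (f K - f (K + 1))]
  have hL0 : 0 < L := by positivity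
  have hconc : ConcaveOn ℝ (Ici 0) f := hp.concaveOn w₀
  have hsub : Ici ξ₀ ⊆ Ioi b := fun ξ hξ => lt_of_lt_of_le hξ₀ hξ
  have hfρ : f ρ₀ = ρ₀ * b := by rw [hf, ← hv]
  have touch : ∀ ε, 0 < ε * (M ξ₀ - ρ₀ * (b - ξ₀)) → ∃ ξ c r, b < ξ ∧ 0 < c ∧ 0 ≤ r ∧ r ≤ K ∧
      r * (w₀ - p r - ξ) < 0 ∧ ε * (r * (w₀ - p r - ξ) - ρ₀ * (b - ξ)) = c * (ξ + L) ∧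
      ε * (ρ₀ - r) ≤ c := by
    intro ε h0
    have hD : Tendsto (fun ξ => ε * (M ξ - ρ₀ * (b - ξ)) / ξ) atTop (𝓝 0) := by
      have h1 : Tendsto (fun ξ : ℝ => ρ₀ * (b * ξ⁻¹ - 1)) atTop (𝓝 (ρ₀ * (b * 0 - 1))) :=
        ((tendsto_inv_atTop_zero.const_mul b).sub_const 1).const_mul ρ₀
      have h2 := (hM.sub h1).const_mul ε
      rw [show ε * (-ρ₀ - ρ₀ * (b * 0 - 1)) = 0 by ring] at h2
      refine h2.congr' ?_
      filter_upwards [eventually_gt_atTop 0] with ξ hξ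
      field_simp
    have hD' := tendsto_div_add_const_atTop hL0.le hD
    obtain ⟨u, hu⟩ := eventually_atTop.1
      (hD'.eventually (gt_mem_nhds (div_pos h0 (by linarith : 0 < ξ₀ + L))))
    obtain ⟨ξ, hξ, c, hc, he, hle⟩ := exists_touching (D := fun ξ => ε * (M ξ - ρ₀ * (b - ξ)))
      (g := fun ξ => ξ + L) (I := Ici ξ₀) (a := ξ₀) (b := max u ξ₀) (ξ₀ := ξ₀)
      (fun x hx => hx.1)
      (((h.mass.continuousOn.mono hsub).sub
        (continuous_const.mul (continuous_const.sub continuous_id)).continuousOn).const_smul ε)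
      (continuous_id.add continuous_const).continuousOn
      (fun ξ hξ => by linarith [mem_Ioi.1 (hsub hξ)])
      ⟨le_rfl, le_max_right _ _⟩ h0
      (fun ξ hξ h => absurd h (not_lt.2 hξ))
      (fun ξ hξ h => le_of_lt (hu ξ ((le_max_left _ _).trans h.le)))
    have hξb : b < ξ := hsub hξ
    obtain ⟨-, -, -, r, w, v, -, t, -, -, hrC, -, -⟩ := h.exists_isTrace hξb
    have hMξ : M ξ < 0 := (h.antitoneOn_mass hξ₀ hξb hξ).trans_lt hM0
    have hw : w = w₀ := by
      have e := hNM ξ hξb hMξ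
      rw [t.momentum] at e
      have : (w - w₀) * M ξ = 0 := by rw [t.mass] at e ⊢; linarith
      rcases mul_eq_zero.1 this with h1 | h1
      · linarith
      · exact absurd h1 hMξ.ne
    have hvv := h.velocity_right hp hV hξb t
    rw [hw] at hvv
    have hlin : HasDerivAt (fun ξ : ℝ => c * (ξ + L)) c ξ :=
      (((hasDerivAt_id' ξ).add_const L).const_mul c).congr_deriv (by ring)
    have hlin' : HasDerivAt (fun ξ : ℝ => ρ₀ * (b - ξ)) (-ρ₀) ξ :=
      (((hasDerivAt_id' ξ).const_sub b).const_mul ρ₀).congr_deriv (by ring)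
    have k1 := nonpos_of_hasDerivWithinAt_Ioi
      (((t.hasDerivWithinAt_mass.fun_sub hlin'.hasDerivWithinAt).const_mul ε).fun_sub
        hlin.hasDerivWithinAt) (by
      filter_upwards [self_mem_nhdsWithin] with η hη
      have := hle η (mem_Ici.2 (le_trans hξ (le_of_lt (mem_Ioi.1 hη))))
      linarith)
    rw [t.mass, hvv] at he hMξ
    exact ⟨ξ, c, r, hξb, hc, t.nonneg, hrC.trans (le_max_left _ _), hMξ, he, by linarith⟩
  refine le_antisymm ?_ ?_
  · by_contra! hlt
    obtain ⟨ξ, c, r, hξ, hc, hr, hrK, hneg, he, hd⟩ := touch 1 (by linarith)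
    have hpos : 0 < c * (ξ + L) := mul_pos hc (by linarith)
    rcases le_or_gt ρ₀ r with hle | hgt
    · have h1 : p ρ₀ ≤ p r := (hp.le_iff hρ₀.le hr).2 hle
      nlinarith
    · have h1 := concaveOn_sub_le_mul_sub hconc hr hgt (le_max_right C ρ₀)
      have h2 : (ρ₀ - r) * (f K - f (K + 1)) < (ρ₀ - r) * L :=
        mul_lt_mul_of_pos_left hL1 (by linarith)
      have h3 : (ρ₀ - r) * (ξ + L) ≤ c * (ξ + L) :=
        mul_le_mul_of_nonneg_right (by linarith) (by linarith)
      rw [hfρ] at h1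
      simp only [hf] at h1 h2
      nlinarith
  · by_contra! hlt
    obtain ⟨ξ, c, r, hξ, hc, hr, hrK, hneg, he, hd⟩ := touch (-1) (by linarith)
    have hpos : 0 < c * (ξ + L) := mul_pos hc (by linarith)
    rcases le_or_gt r ρ₀ with hle | hgt
    · have h1 : p r ≤ p ρ₀ := (hp.le_iff hr hρ₀.le).2 hle
      have h2 : w₀ - p r - ξ < 0 := by
        by_contra! h2
        exact absurd (mul_nonneg hr h2) (not_le.2 hneg)
      nlinarith
    · have h1 := concaveOn_sub_le_mul_sub hconc hρ₀.le hgt hrK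
      have h2 : (r - ρ₀) * (f K - f (K + 1)) < (r - ρ₀) * L :=
        mul_lt_mul_of_pos_left hL1 (by linarith)
      have h3 : (r - ρ₀) * (ξ + L) ≤ c * (ξ + L) :=
        mul_le_mul_of_nonneg_right (by linarith) (by linarith)
      rw [hfρ] at h1
      simp only [hf] at h1 h2
      nlinarith

/-- Beyond the first contact the solution is the initial state. -/
lemma eq_initial_of_Ioi {b : ℝ} (hb : 0 ≤ b) (h : IsRoadSolution (Ioi b) R W V M N C) {p : ℝ → ℝ}
    (hp : RegularPressure p) (hV : ∀ ξ ∈ Ioi b, V ξ = W ξ - p (R ξ)) {w₀ ρ₀ : ℝ} (hρ₀ : 0 < ρ₀)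
    (hv : w₀ - p ρ₀ = b) (hM : Tendsto (fun ξ => M ξ / ξ) atTop (𝓝 (-ρ₀)))
    (hN : Tendsto (fun ξ => N ξ / ξ) atTop (𝓝 (-(ρ₀ * w₀)))) :
    ∀ ξ, b < ξ → M ξ = ρ₀ * (b - ξ) ∧ N ξ = w₀ * M ξ := by
  have hNM : ∀ ξ, b < ξ → M ξ < 0 → N ξ = w₀ * M ξ := fun ξ hξ h0 => by
    have h1 := h.momentum_le_of_Ioi hb (ε := 1) hM hN hξ h0
    have h2 := h.momentum_le_of_Ioi hb (ε := -1) hM hN hξ h0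
    linarith
  have hMS : ∀ ξ, b < ξ → M ξ < 0 → M ξ = ρ₀ * (b - ξ) := fun ξ hξ h0 =>
    h.mass_eq_of_neg hb hp hV hρ₀ hv hM hNM hξ h0
  -- `M` is negative far out. If it were nonnegative at `ξ`, it would take the value `ρ₀ * (b - ξ) /
  -- 2` at some `x ≥ ξ`. But negativity there forces `M x = ρ₀ * (b - x)`, which is smaller.
  have hneg : ∀ ξ, b < ξ → M ξ < 0 := by
    intro ξ hξ
    by_contra! h0
    obtain ⟨η, hη, hηξ⟩ : ∃ η, M η / η < 0 ∧ ξ < η :=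
      ((hM.eventually (gt_mem_nhds (neg_neg_iff_pos.2 hρ₀))).and (eventually_gt_atTop ξ)).exists
    have hη0 : M η < 0 := by
      by_contra! h1
      exact absurd (div_nonneg h1 (by linarith)) (not_le.2 hη)
    have e := hMS η (hξ.trans hηξ) hη0
    have hsub : Icc ξ η ⊆ Ioi b := fun x hx => hξ.trans_le hx.1
    have hlt : ρ₀ * (b - ξ) < 0 := mul_neg_of_pos_of_neg hρ₀ (by linarith)
    obtain ⟨x, hx, hxe⟩ := intermediate_value_Icc' hηξ.le (h.mass.continuousOn.mono hsub)
      (show ρ₀ * (b - ξ) / 2 ∈ Icc (M η) (M ξ) from ⟨by nlinarith, by linarith⟩)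
    have e2 := hMS x (hsub hx) (by linarith)
    nlinarith [hx.1]
  exact fun ξ hξ => ⟨hMS ξ hξ (hneg ξ hξ), hNM ξ hξ (hneg ξ hξ)⟩

end IsRoadSolution

end TrafficNetwork

namespace TrafficNetwork

variable {n m : ℕ}

/-! ### Potentials of a network solution -/

/-- A test function vanishing at the junction extends by zero to the other roads. -/
lemma IsWeakSolution.single {u f : Fin n ⊕ Fin m → ℝ → ℝ → ℝ} {u₀ : Fin n ⊕ Fin m → ℝ}
    (h : IsWeakSolution u f u₀) (r : Fin n ⊕ Fin m) {ψ : ℝ → ℝ → ℝ}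
    (hψ : ContDiff ℝ ∞ (Function.uncurry ψ)) (hc : HasCompactSupport (Function.uncurry ψ))
    (h0 : ∀ t, ψ 0 t = 0) :
    (∫ t in Ioi (0 : ℝ), ∫ x in road r,
        (u r x t * deriv (fun s => ψ x s) t + f r x t * deriv (fun y => ψ y t) x)) +
      ∫ x in road r, u₀ r * ψ x 0 = 0 := by
  classical
  set φ : Fin n ⊕ Fin m → ℝ → ℝ → ℝ := Function.update (fun _ _ _ => 0) r ψ with hφ
  have hr : φ r = ψ := Function.update_self ..
  have hne : ∀ s, s ≠ r → φ s = fun _ _ => 0 := fun s hs => Function.update_of_ne hs ..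
  have hz : ∀ s t, φ s 0 t = 0 := by
    intro s t
    by_cases hs : s = r
    · rw [hs, hr, h0]
    · rw [hne s hs]
  have := h φ ⟨fun s => ?_, fun i j t _ => by rw [hz, hz]⟩
  · rw [Finset.sum_eq_single r (fun s _ hs => by simp [hne s hs]) (by simp), hr] at this
    exact this
  · by_cases hs : s = r
    · rw [hs, hr]
      exact ⟨hψ, hc⟩
    · rw [hne s hs]
      exact ⟨contDiff_const, HasCompactSupport.zero⟩

lemma IsWeakSolution.exists_isPotential_outgoing {u f : Fin n ⊕ Fin m → ℝ → ℝ → ℝ}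
    {u₀ : Fin n ⊕ Fin m → ℝ} (h : IsWeakSolution u f u₀) (j : Fin m) {R F : ℝ → ℝ} {C : ℝ}
    (hR : Measurable R) (hF : Measurable F) (hRC : ∀ ξ, |R ξ| ≤ C) (hFC : ∀ ξ, |F ξ| ≤ C)
    (hu : ∀ x t, 0 < x → 0 < t → u (Sum.inr j) x t = R (x / t))
    (hf : ∀ x t, 0 < x → 0 < t → f (Sum.inr j) x t = F (x / t)) :
    ∃ M, IsPotential (Ioi 0) R F M ∧
      Tendsto (fun ξ => M ξ / ξ) atTop (𝓝 (-u₀ (Sum.inr j))) := by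
  refine IsHalfLineWeakSolution.exists_isPotential hR hF hRC hFC fun φ hφ hc h0 => ?_
  refine Eq.trans ?_ (h.single (Sum.inr j) hφ hc h0)
  congr 1
  refine setIntegral_congr_fun measurableSet_Ioi fun t ht => ?_
  refine setIntegral_congr_fun measurableSet_Ioi fun x hx => ?_
  simp only [hu x t hx ht, hf x t hx ht]

lemma IsWeakSolution.exists_isPotential_incoming {u f : Fin n ⊕ Fin m → ℝ → ℝ → ℝ}
    {u₀ : Fin n ⊕ Fin m → ℝ} (h : IsWeakSolution u f u₀) (i : Fin n) {R F : ℝ → ℝ} {C : ℝ}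
    (hR : Measurable R) (hF : Measurable F) (hRC : ∀ ξ, |R ξ| ≤ C) (hFC : ∀ ξ, |F ξ| ≤ C)
    (hu : ∀ x t, x < 0 → 0 < t → u (Sum.inl i) x t = R (x / t))
    (hf : ∀ x t, x < 0 → 0 < t → f (Sum.inl i) x t = F (x / t)) :
    ∃ M, IsPotential (Iio 0) R F M ∧
      Tendsto (fun ξ => M ξ / ξ) atBot (𝓝 (-u₀ (Sum.inl i))) := by
  have hw : IsHalfLineWeakSolution (fun ξ => R (-ξ)) (fun ξ => -F (-ξ)) (u₀ (Sum.inl i)) := by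
    intro φ hφ hc h0
    have hφ' : ContDiff ℝ ∞ (Function.uncurry fun x t => φ (-x) t) :=
      hφ.comp (contDiff_fst.neg.prodMk contDiff_snd)
    have hc' : HasCompactSupport (Function.uncurry fun x t => φ (-x) t) :=
      hc.comp_homeomorph ((Homeomorph.neg ℝ).prodCongr (Homeomorph.refl ℝ))
    have e := h.single (Sum.inl i) hφ' hc' (by simpa using h0)
    simp only [road, integral_Iio_zero_eq, neg_neg] at e
    refine Eq.trans ?_ e
    congr 1
    refine setIntegral_congr_fun measurableSet_Ioi fun t ht => ?_
    refine setIntegral_congr_fun measurableSet_Ioi fun x hx => ?_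
    have hx' : -x < 0 := neg_neg_iff_pos.2 hx
    have hd : deriv (fun y => φ (-y) t) (-x) = -deriv (fun y => φ y t) x := by
      rw [deriv_comp_neg (fun y => φ y t), neg_neg]
    simp only [hu _ t hx' ht, hf _ t hx' ht, hd, neg_div]
    ring
  obtain ⟨M, hM, hlim⟩ := hw.exists_isPotential (hR.comp measurable_neg) (hF.comp measurable_neg).neg
    (fun ξ => hRC _) (fun ξ => (abs_neg (F (-ξ))).trans_le (hFC _))
  refine ⟨_, hM.reflect, (hlim.comp tendsto_neg_atBot_atTop).congr fun ξ => ?_⟩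
  simp only [Function.comp_apply, div_neg, neg_div]

/-- The direction in which the road `r` extends to infinity. -/
def infinity : Fin n ⊕ Fin m → Filter ℝ
  | Sum.inl _ => atBot
  | Sum.inr _ => atTop

lemma IsWeakSolution.exists_isPotential {u f : Fin n ⊕ Fin m → ℝ → ℝ → ℝ}
    {u₀ : Fin n ⊕ Fin m → ℝ} (h : IsWeakSolution u f u₀) (r : Fin n ⊕ Fin m) {R F : ℝ → ℝ} {C : ℝ}
    (hR : Measurable R) (hF : Measurable F) (hRC : ∀ ξ ∈ (road r : Set ℝ), |R ξ| ≤ C)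
    (hFC : ∀ ξ ∈ (road r : Set ℝ), |F ξ| ≤ C)
    (hu : ∀ x ∈ (road r : Set ℝ), ∀ t, 0 < t → u r x t = R (x / t))
    (hf : ∀ x ∈ (road r : Set ℝ), ∀ t, 0 < t → f r x t = F (x / t)) :
    ∃ M, IsPotential (road r) R F M ∧ Tendsto (fun ξ => M ξ / ξ) (infinity r) (𝓝 (-u₀ r)) := by
  have hm : MeasurableSet (road r) := (isOpen_road r).measurableSet
  have bound : ∀ G : ℝ → ℝ, (∀ ξ ∈ (road r : Set ℝ), |G ξ| ≤ C) →
      -- The bounds hold on the road only, so the profiles are cut off outside it. The road is open,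
      -- so one-sided limits at its points do not change.
      ∀ ξ, |(road r).indicator G ξ| ≤ max C 0 := by
    intro G hG ξ
    by_cases hξ : ξ ∈ (road r : Set ℝ)
    · rw [indicator_of_mem hξ]
      exact (hG ξ hξ).trans (le_max_left _ _)
    · rw [indicator_of_notMem hξ, abs_zero]
      exact le_max_right _ _
  have main : ∃ M, IsPotential (road r) ((road r).indicator R) ((road r).indicator F) M ∧
      Tendsto (fun ξ => M ξ / ξ) (infinity r) (𝓝 (-u₀ r)) := by
    cases r with
    | inl i =>
      refine h.exists_isPotential_incoming i (hR.indicator hm) (hF.indicator hm) (bound R hRC)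
        (bound F hFC) (fun x t hx ht => ?_) (fun x t hx ht => ?_)
      · rw [hu x hx t ht, indicator_of_mem (div_mem_road ht hx)]
      · rw [hf x hx t ht, indicator_of_mem (div_mem_road ht hx)]
    | inr j =>
      refine h.exists_isPotential_outgoing j (hR.indicator hm) (hF.indicator hm) (bound R hRC)
        (bound F hFC) (fun x t hx ht => ?_) (fun x t hx ht => ?_)
      · rw [hu x hx t ht, indicator_of_mem (div_mem_road ht hx)]
      · rw [hf x hx t ht, indicator_of_mem (div_mem_road ht hx)]
  obtain ⟨M, hM, hlim⟩ := main
  have hev : ∀ (G : ℝ → ℝ) (s : Set ℝ), ∀ ξ ∈ (road r : Set ℝ),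
      G =ᶠ[𝓝[s] ξ] (road r).indicator G := by
    intro G s ξ hξ
    filter_upwards [mem_nhdsWithin_of_mem_nhds ((isOpen_road r).mem_nhds hξ)] with η hη
    exact (indicator_of_mem hη G).symm
  exact ⟨M, ⟨hM.continuousOn,
    fun ξ hξ a b ha hb => hM.left ξ hξ a b (ha.congr' (hev R _ ξ hξ)) (hb.congr' (hev F _ ξ hξ)),
    fun ξ hξ a b ha hb => hM.right ξ hξ a b (ha.congr' (hev R _ ξ hξ)) (hb.congr' (hev F _ ξ hξ))⟩,
    hlim⟩

lemma RegularPressure.continuous_comp_max {p : ℝ → ℝ} (hp : RegularPressure p) :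
    Continuous fun r => p (max r 0) :=
  hp.continuousOn.comp_continuous (continuous_id.max continuous_const) fun _ => mem_Ici.2 (le_max_right _ _)

lemma RegularPressure.abs_comp_max_le {p : ℝ → ℝ} (hp : RegularPressure p) {r C : ℝ}
    (hr : |r| ≤ C) : |p (max r 0)| ≤ p C := by
  have hC : 0 ≤ C := (abs_nonneg r).trans hr
  rw [abs_of_nonneg (hp.nonneg (le_max_right _ _))]
  exact (hp.le_iff (le_max_right _ _) hC).2 (max_le ((le_abs_self r).trans hr) hC)

namespace Junction

variable {J : Junction n m}

/-- The velocity profile of a network solution is bounded and measurable along a road. -/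
lemma IsNetworkSolution.exists_velocity {S : NetworkState n m} (h : J.IsNetworkSolution S)
    (r : Fin n ⊕ Fin m) : ∃ (V : ℝ → ℝ) (C : ℝ), Measurable V ∧
      ∀ ξ ∈ (road r : Set ℝ), V ξ = J.velocity S r ξ 1 ∧ |V ξ| ≤ C ∧ |S.ρ r ξ 1| ≤ C ∧
        |S.w r ξ 1| ≤ C := by
  obtain ⟨K, hK⟩ := h.bounded
  have hmρ : Measurable fun ξ => S.ρ r ξ 1 :=
    (h.measurable_ρ r).comp (measurable_id.prodMk measurable_const)
  have hmw : Measurable fun ξ => S.w r ξ 1 :=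
    (h.measurable_w r).comp (measurable_id.prodMk measurable_const)
  -- Pressures are controlled on `[0, ∞)` only. Composing with `max · 0` gives globally measurable
  -- profiles that are unchanged on the road.
  have hmax : ∀ ξ ∈ (road r : Set ℝ), max (S.ρ r ξ 1) 0 = S.ρ r ξ 1 := fun ξ hξ =>
    max_eq_left (h.ρ_nonneg r ξ hξ 1 one_pos)
  have key : ∃ (Q : ℝ → ℝ) (B : ℝ), Measurable Q ∧ ∀ ξ ∈ (road r : Set ℝ),
      Q ξ = J.pressureAt S.P r ξ 1 (S.ρ r ξ 1) ∧ |Q ξ| ≤ B := by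
    cases r with
    | inl i =>
      have hp := (J.pin_law i).regular
      refine ⟨fun ξ => J.pin i (max (S.ρ (Sum.inl i) ξ 1) 0), J.pin i K,
        hp.continuous_comp_max.measurable.comp hmρ, fun ξ hξ => ⟨?_, ?_⟩⟩
      · simp only [hmax ξ hξ, pressureAt]
      · exact hp.abs_comp_max_le (hK _ ξ hξ 1 one_pos).1
    | inr j =>
      have hp := J.regular_pout j
      have hP := (h.pressure j).regular
      refine ⟨fun ξ => if ξ < 1 * J.v₀ j then S.P j (max (S.ρ (Sum.inr j) ξ 1) 0) else
        J.pout j (max (S.ρ (Sum.inr j) ξ 1) 0), max (S.P j K) (J.pout j K),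
        Measurable.ite measurableSet_Iio (hP.continuous_comp_max.measurable.comp hmρ)
          (hp.continuous_comp_max.measurable.comp hmρ), fun ξ hξ => ⟨?_, ?_⟩⟩
      · simp only [hmax ξ hξ, pressureAt]
        split_ifs <;> rfl
      · dsimp only
        split_ifs
        · exact (hP.abs_comp_max_le (hK _ ξ hξ 1 one_pos).1).trans (le_max_left _ _)
        · exact (hp.abs_comp_max_le (hK _ ξ hξ 1 one_pos).1).trans (le_max_right _ _)
  obtain ⟨Q, B, hQm, hQ⟩ := key
  refine ⟨fun ξ => S.w r ξ 1 - Q ξ, K + |B|, hmw.sub hQm, fun ξ hξ => ⟨?_, ?_, ?_, ?_⟩⟩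
  · simp only [(hQ ξ hξ).1, velocity]
  · exact (abs_sub _ _).trans (add_le_add (hK _ ξ hξ 1 one_pos).2
      ((hQ ξ hξ).2.trans (le_abs_self B)))
  · exact (hK _ ξ hξ 1 one_pos).1.trans (le_add_of_nonneg_right (abs_nonneg B))
  · exact (hK _ ξ hξ 1 one_pos).2.trans (le_add_of_nonneg_right (abs_nonneg B))

/-- Along every road the profile of a network solution has potentials that encode the initial
state. -/
lemma IsNetworkSolution.exists_isRoadSolution {S : NetworkState n m} (h : J.IsNetworkSolution S)
    (r : Fin n ⊕ Fin m) : ∃ (M N : ℝ → ℝ) (C : ℝ),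
      IsRoadSolution (road r) (fun ξ => S.ρ r ξ 1) (fun ξ => S.w r ξ 1)
        (fun ξ => J.velocity S r ξ 1) M N C ∧
      Tendsto (fun ξ => M ξ / ξ) (infinity r) (𝓝 (-J.ρ₀ r)) ∧
      Tendsto (fun ξ => N ξ / ξ) (infinity r) (𝓝 (-(J.ρ₀ r * J.w₀ r))) := by
  obtain ⟨V, C, hVm, hV⟩ := h.exists_velocity r
  have hmρ : Measurable fun ξ => S.ρ r ξ 1 :=
    (h.measurable_ρ r).comp (measurable_id.prodMk measurable_const)
  have hmw : Measurable fun ξ => S.w r ξ 1 :=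
    (h.measurable_w r).comp (measurable_id.prodMk measurable_const)
  have self : ∀ x ∈ (road r : Set ℝ), ∀ t, 0 < t → S.ρ r x t = S.ρ r (x / t) 1 ∧
      S.w r x t = S.w r (x / t) 1 ∧ J.velocity S r x t = V (x / t) := fun x hx t ht => by
    have h1 := h.self_similar r x hx t ht
    exact ⟨h1.1, h1.2, by
      rw [J.velocity_div S r ht h1.1 h1.2, (hV _ (div_mem_road ht hx)).1]⟩
  have hev : ∀ s : Set ℝ, ∀ ξ ∈ (road r : Set ℝ),
      (fun η => J.velocity S r η 1) =ᶠ[𝓝[s] ξ] V := by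
    intro s ξ hξ
    filter_upwards [mem_nhdsWithin_of_mem_nhds ((isOpen_road r).mem_nhds hξ)] with η hη
    exact (hV η hη).1.symm
  have b1 : ∀ ξ ∈ (road r : Set ℝ), |S.ρ r ξ 1| ≤ max C (max (C * C) (C * C * C)) ∧
      |S.ρ r ξ 1 * V ξ| ≤ max C (max (C * C) (C * C * C)) ∧
      |S.ρ r ξ 1 * S.w r ξ 1| ≤ max C (max (C * C) (C * C * C)) ∧
      |S.ρ r ξ 1 * V ξ * S.w r ξ 1| ≤ max C (max (C * C) (C * C * C)) := by
    intro ξ hξ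
    obtain ⟨-, h1, h2, h3⟩ := hV ξ hξ
    have hC : 0 ≤ C := (abs_nonneg _).trans h1
    refine ⟨h2.trans (le_max_left _ _), ?_, ?_, ?_⟩
    · rw [abs_mul]
      exact (mul_le_mul h2 h1 (abs_nonneg _) hC).trans
        ((le_max_left _ _).trans (le_max_right _ _))
    · rw [abs_mul]
      exact (mul_le_mul h2 h3 (abs_nonneg _) hC).trans
        ((le_max_left _ _).trans (le_max_right _ _))
    · rw [abs_mul, abs_mul]
      exact (mul_le_mul (mul_le_mul h2 h1 (abs_nonneg _) hC) h3 (abs_nonneg _)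
        (mul_nonneg hC hC)).trans ((le_max_right _ _).trans (le_max_right _ _))
  obtain ⟨M, hM, hMlim⟩ := h.mass.exists_isPotential r hmρ (hmρ.mul hVm)
    (fun ξ hξ => (b1 ξ hξ).1) (fun ξ hξ => (b1 ξ hξ).2.1)
    (fun x hx t ht => (self x hx t ht).1)
    (fun x hx t ht => by
      obtain ⟨e1, e2, e3⟩ := self x hx t ht
      simp only [e1, e3, Pi.mul_apply])
  obtain ⟨N, hN, hNlim⟩ := h.momentum.exists_isPotential r (hmρ.mul hmw) ((hmρ.mul hVm).mul hmw)
    (fun ξ hξ => (b1 ξ hξ).2.2.1) (fun ξ hξ => (b1 ξ hξ).2.2.2)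
    (fun x hx t ht => by
      obtain ⟨e1, e2, e3⟩ := self x hx t ht
      simp only [e1, e2, Pi.mul_apply])
    (fun x hx t ht => by
      obtain ⟨e1, e2, e3⟩ := self x hx t ht
      simp only [e1, e2, e3, Pi.mul_apply])
  refine ⟨M, N, C, ⟨isOpen_road r, fun ξ hξ => h.ρ_nonneg r ξ hξ 1 one_pos,
    fun ξ hξ => (hV ξ hξ).2.2.1, fun ξ hξ => (hV ξ hξ).1 ▸ (hV ξ hξ).2.1, ?_, ?_,
    h.entropy r 1 one_pos⟩, hMlim, hNlim⟩
  · have e : ∀ s : Set ℝ, ∀ ξ ∈ (road r : Set ℝ), (fun η => S.ρ r η 1 * J.velocity S r η 1)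
        =ᶠ[𝓝[s] ξ] fun η => S.ρ r η 1 * V η := fun s ξ hξ =>
      (EventuallyEq.rfl).mul (hev s ξ hξ)
    exact ⟨hM.continuousOn,
      fun ξ hξ a b ha hb => hM.left ξ hξ a b ha (hb.congr' (e _ ξ hξ)),
      fun ξ hξ a b ha hb => hM.right ξ hξ a b ha (hb.congr' (e _ ξ hξ))⟩
  · have e : ∀ s : Set ℝ, ∀ ξ ∈ (road r : Set ℝ),
        (fun η => S.ρ r η 1 * J.velocity S r η 1 * S.w r η 1)
          =ᶠ[𝓝[s] ξ] fun η => S.ρ r η 1 * V η * S.w r η 1 := fun s ξ hξ =>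
      ((EventuallyEq.rfl).mul (hev s ξ hξ)).mul EventuallyEq.rfl
    exact ⟨hN.continuousOn,
      fun ξ hξ a b ha hb => hN.left ξ hξ a b ha (hb.congr' (e _ ξ hξ)),
      fun ξ hξ a b ha hb => hN.right ξ hξ a b ha (hb.congr' (e _ ξ hξ))⟩

end Junction

end TrafficNetwork

namespace TrafficNetwork

namespace Junction

variable {n m : ℕ} {J : Junction n m}

/-! ### Uniqueness of the network solution -/

lemma IsNetworkSolution.pressure_eq {S S' : NetworkState n m} (h : J.IsNetworkSolution S)
    (h' : J.IsNetworkSolution S') (j : Fin m) {r : ℝ} (hr : 0 ≤ r) : S.P j r = S'.P j r := by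
  rw [(J.isApproxPressure_iff j _).1 (h.pressure j) r hr,
    (J.isApproxPressure_iff j _).1 (h'.pressure j) r hr]

/-- Two network solutions have the same fluxes through the junction. -/
lemma IsNetworkSolution.exists_flux {S S' : NetworkState n m} (h : J.IsNetworkSolution S)
    (h' : J.IsNetworkSolution S') : ∃ q : Fin m → Fin n → ℝ, (∀ i, 0 ≤ qin q i) ∧
      ∀ T ∈ ({S, S'} : Set (NetworkState n m)),
        (∀ i, Tendsto (fun ξ => T.ρ (Sum.inl i) ξ 1 * J.velocity T (Sum.inl i) ξ 1)
          (𝓝[<] 0) (𝓝 (qin q i))) ∧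
        ∀ j, Tendsto (fun ξ => T.ρ (Sum.inr j) ξ 1 * J.velocity T (Sum.inr j) ξ 1)
          (𝓝[>] 0) (𝓝 (qout q j)) := by
  obtain ⟨q, hq, hmax, hi, ho⟩ := h.flux
  obtain ⟨q', hq', hmax', hi', ho'⟩ := h'.flux
  have hP : ∀ j, RegularPressure (S.P j) := fun j => (h.pressure j).regular
  have hP' : ∀ j, RegularPressure (S'.P j) := fun j => (h'.pressure j).regular
  -- The pressures agree on `[0, ∞)`, so both solutions have the same admissible fluxes, and the
  -- maximizer is unique.
  have e : q = q' := hq.unique (hq'.congr hP' fun j r hr => h'.pressure_eq h j hr) hmax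
    fun r hr => hmax' r (hr.congr hP fun j r hr => h.pressure_eq h' j hr)
  subst e
  refine ⟨q, fun i => (hq.demand_bound i).1, ?_⟩
  rintro T (rfl | rfl)
  · exact ⟨fun i => hi i 1 one_pos, fun j => ho j 1 one_pos⟩
  · exact ⟨fun i => hi' i 1 one_pos, fun j => ho' j 1 one_pos⟩

/-- The mass potentials agree at the junction, where both equal the flux, and to leading order at
`-∞`, where both encode `ρ₀`. Comparison in both directions makes them equal, and `N = w₀ * M`
settles momentum. -/
lemma IsNetworkSolution.countable_ne_incoming {S S' : NetworkState n m}
    (h : J.IsNetworkSolution S) (h' : J.IsNetworkSolution S') (i : Fin n) :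
    {ξ ∈ (road (Sum.inl i : Fin n ⊕ Fin m) : Set ℝ) |
      ¬ (S.ρ (Sum.inl i) ξ 1 = S'.ρ (Sum.inl i) ξ 1 ∧
        S.ρ (Sum.inl i) ξ 1 * S.w (Sum.inl i) ξ 1 =
          S'.ρ (Sum.inl i) ξ 1 * S'.w (Sum.inl i) ξ 1)}.Countable := by
  obtain ⟨q, hq, hT⟩ := h.exists_flux h'
  obtain ⟨M, N, C, hS, hM, hN⟩ := h.exists_isRoadSolution (Sum.inl i)
  obtain ⟨M', N', C', hS', hM', hN'⟩ := h'.exists_isRoadSolution (Sum.inl i)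
  have hp := (J.pin_law i).regular
  have t : Tendsto M (𝓝[<] 0) _ := hS.tendsto_mass self_mem_nhdsWithin ((hT S (Or.inl rfl)).1 i)
  have t' : Tendsto M' (𝓝[<] 0) _ :=
    hS'.tendsto_mass self_mem_nhdsWithin ((hT S' (Or.inr rfl)).1 i)
  change Tendsto _ atBot _ at hM hN hM' hN'
  obtain ⟨p1, e1⟩ := hS.isEntropyPotential_of_Iio hp (fun _ _ => rfl) (hq i) t hM hN
  obtain ⟨p2, e2⟩ := hS'.isEntropyPotential_of_Iio hp (fun _ _ => rfl) (hq i) t' hM' hN'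
  have hw := J.w₀_in_pos i
  have d : Tendsto (fun ξ => (M ξ - M' ξ) / (J.w₀ (Sum.inl i) - ξ)) atBot (𝓝 0) := by
    refine tendsto_div_const_sub_atBot hw.le ?_
    simpa only [sub_div, sub_self] using hM.sub hM'
  have z : Tendsto (fun ξ => M ξ - M' ξ) (𝓝[<] 0) (𝓝 0) := by simpa using t.sub t'
  have hMM : ∀ ξ ∈ Iio (0 : ℝ), M ξ = M' ξ := fun ξ hξ =>
    le_antisymm (p1.le_of_Iio hp hw p2 d z ξ hξ)
      (p2.le_of_Iio hp hw p1 (by simpa [← neg_div] using d.neg) (by simpa using z.neg) ξ hξ)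
  exact hS.countable_ne hS' hMM fun ξ hξ => by rw [e1 ξ hξ, e2 ξ hξ, hMM ξ hξ]

/-- Beyond the contact both solutions are the initial state. Between junction and contact, the
potentials agree at both ends and comparison on a bounded interval applies; this interval may be
empty. -/
lemma IsNetworkSolution.countable_ne_outgoing {S S' : NetworkState n m}
    (h : J.IsNetworkSolution S) (h' : J.IsNetworkSolution S') (j : Fin m) :
    {ξ ∈ (road (Sum.inr j : Fin n ⊕ Fin m) : Set ℝ) |
      ¬ (S.ρ (Sum.inr j) ξ 1 = S'.ρ (Sum.inr j) ξ 1 ∧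
        S.ρ (Sum.inr j) ξ 1 * S.w (Sum.inr j) ξ 1 =
          S'.ρ (Sum.inr j) ξ 1 * S'.w (Sum.inr j) ξ 1)}.Countable := by
  obtain ⟨q, hq, hT⟩ := h.exists_flux h'
  obtain ⟨M, N, C, hS, hM, hN⟩ := h.exists_isRoadSolution (Sum.inr j)
  obtain ⟨M', N', C', hS', hM', hN'⟩ := h'.exists_isRoadSolution (Sum.inr j)
  have hp := J.regular_pout j
  have hP := (h.pressure j).regular
  have hb := J.v₀_nonneg j
  obtain ⟨b, hbdef⟩ : ∃ b, b = J.v₀ j := ⟨_, rfl⟩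
  rw [← hbdef] at hb
  have t : Tendsto M (𝓝[>] 0) _ := hS.tendsto_mass self_mem_nhdsWithin ((hT S (Or.inl rfl)).2 j)
  have t' : Tendsto M' (𝓝[>] 0) _ :=
    hS'.tendsto_mass self_mem_nhdsWithin ((hT S' (Or.inr rfl)).2 j)
  change Tendsto _ atTop _ at hM hN hM' hN'
  have hsub : Ioi b ⊆ Ioi (0 : ℝ) := Ioi_subset_Ioi hb
  have vfar : ∀ T : NetworkState n m, ∀ ξ ∈ Ioi b, J.velocity T (Sum.inr j) ξ 1 =
      T.w (Sum.inr j) ξ 1 - J.pout j (T.ρ (Sum.inr j) ξ 1) := fun T ξ hξ => by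
    simp only [velocity, pressureAt, one_mul, ← hbdef, if_neg (not_lt.2 (le_of_lt (mem_Ioi.1 hξ)))]
  have vnear : ∀ T : NetworkState n m, ∀ ξ ∈ Ioo 0 b, J.velocity T (Sum.inr j) ξ 1 =
      T.w (Sum.inr j) ξ 1 - T.P j (T.ρ (Sum.inr j) ξ 1) := fun T ξ hξ => by
    simp only [velocity, pressureAt, one_mul, ← hbdef, if_pos hξ.2]
  have far := (hS.mono isOpen_Ioi hsub).eq_initial_of_Ioi hb hp (vfar S) (J.ρ₀_out_pos j) hbdef.symm
    hM hN
  have far' := (hS'.mono isOpen_Ioi hsub).eq_initial_of_Ioi hb hp (vfar S') (J.ρ₀_out_pos j) hbdef.symm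
    hM' hN'
  obtain ⟨p1, e1⟩ := (hS.mono isOpen_Ioo Ioo_subset_Ioi_self).isEntropyPotential_of_marker hP
    (vnear S) (w := J.wbar j) fun ξ hξ => h.marker j ξ 1 one_pos hξ.1 (by rw [one_mul, ← hbdef]; exact hξ.2)
  obtain ⟨p2, e2⟩ := (hS'.mono isOpen_Ioo Ioo_subset_Ioi_self).isEntropyPotential_of_marker hP
    (fun ξ hξ => by
      rw [vnear S' ξ hξ, h.pressure_eq h' j (h'.ρ_nonneg (Sum.inr j) ξ hξ.1 1 one_pos)])
    (w := J.wbar j) fun ξ hξ => h'.marker j ξ 1 one_pos hξ.1 (by rw [one_mul, ← hbdef]; exact hξ.2)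
  have z : Tendsto (fun ξ => M ξ - M' ξ) (𝓝[>] 0) (𝓝 0) := by simpa using t.sub t'
  -- The pressure law changes at `b`, but the mass potential is continuous across it. Agreement on
  -- the right is thereby passed to the left.
  have zb : 0 < b → Tendsto (fun ξ => M ξ - M' ξ) (𝓝[<] b) (𝓝 0) := by
    intro hb0
    have hc : ContinuousAt (fun ξ => M ξ - M' ξ) b :=
      (hS.mass.continuousOn.sub hS'.mass.continuousOn).continuousAt (Ioi_mem_nhds hb0)
    have h1 : Tendsto (fun ξ => M ξ - M' ξ) (𝓝[>] b) (𝓝 0) := by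
      refine tendsto_const_nhds.congr' ?_
      filter_upwards [self_mem_nhdsWithin] with ξ hξ
      rw [(far ξ hξ).1, (far' ξ hξ).1, sub_self]
    have h2 : M b - M' b = 0 := tendsto_nhds_unique (hc.tendsto.mono_left nhdsWithin_le_nhds) h1
    have h3 := hc.tendsto.mono_left (nhdsWithin_le_nhds (s := Iio b))
    rwa [h2] at h3
  have near : ∀ ξ ∈ Ioo 0 b, M ξ = M' ξ := fun ξ hξ => by
    have zb := zb (hξ.1.trans hξ.2)
    exact le_antisymm (p1.le_of_Ioo (hP.concaveOn _) p2 z zb ξ hξ)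
      (p2.le_of_Ioo (hP.concaveOn _) p1 (by simpa using z.neg) (by simpa using zb.neg) ξ hξ)
  have hU : IsOpen (Ioi 0 \ {b}) := isOpen_Ioi.sdiff isClosed_singleton
  have hUsub : Ioi 0 \ {b} ⊆ Ioi (0 : ℝ) := sdiff_subset
  have cases_U : ∀ ξ ∈ Ioi 0 \ {b}, ξ ∈ Ioo 0 b ∨ b < ξ := fun ξ hξ => by
    rcases lt_or_gt_of_ne (mem_singleton_iff.not.1 hξ.2) with h1 | h1
    · exact Or.inl ⟨hξ.1, h1⟩
    · exact Or.inr h1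
  have hMM : ∀ ξ ∈ Ioi 0 \ {b}, M ξ = M' ξ := fun ξ hξ => by
    rcases cases_U ξ hξ with h1 | h1
    · exact near ξ h1
    · rw [(far ξ h1).1, (far' ξ h1).1]
  have hNN : ∀ ξ ∈ Ioi 0 \ {b}, N ξ = N' ξ := fun ξ hξ => by
    rcases cases_U ξ hξ with h1 | h1
    · rw [e1 ξ h1, e2 ξ h1, near ξ h1]
    · rw [(far ξ h1).2, (far' ξ h1).2, hMM ξ hξ]
  refine (((hS.mono hU hUsub).countable_ne (hS'.mono hU hUsub) hMM hNN).union
    (countable_singleton b)).mono fun ξ hξ => ?_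
  by_cases h1 : ξ = b
  · exact Or.inr h1
  · exact Or.inl ⟨⟨hξ.1, h1⟩, hξ.2⟩

theorem IsNetworkSolution.ae_eq {S S' : NetworkState n m} (h : J.IsNetworkSolution S)
    (h' : J.IsNetworkSolution S') (r : Fin n ⊕ Fin m) {t : ℝ} (ht : 0 < t) :
    ∀ᵐ x : ℝ, x ∈ (road r : Set ℝ) →
      S.ρ r x t = S'.ρ r x t ∧ S.ρ r x t * S.w r x t = S'.ρ r x t * S'.w r x t := by
  have hc : {ξ ∈ (road r : Set ℝ) | ¬ (S.ρ r ξ 1 = S'.ρ r ξ 1 ∧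
      S.ρ r ξ 1 * S.w r ξ 1 = S'.ρ r ξ 1 * S'.w r ξ 1)}.Countable := by
    cases r with
    | inl i => exact h.countable_ne_incoming h' i
    | inr j => exact h.countable_ne_outgoing h' j
  -- At time `t` the exceptional set is a dilation of a countable set, hence null.
  filter_upwards [(hc.image (· * t)).ae_notMem volume] with x hx hxr
  by_contra hne
  obtain ⟨e1, e2⟩ := h.self_similar r x hxr t ht
  obtain ⟨e3, e4⟩ := h'.self_similar r x hxr t ht
  rw [e1, e2, e3, e4] at hne
  exact hx ⟨x / t, ⟨div_mem_road ht hxr, hne⟩, div_mul_cancel₀ x ht.ne'⟩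

end Junction

end TrafficNetwork

/-! ### Main theorem -/

theorem lemma2 {n m : ℕ} (J : TrafficNetwork.Junction n m) :
    (∃ S : TrafficNetwork.NetworkState n m, J.IsNetworkSolution S ∧
      ∀ S' : TrafficNetwork.NetworkState n m, J.IsNetworkSolution S' →
        (∀ r t, 0 < t → ∀ᵐ x : ℝ, x ∈ TrafficNetwork.road r →
          S'.ρ r x t = S.ρ r x t ∧ S'.ρ r x t * S'.w r x t = S.ρ r x t * S.w r x t) ∧
        (∀ j ρ, 0 ≤ ρ → S'.P j ρ = S.P j ρ)) ∧
    (∀ (j : Fin m) (P : ℝ → ℝ), J.IsApproxPressure j P ↔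
      ∀ ρ : ℝ, 0 ≤ ρ → P ρ =
        J.c₀ j * (∑ i, J.β i j * J.w₀ (Sum.inl i) *
          (∑ l, J.β l j / J.w₀ (Sum.inl l) ^ (1 / J.γ)) ^ J.γ) * ρ ^ J.γ) := by
  obtain ⟨S, hS⟩ := J.exists_isNetworkSolution
  exact ⟨⟨S, hS, fun S' hS' => ⟨fun r t ht => hS'.ae_eq hS r ht,
    fun j ρ hρ => hS'.pressure_eq hS j hρ⟩⟩, fun j P => J.isApproxPressure_iff j P⟩
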